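/- **Slices.** For $0\le r\le n$ let $\binom{[n]}{r}=\{x\in\{0,1\}^n:\sum_i x_i=r\}$, with $\langle g,h\rangle=\mathbb E_x[g(x)h(x)]$ for uniform $x\in\binom{[n]}{r}$ and $\|g\|_2^2=\langle g,g\rangle$. A *top set* of length $k$ is an increasing sequence $B=(b_1<\dots<b_k)$ in $[n]$ for which some sequence $A=(a_1,\dots,a_k)$ of distinct elements of $[n]\setminus B$ satisfies $a_i<b_i$ for all $i$; put $\chi_B(x)=\sum_A\prod_{i=1}^k(x_{a_i}-x_{b_i})$, summed over all such $A$. On slices with $r>n/2$, $\chi_B(x)$ is replaced by $\chi_B(\bar x)$, where $\bar x$ is the complement of $x$. For $f:\{0,1\}^n\to\{\pm1\}$ let $f|_r$ be its restriction to $\binom{[n]}{r}$, $\widehat{f|_r}(B)=\langle f|_r,\chi_B\rangle/\|\chi_B\|_2^2$, and $\mathbf W^{>d}(f|_r)=\sum_B\widehat{f|_r}(B)^2\|\chi_B\|_2^2$ over the top sets $B$ of length $k$ with $d<k\le\min(r,n-r)$. The function $f$ is $(t,d,\varepsilon)$-*concentrated* if $\mathbf W^{>d}(f|_r)<\varepsilon$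 for some integer $0\le r\le n$ with $n/2-t/2\le r\le n/2+t/2$. **Algorithm** (parameters $C,n,t,d$; access to independent uniformly random examples $(x,f(x))$ and to random bits). Every estimate below is the average over those of $n^{3C\lfloor d\rfloor}$ fresh random examples that lie in the relevant part of the cube; for large $C$ this suffices for accuracy $n^{-C\lfloor d\rfloor}$. For each integer $r\in[n/2-t/2,\,n/2+t/2]\cap[0,n]$, in increasing order: 1. For every top set $B$ of length at most $d$, estimate $\langle f|_r,\chi_B\rangle$, and from it $\widehat{f|_r}(B)$; let $S$ be the sum of the resulting estimates of $\widehat{f|_r}(B)^2\|\chi_B\|_2^2$. 2. If $S\ge 3/8$, let $g=\sum_{|B|\le d}\widehat{f|_r}(B)\chi_B$ with the estimated coefficients. Set $p=1$; while $p>\sqrt3/4$, pick $\theta$ uniformly at random in $[-1,1]$ (on the grid of the $2^n$ points $-1+2j/2^n$, $0\le j<2^n$) and let $p$ be an estimate of $\Pr[f|_r\ne\operatorname{sgn}(g-\theta)]$. Then estimate $\mu=\mathbb E[f(x)\mid\sum_i x_i\ne r]$, and halt with the hypothesis $h(x)=\operatorname{sgn}(g(x)-\theta)$ if $\sum_i x_i=r$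 and $h(x)=\operatorname{sgn}(\mu)$ otherwise. Here $\operatorname{sgn}(0)=1$. If no $r$ gives $S\ge3/8$, halt with $h\equiv0$. Time is counted on a machine with truth values, rational numbers, lists and pairs, in which an arithmetic operation or comparison costs the square of one plus the bit length of its operands, a random example costs $n+1$, writing down a constant costs one plus its bit length, and every other elementary step (a random bit, a list or pair operation, a branch, a round of a loop) costs $1$. **Proposition.** For every real $a$ there are $c,C_0\in\mathbb N$ such that for every integer $C\ge C_0$ there is a real $K$ with the following property. Let $t=t(n)$ and $d=d(n)$ be real sequences with $|t|\le a\sqrt{n\log n}$ and $d\ge1$ for all large $n$, and $d=o(n/\log n)$. Then for all sufficiently large $n$ and every $(t,d,1/2)$-concentrated $f:\{0,1\}^n\to\{\pm1\}$, with probability at least $1-1/n$ over the random examples and the random bits, the algorithm halts within $2^{K(d\log n+t^2/n)}$ steps and its hypothesis $h$ satisfies $$\Pr_{x\in\{0,1\}^n}[f(x)\ne h(x)]\le\frac12-\frac1{n^c}.$$ That is, for $t=O(\sqrt{n\log n})$ and $d=o(n/\log n)$ the algorithm weakly learns the $(t,d,1/2)$-concentrated functions in time $2^{O(d\log n+t^2/n)}$.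 -/

import Mathlib

namespace SliceLearner

/-! ## Slices of the Boolean cube and their Young-Fourier expansion

Coordinates are indexed by `Fin n`.  Only the order of the coordinates matters for top sets and for
the functions `chi`, so that starting at `0` instead of `1` changes nothing. -/

/-- The Boolean cube `{0,1}^n`. -/
abbrev Cube (n : ℕ) : Type := Fin n → Bool

/-- The coordinate `x i` as a real number, `0` or `1`. -/
def bit {n : ℕ} (x : Cube n) (i : Fin n) : ℝ := if x i then 1 else 0

/-- The Hamming weight of `x`. -/
def weight {n : ℕ} (x : Cube n) : ℕ := (Finset.univ.filter fun i => x i = true).card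

/-- The slice of all points of weight `r`. -/
def slice (n r : ℕ) : Finset (Cube n) := Finset.univ.filter fun x => weight x = r

/-- `A` is a sequence of distinct coordinates, disjoint from `B`, with `A i < B i` for all `i`. -/
def IsBelow {n k : ℕ} (A B : Fin k → Fin n) : Prop :=
  Function.Injective A ∧ (∀ i j, A i ≠ B j) ∧ ∀ i, A i < B i

/-- `B` is a top set of length `k`, written as an increasing sequence. -/
def IsTopSet {n k : ℕ} (B : Fin k → Fin n) : Prop :=
  StrictMono B ∧ ∃ A : Fin k → Fin n, IsBelow A B

open Classical in
/-- The top sets of length `k`. -/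
noncomputable def topSets (n k : ℕ) : Finset (Fin k → Fin n) :=
  Finset.univ.filter fun B => IsTopSet B

/-- `χ_{A,B}(x) = ∏ i, (x_{A i} - x_{B i})`. -/
def chiPair {n k : ℕ} (A B : Fin k → Fin n) (x : Cube n) : ℝ :=
  ∏ i, (bit x (A i) - bit x (B i))

open Classical in
/-- `χ_B`, the sum of `χ_{A,B}` over all sequences `A < B` disjoint from `B`. -/
noncomputable def chi {n k : ℕ} (B : Fin k → Fin n) (x : Cube n) : ℝ :=
  ∑ A ∈ Finset.univ.filter (fun A : Fin k → Fin n => IsBelow A B), chiPair A B x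

/-- The basis function attached to `B` on the slice of weight `r`: `χ_B(x)` when `r ≤ n / 2`, and
`χ_B` at the complement of `x` when `r > n / 2`. -/
noncomputable def basis {n k : ℕ} (r : ℕ) (B : Fin k → Fin n) (x : Cube n) : ℝ :=
  if 2 * r ≤ n then chi B x else chi B (fun i => !x i)

/-- `⟨g, h⟩`, the expectation of `g * h` under the uniform distribution on the slice. -/
noncomputable def sliceInner {n : ℕ} (r : ℕ) (g h : Cube n → ℝ) : ℝ :=
  (∑ x ∈ slice n r, g x * h x) / (slice n r).card

/-- The Young-Fourier coefficient of `g` restricted to the slice of weight `r`. -/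
noncomputable def fourierCoeff {n k : ℕ} (r : ℕ) (g : Cube n → ℝ) (B : Fin k → Fin n) : ℝ :=
  sliceInner r g (basis r B) / sliceInner r (basis r B) (basis r B)

/-- The weight `W^k` of `g` on the slice of weight `r`. -/
noncomputable def levelWeight {n : ℕ} (r k : ℕ) (g : Cube n → ℝ) : ℝ :=
  ∑ B ∈ topSets n k, fourierCoeff r g B ^ 2 * sliceInner r (basis r B) (basis r B)

/-- The weight `W^{>d}` of `g` on the slice of weight `r`; the levels of that slice are
`0, …, min r (n - r)`. -/
noncomputable def tailWeight {n : ℕ} (r : ℕ) (d : ℝ) (g : Cube n → ℝ) : ℝ :=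
  ∑ k ∈ (Finset.range (min r (n - r) + 1)).filter (fun k : ℕ => d < (k : ℝ)), levelWeight r k g

/-- A function to `{1, -1}` (the type `ℤˣ`) as a real-valued function. -/
def toReal {n : ℕ} (f : Cube n → ℤˣ) (x : Cube n) : ℝ := ((f x : ℤ) : ℝ)

/-- `f` is `(t, d, ε)`-concentrated. -/
def IsConcentrated {n : ℕ} (f : Cube n → ℤˣ) (t d ε : ℝ) : Prop :=
  ∃ r : ℕ, r ≤ n ∧ (n : ℝ) / 2 - t / 2 ≤ r ∧ (r : ℝ) ≤ n / 2 + t / 2 ∧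
    tailWeight r d (toReal f) < ε

/-! ## Programs with random examples and random bits, and their running time

A program is written against an abstract family `V` of values, one type for each data type `Ty`, so
that it can look at and compute with data by means of the instructions `Op` only, and the only
control structures are a conditional and a loop.  Every instruction, every conditional
and every round of a loop is charged. -/

/-- The data types: truth values, rational numbers, lists and pairs. -/
inductive Ty : Type
  | bool : Ty
  | num : Ty
  | list : Ty → Ty
  | prod : Ty → Ty → Ty

/-- The values of a data type. -/
abbrev Ty.denote : Ty → Type
  | .bool => Bool
  | .num => ℚ
  | .list σ => List σ.denote
  | .prod σ τ => σ.denote × τ.denote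

/-- The value of `head` at an empty list. -/
def Ty.dflt : (τ : Ty) → τ.denote
  | .bool => false
  | .num => (0 : ℚ)
  | .list _ => []
  | .prod σ τ => (σ.dflt, τ.dflt)

/-- The instructions.  `sample` obtains a random example `(x, f x)` and `flip` a random bit. -/
inductive Op (V : Ty → Type) : Ty → Type
  | lit (q : ℚ) : Op V .num
  | tt : Op V .bool
  | ff : Op V .bool
  | plus (x y : V .num) : Op V .num
  | minus (x y : V .num) : Op V .num
  | times (x y : V .num) : Op V .num
  | divide (x y : V .num) : Op V .num
  | le (x y : V .num) : Op V .bool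
  | nil {σ : Ty} : Op V (.list σ)
  | cons {σ : Ty} (x : V σ) (l : V (.list σ)) : Op V (.list σ)
  | isNil {σ : Ty} (l : V (.list σ)) : Op V .bool
  | head {σ : Ty} (l : V (.list σ)) : Op V σ
  | tail {σ : Ty} (l : V (.list σ)) : Op V (.list σ)
  | pair {σ τ : Ty} (x : V σ) (y : V τ) : Op V (.prod σ τ)
  | fst {σ τ : Ty} (p : V (.prod σ τ)) : Op V σ
  | snd {σ τ : Ty} (p : V (.prod σ τ)) : Op V τ
  | sample : Op V (.prod (.list .num) .num)
  | flip : Op V .bool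

/-- Programs with result in `α`.  The loop `iter body x k` runs `body x`; if that yields `inl y`, it
goes on with `y` in place of `x`, and if it yields `inr z`, it continues with `k z`. -/
inductive Prog (V : Ty → Type) : Type → Type 1
  | ret {α : Type} (a : α) : Prog V α
  | op {α : Type} {τ : Ty} (o : Op V τ) (k : V τ → Prog V α) : Prog V α
  | branch {α : Type} (b : V .bool) (p q : Prog V α) : Prog V α
  | iter {α ρ : Type} {σ : Ty} (body : V σ → Prog V (V σ ⊕ ρ)) (x : V σ) (k : ρ → Prog V α) :
      Prog V α

/-- Sequential composition. -/
def Prog.bind {V : Ty → Type} {α β : Type} : Prog V α → (α → Prog V β) → Prog V β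
  | .ret a, g => g a
  | .op o k, g => .op o fun v => (k v).bind g
  | .branch b p q, g => .branch b (p.bind g) (q.bind g)
  | .iter body x k, g => .iter body x fun z => (k z).bind g

instance {V : Ty → Type} : Monad (Prog V) where
  pure := Prog.ret
  bind := Prog.bind

/-- What a run can draw from: a sequence of examples and a sequence of bits. -/
structure Env : Type where
  example_ : ℕ → (Ty.prod (.list .num) .num).denote
  coin : ℕ → Bool

/-- The examples and bits used so far, and the time used so far. -/
structure State : Type where
  examples : ℕ
  coins : ℕ
  time : ℕ

/-- Let `m` time steps pass. -/
def State.tick (s : State) (m : ℕ) : State := { s with time := s.time + m }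

/-- The number of binary digits of numerator and denominator. -/
def bitSize (q : ℚ) : ℕ := q.num.natAbs.size + q.den.size

/-- The charge for an arithmetic operation: quadratic in the length of the operands, as for
schoolbook arithmetic and the Euclidean algorithm. -/
def arithCost (x y : ℚ) : ℕ := (1 + bitSize x + bitSize y) ^ 2

/-- The effect of an instruction.  List and pair instructions manipulate pointers and cost `1`;
an example costs its length; drawing a bit costs `1`. -/
def Op.exec (E : Env) (s : State) : {τ : Ty} → Op Ty.denote τ → τ.denote × State
  | _, .lit q => (q, s.tick (1 + bitSize q))
  | _, .tt => (true, s.tick 1)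
  | _, .ff => (false, s.tick 1)
  | _, .plus x y => ((x + y : ℚ), s.tick (arithCost x y))
  | _, .minus x y => ((x - y : ℚ), s.tick (arithCost x y))
  | _, .times x y => ((x * y : ℚ), s.tick (arithCost x y))
  | _, .divide x y => ((x / y : ℚ), s.tick (arithCost x y))
  | _, .le (x : ℚ) (y : ℚ) => (decide (x ≤ y), s.tick (arithCost x y))
  | _, .nil => ([], s.tick 1)
  | _, .cons x l => (List.cons x l, s.tick 1)
  | _, .isNil l => (List.isEmpty l, s.tick 1)
  | τ, .head l => (List.headD l τ.dflt, s.tick 1)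
  | _, .tail l => (List.tail l, s.tick 1)
  | _, .pair x y => (Prod.mk x y, s.tick 1)
  | _, .fst p => (Prod.fst p, s.tick 1)
  | _, .snd p => (Prod.snd p, s.tick 1)
  | _, .sample =>
      (E.example_ s.examples,
        { s with examples := s.examples + 1
                 time := s.time + ((E.example_ s.examples).1.length + 1) })
  | _, .flip => (E.coin s.coins, { s with coins := s.coins + 1, time := s.time + 1 })

/-- `Eval E p s a s'`: the program `p`, started in state `s`, halts with result `a` in state `s'`. -/
inductive Eval (E : Env) :
    {α : Type} → Prog Ty.denote α → State → α → State → Prop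
  | ret {α : Type} (a : α) (s : State) : Eval E (.ret a) s a s
  | op {α : Type} {τ : Ty} (o : Op Ty.denote τ) (k : τ.denote → Prog Ty.denote α)
      (s : State) (a : α) (s' : State)
      (h : Eval E (k (o.exec E s).1) (o.exec E s).2 a s') : Eval E (.op o k) s a s'
  | branch {α : Type} (b : Bool) (p q : Prog Ty.denote α) (s : State) (a : α) (s' : State)
      (h : Eval E (cond b p q) (s.tick 1) a s') : Eval E (.branch b p q) s a s'
  | again {α ρ : Type} {σ : Ty} (body : σ.denote → Prog Ty.denote (σ.denote ⊕ ρ))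
      (x y : σ.denote) (k : ρ → Prog Ty.denote α) (s s₁ s₂ : State) (a : α)
      (h₁ : Eval E (body x) (s.tick 1) (.inl y) s₁)
      (h₂ : Eval E (.iter body y k) s₁ a s₂) : Eval E (.iter body x k) s a s₂
  | done {α ρ : Type} {σ : Ty} (body : σ.denote → Prog Ty.denote (σ.denote ⊕ ρ))
      (x : σ.denote) (z : ρ) (k : ρ → Prog Ty.denote α) (s s₁ s₂ : State) (a : α)
      (h₁ : Eval E (body x) (s.tick 1) (.inr z) s₁)
      (h₂ : Eval E (k z) s₁ a s₂) : Eval E (.iter body x k) s a s₂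

/-- Result, resources and running time of a program are determined by the random choices. -/
theorem Eval.unique (E : Env) {α : Type} {p : Prog Ty.denote α} {s : State} {a : α} {s' : State}
    (h : Eval E p s a s') : ∀ b s'', Eval E p s b s'' → a = b ∧ s' = s'' := by
  induction h with
  | ret a s => intro b s'' h; cases h; simp
  | op o k s a s' h ih => intro b s'' h; cases h; exact ih _ _ (by assumption)
  | branch o k s a s' h i ih => intro b s'' h; cases h; exact ih _ _ (by assumption)
  | again body x y k s s₁ s₂ a h₁ h₂ ih₁ ih₂ =>
    intro b s'' h
    cases h with
    | again _ _ y' _ _ t₁ _ _ g₁ g₂ =>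
      obtain ⟨e, rfl⟩ := ih₁ _ _ g₁
      cases e
      exact ih₂ _ _ g₂
    | done _ _ z' _ _ t₁ _ _ g₁ g₂ =>
      have e := (ih₁ _ _ g₁).1
      simp at e
  | done body x z k s s₁ s₂ a h₁ h₂ ih₁ ih₂ =>
    intro b s'' h
    cases h with
    | again _ _ y' _ _ t₁ _ _ g₁ g₂ =>
      have e := (ih₁ _ _ g₁).1
      simp at e
    | done _ _ z' _ _ t₁ _ _ g₁ g₂ =>
      obtain ⟨e, rfl⟩ := ih₁ _ _ g₁
      cases e
      exact ih₂ _ _ g₂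

/-! ## The learning algorithm -/

section Programs

variable {V : Ty → Type}

/-- A single instruction as a program. -/
def instr {τ : Ty} (o : Op V τ) : Prog V (V τ) := .op o .ret

def lit (q : ℚ) : Prog V (V .num) := instr (.lit q)
def tt : Prog V (V .bool) := instr .tt
def ff : Prog V (V .bool) := instr .ff
def plus (x y : V .num) : Prog V (V .num) := instr (.plus x y)
def minus (x y : V .num) : Prog V (V .num) := instr (.minus x y)
def times (x y : V .num) : Prog V (V .num) := instr (.times x y)
def divide (x y : V .num) : Prog V (V .num) := instr (.divide x y)
def nil {σ : Ty} : Prog V (V (.list σ)) := instr .nil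
def cons {σ : Ty} (x : V σ) (l : V (.list σ)) : Prog V (V (.list σ)) := instr (.cons x l)
def isNil {σ : Ty} (l : V (.list σ)) : Prog V (V .bool) := instr (.isNil l)
def head {σ : Ty} (l : V (.list σ)) : Prog V (V σ) := instr (.head l)
def tail {σ : Ty} (l : V (.list σ)) : Prog V (V (.list σ)) := instr (.tail l)
def pair {σ τ : Ty} (x : V σ) (y : V τ) : Prog V (V (.prod σ τ)) := instr (.pair x y)
def fst {σ τ : Ty} (p : V (.prod σ τ)) : Prog V (V σ) := instr (.fst p)
def snd {σ τ : Ty} (p : V (.prod σ τ)) : Prog V (V τ) := instr (.snd p)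
def sample : Prog V (V (.prod (.list .num) .num)) := instr .sample
def flip : Prog V (V .bool) := instr .flip

/-- If `x ≤ y` then `p` else `q`. -/
def ifLe {α : Type} (x y : V .num) (p q : Prog V α) : Prog V α :=
  .op (.le x y) fun b => .branch b p q

/-- If `x < y` then `p` else `q`. -/
def ifLt {α : Type} (x y : V .num) (p q : Prog V α) : Prog V α := ifLe y x q p

/-- If `x = y` then `p` else `q`. -/
def ifEq {α : Type} (x y : V .num) (p q : Prog V α) : Prog V α :=
  ifLe x y (ifLe y x p q) q

/-- Run through the list `l` from its head, updating an accumulator that starts as `a`. -/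
def fold {σ ρ : Ty} (l : V (.list σ)) (a : V ρ) (body : V ρ → V σ → Prog V (V ρ)) :
    Prog V (V ρ) := do
  let s₀ ← pair l a
  .iter (fun s => do
    let l ← fst s
    let a ← snd s
    let e ← isNil l
    .branch e (pure (.inr a)) (do
      let x ← head l
      let l' ← tail l
      let a' ← body a x
      let s' ← pair l' a'
      pure (.inl s'))) s₀ .ret

/-- Run through two lists of the same length in parallel. -/
def fold₂ {σ τ ρ : Ty} (l : V (.list σ)) (m : V (.list τ)) (a : V ρ)
    (body : V ρ → V σ → V τ → Prog V (V ρ)) : Prog V (V ρ) := do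
  let s₀ ← pair l a
  let s₁ ← fold m s₀ fun s y => do
    let l ← fst s
    let a ← snd s
    let x ← head l
    let l' ← tail l
    let a' ← body a x y
    pair l' a'
  snd s₁

/-- Update an accumulator `m` times. -/
def repeatTimes {ρ : Ty} (m : V .num) (a : V ρ) (body : V ρ → Prog V (V ρ)) :
    Prog V (V ρ) := do
  let zero ← lit 0
  let one ← lit 1
  let s₀ ← pair m a
  .iter (fun s => do
    let m ← fst s
    let a ← snd s
    ifLe m zero (pure (.inr a)) (do
      let m' ← minus m one
      let a' ← body a
      let s' ← pair m' a'
      pure (.inl s'))) s₀ .ret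

/-- `x ^ m`. -/
def power (x m : V .num) : Prog V (V .num) := do
  let one ← lit 1
  repeatTimes m one fun y => times y x

def length {σ : Ty} (l : V (.list σ)) : Prog V (V .num) := do
  let zero ← lit 0
  let one ← lit 1
  fold l zero fun m _ => plus m one

def reverse {σ : Ty} (l : V (.list σ)) : Prog V (V (.list σ)) := do
  let e ← nil
  fold l e fun m x => cons x m

/-- The list `[1, …, n]` of all coordinates. -/
def coordinates (n : V .num) : Prog V (V (.list .num)) := do
  let one ← lit 1
  let e ← nil
  let s₀ ← pair n e
  let s₁ ← repeatTimes n s₀ fun s => do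
    let i ← fst s
    let l ← snd s
    let l' ← cons i l
    let i' ← minus i one
    pair i' l'
  snd s₁

/-- Whether `j` occurs in `l`. -/
def member (j : V .num) (l : V (.list .num)) : Prog V (V .bool) := do
  let b ← ff
  fold l b fun b i => ifEq i j tt (pure b)

/-- The list of all sequences of `k` distinct coordinates. -/
def sequences (n k : V .num) : Prog V (V (.list (.list .num))) := do
  let coords ← coordinates n
  let e ← nil
  let e' ← nil
  let one ← cons e e'
  repeatTimes k one fun seqs => do
    let out₀ ← nil
    fold seqs out₀ fun out s =>
      fold coords out fun out j => do
        let b ← member j s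
        .branch b (pure out) (do
          let s' ← cons j s
          cons s' out)

/-- Whether `A` is disjoint from `B` and `a_i < b_i` for all `i`. -/
def below (A B : V (.list .num)) : Prog V (V .bool) := do
  let b₀ ← tt
  fold₂ A B b₀ fun b x y => do
    let m ← member x B
    .branch m ff (ifLt x y (pure b) ff)

/-- The list of all sequences `A < B` disjoint from `B`. -/
def allBelow (n : V .num) (B : V (.list .num)) : Prog V (V (.list (.list .num))) := do
  let k ← length B
  let seqs ← sequences n k
  let e ← nil
  fold seqs e fun out A => do
    let b ← below A B
    .branch b (cons A out) (pure out)

/-- Whether `B` is increasing. -/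
def increasing (B : V (.list .num)) : Prog V (V .bool) := do
  let zero ← lit 0
  let t ← tt
  let s₀ ← pair zero t
  let s₁ ← fold B s₀ fun s y => do
    let x ← fst s
    let b ← snd s
    let b' ← ifLt x y (pure b) ff
    pair y b'
  snd s₁

/-- The list of all top sets of length at most `d`. -/
def allTopSets (n d : V .num) : Prog V (V (.list (.list .num))) := do
  let zero ← lit 0
  let one ← lit 1
  let m ← plus d one
  let e ← nil
  let s₀ ← pair zero e
  let s₁ ← repeatTimes m s₀ fun s => do
    let k ← fst s
    let out₀ ← snd s
    let seqs ← sequences n k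
    let out₁ ← fold seqs out₀ fun out B => do
      let inc ← increasing B
      .branch inc (do
        let As ← allBelow n B
        let none_ ← isNil As
        .branch none_ (pure out) (cons B out)) (pure out)
    let k' ← plus k one
    pair k' out₁
  snd s₁

/-- The coordinate of `x` with number `i`. -/
def coordinate (x : V (.list .num)) (i : V .num) : Prog V (V .num) := do
  let one ← lit 1
  let m ← minus i one
  let l ← repeatTimes m x fun l => tail l
  head l

/-- `χ_{A,B}(x)`. -/
def evalChiPair (x A B : V (.list .num)) : Prog V (V .num) := do
  let one ← lit 1
  fold₂ A B one fun p a b => do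
    let xa ← coordinate x a
    let xb ← coordinate x b
    let u ← minus xa xb
    times p u

/-- `χ_B(x)`, by enumeration of all sequences `A`. -/
def evalChi (n : V .num) (B x : V (.list .num)) : Prog V (V .num) := do
  let zero ← lit 0
  let As ← allBelow n B
  fold As zero fun s A => do
    let u ← evalChiPair x A B
    plus s u

/-- The complement of `x`. -/
def complement (x : V (.list .num)) : Prog V (V (.list .num)) := do
  let one ← lit 1
  let e ← nil
  let l ← fold x e fun l u => do
    let u' ← minus one u
    cons u' l
  reverse l

/-- The value at `x` of the basis function of `B` for the slice of weight `r`. -/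
def evalBasis (n r : V .num) (B x : V (.list .num)) : Prog V (V .num) := do
  let r₂ ← plus r r
  ifLe r₂ n (evalChi n B x) (do
    let y ← complement x
    evalChi n B y)

/-- The squared norm of `χ_B` on the slice of weight `r`, by the closed formula
`∏ i < k, (b_i - 2 i) (b_i - 2 i - 1) (r - i) (n - r - i) / ((n - 2 i) (n - 2 i - 1))`, where the
entries `b_0, …, b_{k-1}` of `B` are numbers between `1` and `n`. -/
def normSquare (n r : V .num) (B : V (.list .num)) : Prog V (V .num) := do
  let zero ← lit 0
  let one ← lit 1
  let co ← minus n r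
  let s₀ ← pair zero one
  let s₁ ← fold B s₀ fun s b => do
    let i ← fst s
    let p ← snd s
    let i₂ ← plus i i
    let u ← minus b i₂
    let u' ← minus u one
    let v ← minus r i
    let w ← minus co i
    let m ← minus n i₂
    let m' ← minus m one
    let q₁ ← times u u'
    let q₂ ← times v w
    let q₃ ← times q₁ q₂
    let q₄ ← times m m'
    let q ← divide q₃ q₄
    let p' ← times p q
    let i' ← plus i one
    pair i' p'
  snd s₁

/-- Whether `x` has weight `r`. -/
def onSlice (r : V .num) (x : V (.list .num)) : Prog V (V .bool) := do
  let zero ← lit 0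
  let w ← fold x zero fun s u => plus s u
  ifEq w r tt ff

/-- Draw `m` random examples `(x, y)` and return the average of `value x y` over those with
`keep x` (`0` if there are none). -/
def average (m : V .num) (keep : V (.list .num) → Prog V (V .bool))
    (value : V (.list .num) → V .num → Prog V (V .num)) : Prog V (V .num) := do
  let zero ← lit 0
  let one ← lit 1
  let s₀ ← pair zero zero
  let s₁ ← repeatTimes m s₀ fun s => do
    let e ← sample
    let x ← fst e
    let y ← snd e
    let b ← keep x
    .branch b (do
      let v ← value x y
      let sum ← fst s
      let cnt ← snd s
      let sum' ← plus sum v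
      let cnt' ← plus cnt one
      pair sum' cnt') (pure s)
  let sum ← fst s₁
  let cnt ← snd s₁
  divide sum cnt

/-- Estimate `⟨f, χ_B⟩` on the slice of weight `r` from `m` random examples. -/
def estimateInner (m n r : V .num) (B : V (.list .num)) : Prog V (V .num) :=
  average m (onSlice r) fun x y => do
    let u ← evalBasis n r B x
    times y u

/-- The value at `x` of a combination of basis functions, given as a list of pairs of a top set and
a coefficient. -/
def evalCombination (n r : V .num) (g : V (.list (.prod (.list .num) .num)))
    (x : V (.list .num)) : Prog V (V .num) := do
  let zero ← lit 0
  fold g zero fun s e => do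
    let B ← fst e
    let c ← snd e
    let u ← evalBasis n r B x
    let v ← times c u
    plus s v

/-- `1` if `z ≥ 0` and `-1` if `z < 0`. -/
def signum (z : V .num) : Prog V (V .num) := do
  let zero ← lit 0
  ifLe zero z (lit 1) (lit (-1))

/-- A uniformly random point of the grid of the `2 ^ n` points `-1 + j * 2 / 2 ^ n`, `j < 2 ^ n`, in
`[-1, 1]`. -/
def randomThreshold (n : V .num) : Prog V (V .num) := do
  let one ← lit 1
  let two ← lit 2
  let θ₀ ← lit (-1)
  let s₀ ← pair one θ₀
  let s₁ ← repeatTimes n s₀ fun s => do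
    let w ← fst s
    let θ ← snd s
    let w' ← divide w two
    let b ← flip
    .branch b (do
      let θ' ← plus θ w
      pair w' θ') (pair w' θ)
  snd s₁

/-- Estimate the probability that `f` differs from `sgn (g - θ)` on the slice of weight `r`. -/
def estimateError (m n r : V .num) (g : V (.list (.prod (.list .num) .num))) (θ : V .num) :
    Prog V (V .num) := do
  let zero ← lit 0
  let one ← lit 1
  average m (onSlice r) fun x y => do
    let u ← evalCombination n r g x
    let v ← minus u θ
    let h ← signum v
    ifEq y h (pure zero) (pure one)

/-- Starting from `p = 1`: while `p > √3 / 4`, pick a random threshold `θ` and let `p` be an estimate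
of the error of `sgn (g - θ)`.  Return the last threshold. -/
def findThreshold (m n r : V .num) (g : V (.list (.prod (.list .num) .num))) :
    Prog V (V .num) := do
  let one ← lit 1
  let three ← lit 3
  let sixteen ← lit 16
  let s₀ ← pair one one
  .iter (fun s => do
    let p ← fst s
    let θ ← snd s
    let p₂ ← times p p
    let p₃ ← times sixteen p₂
    ifLe p₃ three (pure (.inr θ)) (do
      let θ' ← randomThreshold n
      let p' ← estimateError m n r g θ'
      let s' ← pair p' θ'
      pure (.inl s'))) s₀ .ret

/-- Estimate the expectation of `f x` over the points `x` of weight different from `r`. -/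
def estimateOff (m r : V .num) : Prog V (V .num) :=
  average m (fun x => do
    let b ← onSlice r x
    .branch b ff tt) fun _ y => pure y

/-- The description of a hypothesis: the weight of the slice, the combination of basis functions
(a list of pairs of a top set and a coefficient), the threshold, and the value elsewhere. -/
structure Hypothesis (V : Ty → Type) : Type where
  slice : V .num
  poly : V (.list (.prod (.list .num) .num))
  threshold : V .num
  elsewhere : V .num

/-- The weak learner for functions that are concentrated up to level `d` on some slice of weight
between `n / 2 - t / 2` and `n / 2 + t / 2`.  Every estimate uses `n ^ (3 C d)` random examples,
which for large `C` is enough for accuracy `n ^ (- C d)`.  The result `none` stands for the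
hypothesis that is identically `0`. -/
def learner (C n t d : V .num) : Prog V (Option (Hypothesis V)) := do
  let zero ← lit 0
  let one ← lit 1
  let three ← lit 3
  let bound ← lit (3 / 8)
  let c₁ ← times three C
  let c₂ ← times c₁ d
  let m ← power n c₂
  let tops ← allTopSets n d
  .iter (fun r => do
    let next ← plus r one
    ifLt n r (pure (.inr none)) (do
      let r₂ ← plus r r
      let u ← minus r₂ n
      let v ← minus n r₂
      ifLt t u (pure (.inl next)) (ifLt t v (pure (.inl next)) (do
        let g₀ ← nil
        let s₀ ← pair zero g₀
        let s₁ ← fold tops s₀ fun s B => do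
          let S ← fst s
          let g ← snd s
          let q ← normSquare n r B
          let e ← estimateInner m n r B
          let c ← divide e q
          let w ← times e c
          let S' ← plus S w
          let p ← pair B c
          let g' ← cons p g
          pair S' g'
        let S ← fst s₁
        let g ← snd s₁
        ifLe bound S (do
          let θ ← findThreshold m n r g
          let μ ← estimateOff m r
          let sg ← signum μ
          pure (.inr (some ⟨r, g, θ, sg⟩))) (pure (.inl next)))))) zero .ret

end Programs

/-! ## What it means that the algorithm succeeds -/

/-- The notation of a sequence of coordinates as a list of numbers between `1` and `n`. -/
def encode {n k : ℕ} (B : Fin k → Fin n) : List ℚ := List.ofFn fun i => ((B i : ℕ) : ℚ) + 1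

/-- The coefficient of `χ_B` in a list of pairs of a top set and a coefficient. -/
def coefficient {n k : ℕ} (g : List (List ℚ × ℚ)) (B : Fin k → Fin n) : ℝ :=
  (((g.filter fun e => e.1 = encode B).map Prod.snd).sum : ℚ)

/-- The function `g(x) = ∑_B ĝ(B) χ_B(x)` that such a list describes on the slice of weight `r`. -/
noncomputable def polyValue {n : ℕ} (r : ℕ) (g : List (List ℚ × ℚ)) (x : Cube n) : ℝ :=
  ∑ k ∈ Finset.range (n + 1), ∑ B ∈ topSets n k, coefficient g B * basis r B x

/-- The function that the result of the algorithm describes: `sgn (g(x) - θ)` on the slice that was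
found, a constant elsewhere. -/
noncomputable def hypothesisValue {n : ℕ} : Option (Hypothesis Ty.denote) → Cube n → ℝ
  | none, _ => 0
  | some H, x =>
      if ((weight x : ℕ) : ℚ) = H.slice then
        (if (H.threshold : ℚ) ≤ polyValue (weight x) H.poly x then 1 else -1)
      else ((H.elsewhere : ℚ) : ℝ)

/-- `Pr[f(x) ≠ h(x)]` for uniformly random `x`. -/
noncomputable def errorProb {n : ℕ} (f : Cube n → ℤˣ) (h : Cube n → ℝ) : ℝ :=
  ((Finset.univ.filter fun x => toReal f x ≠ h x).card : ℝ) / 2 ^ n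

/-- The random choices: the points of the examples and the random bits. -/
abbrev Tape (n : ℕ) : Type := (ℕ → Cube n) × (ℕ → Bool)

/-- All points and all bits are independent and uniformly distributed. -/
noncomputable def tapeMeasure (n : ℕ) : MeasureTheory.Measure (Tape n) :=
  (MeasureTheory.Measure.infinitePi fun _ : ℕ => (PMF.uniformOfFintype (Cube n)).toMeasure).prod
    (MeasureTheory.Measure.infinitePi fun _ : ℕ => (PMF.uniformOfFintype Bool).toMeasure)

/-- The examples `(x, f x)`, with `x` as a list of `n` numbers `0` or `1`. -/
def env {n : ℕ} (f : Cube n → ℤˣ) (ω : Tape n) : Env where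
  example_ i := (List.ofFn fun j => if ω.1 i j then (1 : ℚ) else 0, ((f (ω.1 i) : ℤ) : ℚ))
  coin := ω.2

/-- On the random choices `ω`, the learner with parameters `C, n, ⌊t⌋, ⌊d⌋` halts after at most `N`
steps, and its hypothesis has error at most `1 / 2 - γ`. -/
def Succeeds {n : ℕ} (C : ℕ) (t d : ℝ) (f : Cube n → ℤˣ) (N γ : ℝ) (ω : Tape n) : Prop :=
  ∃ (H : Option (Hypothesis Ty.denote)) (s : State),
    Eval (env f ω) (learner (V := Ty.denote) (C : ℚ) (n : ℚ) (⌊t⌋₊ : ℚ) (⌊d⌋₊ : ℚ))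
      ⟨0, 0, 0⟩ H s ∧
    (s.time : ℝ) ≤ N ∧ errorProb f (hypothesisValue H) ≤ 1 / 2 - γ

end SliceLearner

/-! On each slice the functions `χ_B` that do not vanish there form an orthogonal basis with
explicit norms. If `f` is concentrated on a slice, more than half of its squared norm there (which
is `1`) sits on levels at most `D = ⌊d⌋`. Let `S` be the estimated low-level weight and `g` the
combination with estimated coefficients. When all inner products are known up to `n ^ (-6 D)`, then
`S` is correct up to `3 / n`, and `‖f - g‖² ≤ 1 - S + 4 / n`. So the concentrated slice passes the
test `S ≥ 3 / 8`, and any slice that passes it has `‖f - g‖² ≤ 63 / 100`, whether or not `f` is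
concentrated there.

For `θ` uniform in `[-1, 1]`, a value `y` and a sign `σ`, the probability that `sgn (y - θ) ≠ σ` is
at most `|σ - y| / 2`. Hence the mean error of `sgn (g - θ)` on the slice is at most about `E|f - g|
/ 2`, which is below `2 / 5`; by Markov a fraction at least `3 / 50` of the thresholds has error at
most `43 / 100 < √3 / 4`, and `n` independent rounds all fail with probability at most `(47 / 50) ^
n`. Let `w` be the density of the slice in the cube. The hypothesis gains at least `0.065 w` over
guessing on the slice. Off the slice, the sign of a mean known up to `w / 10` loses at most `w /
20`. The net gain is at least `0.015 w`, and `w ≥ n ^ (-c₀)` because the weight is within `O(√(n log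
n))` of the middle (`le_choose`).

Three things carry this out. (1) Harmonic analysis by induction on the largest coordinate: in
`youngFun` the largest element `b` of `B` contributes one factor that is constant on each half of a
slice of `{0, …, b}`. Orthogonality (`sliceSum_youngFun_mul`) and Parseval (`sliceSum_parseval`)
then reduce to binomial identities and a change of basis in a plane; `chi_eq` identifies `youngFun`
with `χ_B`.

(2) A calculus `Runs` for the programs, with explicit intermediate states and a count of operations
on numbers of at most `L` bits. Every length, counter and bit size is polynomial in one number `M =
n ^ ((3 C + 3) D)`, so crude bounds suffice: the total time is at most `M ^ 20`. The outcome is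
`runs_learner`, which describes the run as a function of the random tape.

(3) Probability: each estimate is a ratio of two sums of independent variables, controlled by
Chebyshev (`seqMeasure_avgOf_le`). Since `g` is itself random, its error is estimated from later
examples, and independence allows `g` to be fixed first (`seqMeasure_adaptive_le`). With `m = n ^ (3
C D)` examples per estimate and `C ≥ c₀ + 10`, a union bound over all estimates on all inspected
slices stays below `1 / n` (`failure_le`). -/

namespace SliceLearner

open Finset

/-! ## The Young-Fourier basis via a recursion on the largest coordinate -/

/-- Binomial coefficients with integer lower index, zero for a negative one. -/
noncomputable def intChoose (N : ℕ) (s : ℤ) : ℝ := if 0 ≤ s then (N.choose s.toNat : ℝ) else 0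

theorem intChoose_nonneg (N : ℕ) (s : ℤ) : 0 ≤ intChoose N s := by
  unfold intChoose; split_ifs <;> positivity

theorem intChoose_nat (N s : ℕ) : intChoose N (s : ℤ) = N.choose s := by simp [intChoose]

theorem intChoose_neg (N s : ℕ) : intChoose N (-((s : ℤ) + 1)) = 0 := by
  rw [intChoose, if_neg (by omega)]

theorem intChoose_succ (N : ℕ) (s : ℤ) :
    intChoose (N + 1) s = intChoose N s + intChoose N (s - 1) := by
  rcases lt_trichotomy s 0 with h | h | h
  · simp [intChoose, show ¬ (0 ≤ s) by omega, show ¬ (1 ≤ s) by omega]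
  · subst h; simp [intChoose]
  · obtain ⟨m, rfl⟩ : ∃ m : ℕ, s = ((m + 1 : ℕ) : ℤ) := ⟨s.toNat - 1, by omega⟩
    have : (((m + 1 : ℕ) : ℤ) - 1) = (m : ℤ) := by push_cast; ring
    rw [this, intChoose_nat, intChoose_nat, intChoose_nat, Nat.choose_succ_succ]
    push_cast; ring

/-- Absorption. With `N = n - 2 |L|` and `s = r - |L|` the two sides are, up to the factor
`normConst L`, the contributions of the two halves of a slice to the inner product of `χ_L` with
`χ_{n :: L}`; their equality is the orthogonality of these functions. -/
theorem mul_intChoose (N : ℕ) (s : ℤ) :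
    (s : ℝ) * intChoose N s = ((N : ℝ) + 1 - s) * intChoose N (s - 1) := by
  rcases lt_trichotomy s 0 with h | h | h
  · simp [intChoose, show ¬ (0 ≤ s) by omega, show ¬ (1 ≤ s) by omega]
  · subst h; simp [intChoose]
  · obtain ⟨m, rfl⟩ : ∃ m : ℕ, s = ((m + 1 : ℕ) : ℤ) := ⟨s.toNat - 1, by omega⟩
    have : (((m + 1 : ℕ) : ℤ) - 1) = (m : ℤ) := by push_cast; ring
    rw [this, intChoose_nat, intChoose_nat]
    have h1 := Nat.choose_succ_right_eq N m
    rcases le_or_gt m N with hm | hm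
    · have h2 : ((N - m : ℕ) : ℝ) = (N : ℝ) - m := by push_cast [hm]; ring
      have h3 : (N.choose (m + 1) : ℝ) * (m + 1) = N.choose m * (N - m) := by
        rw [← h2]; exact_mod_cast h1
      push_cast; linear_combination h3
    · simp [Nat.choose_eq_zero_of_lt hm, Nat.choose_eq_zero_of_lt (show N < m + 1 by omega)]

theorem succ_mul_intChoose (N : ℕ) (s : ℤ) :
    ((N : ℝ) + 1) * intChoose N (s - 1) = s * intChoose (N + 1) s := by
  rw [intChoose_succ]
  linear_combination (-1 : ℝ) * mul_intChoose N s

/-! ### Sums over a slice, split at the last coordinate -/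

/-- The sum of `F` over the subsets of `{0, …, n - 1}` of size `r`. -/
noncomputable def sliceSum (n : ℕ) (r : ℤ) (F : Finset ℕ → ℝ) : ℝ :=
  ∑ S ∈ (range n).powerset, if (S.card : ℤ) = r then F S else 0

theorem sliceSum_congr {n : ℕ} {r : ℤ} {F G : Finset ℕ → ℝ}
    (h : ∀ S, S ⊆ range n → (S.card : ℤ) = r → F S = G S) : sliceSum n r F = sliceSum n r G := by
  refine sum_congr rfl fun S hS => ?_
  split_ifs with h'
  · exact h S (mem_powerset.1 hS) h'
  · rfl

theorem sliceSum_const_mul (n : ℕ) (r : ℤ) (c : ℝ) (F : Finset ℕ → ℝ) :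
    sliceSum n r (fun S => c * F S) = c * sliceSum n r F := by
  simp only [sliceSum, mul_sum, mul_ite, mul_zero]

theorem sliceSum_succ (n : ℕ) (r : ℤ) (F : Finset ℕ → ℝ) :
    sliceSum (n + 1) r F = sliceSum n r F + sliceSum n (r - 1) (fun S => F (insert n S)) := by
  unfold sliceSum
  rw [range_add_one, sum_powerset_insert (by simp)]
  congr 1
  refine sum_congr rfl fun S hS => ?_
  have : n ∉ S := fun h => by simpa using mem_powerset.1 hS h
  rw [card_insert_of_notMem this]
  congr 1
  simp only [eq_iff_iff]; push_cast; constructor <;> intro h <;> linarith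

/-! ### The basis by recursion: orthogonality and norms -/

/-- The function `χ_B`, where `B` is written as a decreasing list of coordinates. -/
noncomputable def youngFun : List ℕ → Finset ℕ → ℝ
  | [], _ => 1
  | b :: L, S => youngFun L S *
      (((S.filter (· < b)).card : ℝ) - L.length - ((b : ℝ) - 2 * L.length) * (if b ∈ S then 1 else 0))

/-- The top sets of `{0, …, n - 1}` as decreasing lists. -/
def topLists : ℕ → Finset (List ℕ)
  | 0 => {[]}
  | n + 1 => topLists n ∪ ((topLists n).filter fun L => 2 * L.length < n).image (List.cons n)

/-- The constant `∏ (b_i - 2 i) (b_i - 2 i - 1)` in the norm of `χ_B`. -/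
noncomputable def normConst : List ℕ → ℝ
  | [] => 1
  | b :: L => normConst L * (((b : ℝ) + 1 - 2 * L.length) * ((b : ℝ) - 2 * L.length))

theorem lt_of_mem_topLists {n : ℕ} {L : List ℕ} (h : L ∈ topLists n) : ∀ a ∈ L, a < n := by
  induction n generalizing L with
  | zero => simp [topLists] at h; simp [h]
  | succ n ih =>
    simp only [topLists, mem_union, mem_image, mem_filter] at h
    rcases h with h | ⟨L', ⟨h, -⟩, rfl⟩
    · intro a ha; exact (ih h a ha).trans (by simp)
    · intro a ha
      rcases List.mem_cons.1 ha with rfl | ha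
      · simp
      · exact (ih h a ha).trans (by simp)

theorem length_of_mem_topLists {n : ℕ} {L : List ℕ} (h : L ∈ topLists n) : 2 * L.length ≤ n := by
  induction n generalizing L with
  | zero => simp [topLists] at h; simp [h]
  | succ n ih =>
    simp only [topLists, mem_union, mem_image, mem_filter] at h
    rcases h with h | ⟨L', ⟨h, h2⟩, rfl⟩
    · have := ih h; omega
    · simp; omega

theorem one_le_normConst {n : ℕ} {L : List ℕ} (h : L ∈ topLists n) : 1 ≤ normConst L := by
  induction n generalizing L with
  | zero => simp [topLists] at h; simp [h, normConst]
  | succ n ih =>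
    simp only [topLists, mem_union, mem_image, mem_filter] at h
    rcases h with h | ⟨L', ⟨h, h2⟩, rfl⟩
    · exact ih h
    · have h1 := ih h
      have h3 : (1 : ℝ) ≤ (n : ℝ) - 2 * L'.length := by
        have : ((2 * L'.length + 1 : ℕ) : ℝ) ≤ n := by exact_mod_cast h2
        push_cast at this; linarith
      simp only [normConst]
      have h4 : (1 : ℝ) ≤ (n : ℝ) + 1 - 2 * L'.length := by linarith
      exact one_le_mul_of_one_le_of_one_le h1 (one_le_mul_of_one_le_of_one_le h4 h3)

theorem sum_topLists_succ (n : ℕ) (G : List ℕ → ℝ) :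
    ∑ L ∈ topLists (n + 1), G L =
      ∑ L ∈ topLists n, (G L + if 2 * L.length < n then G (n :: L) else 0) := by
  rw [topLists, sum_union, sum_add_distrib, sum_image (by simp), sum_filter]
  rw [disjoint_left]
  intro L hL hL'
  simp only [mem_image, mem_filter] at hL'
  obtain ⟨L', -, rfl⟩ := hL'
  simpa using lt_of_mem_topLists hL n (by simp)

theorem youngFun_insert {n : ℕ} {L : List ℕ} (h : ∀ a ∈ L, a < n) (S : Finset ℕ) :
    youngFun L (insert n S) = youngFun L S := by
  induction L with
  | nil => rfl
  | cons b L ih =>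
    have hb : b < n := h b (by simp)
    simp only [youngFun, ih fun a ha => h a (by simp [ha])]
    rw [filter_insert, if_neg (by omega)]
    simp [mem_insert, hb.ne]

/-- The last factor depends on `S` only through the weight and the membership of `n`. On each half
of the slice `χ_{n :: L}` is therefore a scalar multiple of `χ_L`; this is the half without `n`. -/
theorem youngFun_cons_of_subset {n : ℕ} {r : ℤ} {L : List ℕ} {S : Finset ℕ} (hS : S ⊆ range n)
    (hr : (S.card : ℤ) = r) : youngFun (n :: L) S = ((r : ℝ) - L.length) * youngFun L S := by
  have h1 : S.filter (· < n) = S := filter_true_of_mem fun a ha => by simpa using hS ha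
  have h2 : n ∉ S := fun h => by simpa using hS h
  have h3 : (r : ℝ) = S.card := by rw [← hr]; simp
  simp only [youngFun, h1, h2, h3, if_false]; ring

theorem youngFun_cons_insert {n : ℕ} {r : ℤ} {L : List ℕ} {S : Finset ℕ} (h : ∀ a ∈ L, a < n)
    (hS : S ⊆ range n) (hr : (S.card : ℤ) = r - 1) :
    youngFun (n :: L) (insert n S) = (-((n : ℝ) + 1 - r - L.length)) * youngFun L S := by
  have h1 : (insert n S).filter (· < n) = S := by
    rw [filter_insert, if_neg (by omega)]
    exact filter_true_of_mem fun a ha => by simpa using hS ha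
  have h3 : (r : ℝ) - 1 = S.card := by
    have : (((S.card : ℤ) : ℝ)) = ((r - 1 : ℤ) : ℝ) := by rw [hr]
    push_cast at this; linarith
  simp only [youngFun, h1, youngFun_insert h, mem_insert, true_or, if_true, ← h3]; ring

/-- The tool of both inductions: inner products with `χ_{n :: L}` on `n + 1` coordinates become
inner products with `χ_L` on two neighbouring slices of `n` coordinates. -/
theorem sliceSum_cons_mul {n : ℕ} {L : List ℕ} (h : ∀ a ∈ L, a < n) (r : ℤ) (F : Finset ℕ → ℝ) :
    sliceSum (n + 1) r (fun S => F S * youngFun (n :: L) S) =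
      ((r : ℝ) - L.length) * sliceSum n r (fun S => F S * youngFun L S) -
      ((n : ℝ) + 1 - r - L.length) *
        sliceSum n (r - 1) (fun S => F (insert n S) * youngFun L S) := by
  rw [sliceSum_succ, sub_eq_add_neg _ (_ * _), ← neg_mul, ← sliceSum_const_mul,
    ← sliceSum_const_mul]
  congr 1
  · refine sliceSum_congr fun S hS hr => ?_
    rw [youngFun_cons_of_subset hS hr]; ring
  · refine sliceSum_congr fun S hS hr => ?_
    rw [youngFun_cons_insert h hS hr]; ring

theorem sliceSum_mul_of_lt {n : ℕ} {L : List ℕ} (h : ∀ a ∈ L, a < n) (r : ℤ)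
    (F : Finset ℕ → ℝ) :
    sliceSum (n + 1) r (fun S => F S * youngFun L S) =
      sliceSum n r (fun S => F S * youngFun L S) +
      sliceSum n (r - 1) (fun S => F (insert n S) * youngFun L S) := by
  rw [sliceSum_succ]; simp only [youngFun_insert h]

/-- Orthogonality and norms of the Young-Fourier basis. -/
theorem sliceSum_youngFun_mul {n : ℕ} {L L' : List ℕ} (hL : L ∈ topLists n) (hL' : L' ∈ topLists n)
    (r : ℤ) : sliceSum n r (fun S => youngFun L S * youngFun L' S) =
      if L = L' then normConst L * intChoose (n - 2 * L.length) (r - L.length) else 0 := by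
  induction n generalizing L L' r with
  | zero =>
    simp [topLists] at hL hL'
    subst hL; subst hL'
    simp only [sliceSum, youngFun, normConst, range_zero, powerset_empty, sum_singleton, card_empty,
      intChoose]
    rcases lt_trichotomy r 0 with h | h | h
    · simp [show ¬ (0 ≤ r) by omega, show ¬ (0 = r) by omega]
    · simp [h]
    · obtain ⟨m, rfl⟩ : ∃ m : ℕ, r = ((m + 1 : ℕ) : ℤ) := ⟨r.toNat - 1, by omega⟩
      have : ¬ ((0 : ℤ) = (m : ℤ) + 1) := by omega
      simp [this]
  | succ n ih =>
    -- An old function against a new one. For different lists both halves vanish by induction; for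
    -- equal lists they cancel by `mul_intChoose`.
    have mix : ∀ {A B : List ℕ}, A ∈ topLists n → B ∈ topLists n → 
        sliceSum (n + 1) r (fun S => youngFun A S * youngFun (n :: B) S) = 0 := by
      intro A B hA hB
      rw [sliceSum_cons_mul (lt_of_mem_topLists hB)]
      simp only [youngFun_insert (lt_of_mem_topLists hA), ih hA hB]
      split_ifs with hAB
      · subst hAB
        have h := mul_intChoose (n - 2 * A.length) (r - A.length)
        have h2 : ((n - 2 * A.length : ℕ) : ℝ) = n - 2 * A.length := by
          push_cast [length_of_mem_topLists hA]; ring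
        rw [h2] at h
        push_cast at h
        rw [show r - 1 - (A.length : ℤ) = r - A.length - 1 by ring]
        linear_combination normConst A * h
      · simp
    have hne : ∀ {A B : List ℕ}, A ∈ topLists n → A ≠ n :: B := by
      rintro A B hA rfl
      simpa using lt_of_mem_topLists hA n (by simp)
    simp only [topLists, mem_union, mem_image, mem_filter] at hL hL'
    rcases hL with hL | ⟨L, ⟨hL, hl⟩, rfl⟩ <;> rcases hL' with hL' | ⟨L', ⟨hL', hl'⟩, rfl⟩
    · rw [sliceSum_mul_of_lt (lt_of_mem_topLists hL')]
      simp only [youngFun_insert (lt_of_mem_topLists hL), ih hL hL']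
      split_ifs with hLL
      · have := length_of_mem_topLists hL
        rw [show n + 1 - 2 * L.length = n - 2 * L.length + 1 by omega, intChoose_succ,
          show r - 1 - (L.length : ℤ) = r - L.length - 1 by ring]
        ring
      · simp
    · rw [mix hL hL', if_neg (hne hL)]
    · rw [if_neg (hne hL').symm, ← mix hL' hL]
      simp only [mul_comm]
    · rw [sliceSum_cons_mul (lt_of_mem_topLists hL')]
      have e1 : sliceSum n r (fun S => youngFun (n :: L) S * youngFun L' S) =
          ((r : ℝ) - L.length) * sliceSum n r (fun S => youngFun L S * youngFun L' S) := by
        rw [← sliceSum_const_mul]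
        refine sliceSum_congr fun S hS hr => ?_
        rw [youngFun_cons_of_subset hS hr]; ring
      have e2 : sliceSum n (r - 1) (fun S => youngFun (n :: L) (insert n S) * youngFun L' S) =
          (-((n : ℝ) + 1 - r - L.length)) *
            sliceSum n (r - 1) (fun S => youngFun L S * youngFun L' S) := by
        rw [← sliceSum_const_mul]
        refine sliceSum_congr fun S hS hr => ?_
        rw [youngFun_cons_insert (lt_of_mem_topLists hL) hS hr]; ring
      rw [e1, e2, ih hL hL', ih hL hL']
      by_cases hLL : L = L'
      · subst hLL
        -- The condition `2 |L| < n` leaves `N + 1 = n - 2 |L|` positive. With `s = r - |L|` the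
        -- claim is `s² C(N+1, s) + (N+2-s)² C(N+1, s-1) = (N+2)(N+1) C(N, s-1)`.
        obtain ⟨N, hN⟩ : ∃ N, n = N + 1 + 2 * L.length := ⟨n - 1 - 2 * L.length, by omega⟩
        have i1 : n - 2 * L.length = N + 1 := by omega
        have i2 : n + 1 - 2 * (n :: L).length = N := by simp; omega
        have h := mul_intChoose (N + 1) (r - L.length)
        have h' := succ_mul_intChoose N (r - L.length)
        rw [i2, i1]
        simp only [if_true, normConst, List.length_cons]
        rw [show r - ((L.length + 1 : ℕ) : ℤ) = r - L.length - 1 by push_cast; ring,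
          show r - 1 - (L.length : ℤ) = r - L.length - 1 by ring]
        have hn : (n : ℝ) = N + 1 + 2 * L.length := by exact_mod_cast hN
        rw [hn]
        push_cast at h h' ⊢
        linear_combination (-normConst L * ((N : ℝ) + 2 - (r - L.length))) * h
          - normConst L * ((N : ℝ) + 2) * h'
      · simp [hLL]

theorem sliceSum_youngFun_sq {n : ℕ} {L : List ℕ} (hL : L ∈ topLists n) (r : ℤ) :
    sliceSum n r (fun S => youngFun L S ^ 2) =
      normConst L * intChoose (n - 2 * L.length) (r - L.length) := by
  simpa [sq] using sliceSum_youngFun_mul hL hL r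

/-- A function of norm zero vanishes on the slice. Parseval's sum contains such terms with
denominator zero; this keeps the convention `x / 0 = 0` harmless. -/
theorem sliceSum_mul_youngFun_eq_zero {n : ℕ} {L : List ℕ} (hL : L ∈ topLists n) {r : ℤ}
    (h : intChoose (n - 2 * L.length) (r - L.length) = 0) (F : Finset ℕ → ℝ) :
    sliceSum n r (fun S => F S * youngFun L S) = 0 := by
  have h0 := sliceSum_youngFun_sq hL r
  rw [h, mul_zero, sliceSum, sum_eq_zero_iff_of_nonneg
    (fun S _ => by split_ifs <;> positivity)] at h0
  refine sum_eq_zero fun S hS => ?_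
  have := h0 S hS
  split_ifs with h'
  · rw [if_pos h'] at this
    simp [pow_eq_zero_iff] at this
    simp [this]
  · rfl

/-- Parseval in a plane. One orthogonal basis consists of the two halves of `χ_L`, with squared
norms `c x` and `c y`; the other one is their sum and the combination with coefficients `s` and
`-s'`, orthogonal because `s x = s' y`. The numbers `p` and `q` are the inner products with the
halves. -/
theorem two_term_parseval {x y s s' p q c : ℝ} (hx : 0 ≤ x) (hy : 0 ≤ y) (hc : 0 < c)
    (hs : s * x = s' * y) (hss : 0 < s + s') (hp : x = 0 → p = 0) (hq : y = 0 → q = 0) :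
    (p + q) ^ 2 / (c * (x + y)) + (s * p - s' * q) ^ 2 / (c * (s ^ 2 * x + s' ^ 2 * y)) =
      p ^ 2 / (c * x) + q ^ 2 / (c * y) := by
  rcases hx.eq_or_lt with hx | hx
  · have := hp hx.symm
    subst this
    rcases hy.eq_or_lt with hy | hy
    · have := hq hy.symm
      subst this; simp
    · have : s' = 0 := by
        rw [← hx, mul_zero] at hs
        rcases mul_eq_zero.1 hs.symm with h | h
        · exact h
        · exact absurd h hy.ne'
      subst this; simp [← hx]
  · rcases hy.eq_or_lt with hy | hy
    · have := hq hy.symm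
      subst this
      have : s = 0 := by
        rw [← hy, mul_zero] at hs
        rcases mul_eq_zero.1 hs with h | h
        · exact h
        · exact absurd h hx.ne'
      subst this; simp [← hy]
    · have hs' : s' = s * x / y := by field_simp; linarith
      -- By `s x = s' y` the numbers `s` and `s'` have the same sign, and their sum is positive.
      have hspos : 0 < s := by
        by_contra hcon
        push Not at hcon
        have : s * x / y ≤ 0 := div_nonpos_of_nonpos_of_nonneg
          (mul_nonpos_of_nonpos_of_nonneg hcon hx.le) hy.le
        linarith
      subst hs'
      field_simp
      ring

/-- Parseval's identity on a slice. -/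
theorem sliceSum_parseval (n : ℕ) (r : ℤ) (F : Finset ℕ → ℝ) :
    ∑ L ∈ topLists n, sliceSum n r (fun S => F S * youngFun L S) ^ 2 /
      (normConst L * intChoose (n - 2 * L.length) (r - L.length)) =
      sliceSum n r (fun S => F S ^ 2) := by
  induction n generalizing r F with
  | zero =>
    simp only [topLists, sum_singleton, youngFun, normConst, mul_one, one_mul, List.length_nil]
    rcases eq_or_ne r 0 with rfl | h
    · simp [sliceSum, intChoose]
    · simp [sliceSum, h.symm]
  | succ n ih =>
    rw [sliceSum_succ, ← ih, ← ih, sum_topLists_succ, ← sum_add_distrib]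
    refine sum_congr rfl fun L hL => ?_
    have hlt := lt_of_mem_topLists hL
    have hlen := length_of_mem_topLists hL
    rw [sliceSum_mul_of_lt hlt, sliceSum_cons_mul hlt]
    have hp := fun h => sliceSum_mul_youngFun_eq_zero hL (r := r) h F
    have hq := fun h => sliceSum_mul_youngFun_eq_zero hL (r := r - 1) h (fun S => F (insert n S))
    set p := sliceSum n r (fun S => F S * youngFun L S)
    set q := sliceSum n (r - 1) (fun S => F (insert n S) * youngFun L S)
    rw [show r - 1 - (L.length : ℤ) = r - L.length - 1 by ring] at hq ⊢
    obtain ⟨N, hN⟩ : ∃ N, n = N + 2 * L.length := ⟨n - 2 * L.length, by omega⟩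
    have i1 : n - 2 * L.length = N := by omega
    have i2 : n + 1 - 2 * L.length = N + 1 := by omega
    have hn : (n : ℝ) = N + 2 * L.length := by exact_mod_cast hN
    rw [i1] at hp hq
    rw [i1, i2, intChoose_succ]
    have h := mul_intChoose N (r - L.length)
    have hx := intChoose_nonneg N (r - L.length)
    have hy := intChoose_nonneg N (r - L.length - 1)
    have hc : 0 < normConst L := one_pos.trans_le (one_le_normConst hL)
    -- Here `s = r - |L|` and `s' = n + 1 - r - |L|`, with sum `N + 1 > 0`. The left side of the
    -- identity consists of the terms of `L` and `n :: L` upstairs, the right side of the terms of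
    -- `L` on the two slices downstairs.
    have key := two_term_parseval (s := (r : ℝ) - L.length) (s' := (n : ℝ) + 1 - r - L.length)
      hx hy hc (by push_cast at h; rw [hn]; linear_combination h)
      (by rw [hn]; have : (0 : ℝ) ≤ N := by positivity
          linarith) hp hq
    rw [← key]
    congr 1
    split_ifs with hlt'
    · obtain ⟨M, rfl⟩ : ∃ M, N = M + 1 := ⟨N - 1, by omega⟩
      have i3 : n + 1 - 2 * (n :: L).length = M := by simp; omega
      rw [i3]
      congr 1
      have h' := succ_mul_intChoose M (r - L.length)
      simp only [normConst, List.length_cons]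
      rw [show r - ((L.length + 1 : ℕ) : ℤ) = r - L.length - 1 by push_cast; ring]
      rw [hn]
      push_cast at h h' ⊢
      linear_combination normConst L * ((M : ℝ) + 2) * h' 
        + (normConst L * ((M : ℝ) + 2 - (r - L.length))) * h
    -- When `2 |L| = n`, the list `n :: L` is not a top set, so its term has to be zero. At most one
    -- half of `χ_L` is nonzero, for `r = |L|` or `r = |L| + 1`, and in each case the coefficient of
    -- that half vanishes.
    · have hN0 : N = 0 := by omega
      subst hN0
      symm
      have hxy : intChoose 0 (r - L.length) = 0 ∨ r - (L.length : ℤ) = 0 := by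
        by_cases h0 : r - (L.length : ℤ) = 0
        · exact Or.inr h0
        · left
          unfold intChoose
          split_ifs with h1
          · rw [Nat.choose_eq_zero_of_lt (by omega)]; simp
          · rfl
      have hnum : ((r : ℝ) - L.length) * p - ((n : ℝ) + 1 - r - L.length) * q = 0 := by
        rcases hxy with h0 | h0
        · rw [hp h0]
          by_cases h1 : intChoose 0 (r - L.length - 1) = 0
          · rw [hq h1]; ring
          · rw [h0, mul_zero] at h
            rcases mul_eq_zero.1 h.symm with h2 | h2
            · push_cast at h2
              rw [hn]; push_cast; linear_combination (-q) * h2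
            · exact absurd h2 h1
        · rw [hq (by rw [h0]; exact intChoose_neg 0 0)]
          have : (r : ℝ) - L.length = 0 := by exact_mod_cast h0
          rw [this]; ring
      rw [hnum]; simp

end SliceLearner


namespace SliceLearner

open Finset

/-! ## Top sets as decreasing lists -/

/-- The entries of `B` as a list, in reversed order. -/
def toDesc {n k : ℕ} (B : Fin k → Fin n) : List ℕ := (List.ofFn fun i => (B i : ℕ)).reverse

theorem length_toDesc {n k : ℕ} (B : Fin k → Fin n) : (toDesc B).length = k := by simp [toDesc]

theorem toDesc_succ {n k : ℕ} (B : Fin (k + 1) → Fin n) :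
    toDesc B = (B (Fin.last k) : ℕ) :: toDesc fun i => B i.castSucc := by
  rw [toDesc, List.ofFn_succ', List.concat_eq_append, List.reverse_append]
  rfl

theorem toDesc_injective {n k : ℕ} : Function.Injective (toDesc : (Fin k → Fin n) → List ℕ) := by
  intro B B' h
  have := List.ofFn_injective (List.reverse_injective h)
  funext i
  exact Fin.ext (congrFun this i)

/-- A decreasing list of coordinates that forms a top set. -/
def IsTopList : List ℕ → Prop
  | [] => True
  | b :: L => IsTopList L ∧ (∀ a ∈ L, a < b) ∧ 2 * L.length < b

theorem mem_topLists_iff {n : ℕ} {L : List ℕ} :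
    L ∈ topLists n ↔ IsTopList L ∧ ∀ a ∈ L, a < n := by
  induction n generalizing L with
  | zero =>
    cases L with
    | nil => simp [topLists, IsTopList]
    | cons b L =>
      simp only [topLists, mem_singleton, reduceCtorEq, false_iff, not_and]
      exact fun _ h => absurd (h b (by simp)) (by omega)
  | succ n ih =>
    simp only [topLists, mem_union, mem_image, mem_filter, ih]
    constructor
    · rintro (⟨h, h'⟩ | ⟨L', ⟨⟨h, h'⟩, hl⟩, rfl⟩)
      · exact ⟨h, fun a ha => (h' a ha).trans (by simp)⟩
      · refine ⟨⟨h, h', hl⟩, fun a ha => ?_⟩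
        rcases List.mem_cons.1 ha with rfl | ha
        · simp
        · exact (h' a ha).trans (by simp)
    · rintro ⟨h, h'⟩
      cases L with
      | nil => simp [IsTopList]
      | cons b L =>
        have hb : b < n + 1 := h' b (by simp)
        rcases Nat.lt_succ_iff_lt_or_eq.1 hb with hb | rfl
        · left
          refine ⟨h, fun a ha => ?_⟩
          rcases List.mem_cons.1 ha with rfl | ha
          · exact hb
          · exact (h.2.1 a ha).trans hb
        · right
          exact ⟨L, ⟨⟨h.1, h.2.1⟩, h.2.2⟩, rfl⟩

theorem strictMono_succ_iff {n k : ℕ} (B : Fin (k + 1) → Fin n) :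
    StrictMono B ↔ StrictMono (fun i : Fin k => B i.castSucc) ∧
      ∀ i : Fin k, B i.castSucc < B (Fin.last k) := by
  constructor
  · intro h
    exact ⟨fun i j hij => h (by simpa using hij), fun i => h (Fin.castSucc_lt_last i)⟩
  · rintro ⟨h, h'⟩ i j hij
    induction j using Fin.lastCases with
    | last =>
      induction i using Fin.lastCases with
      | last => simp at hij
      | cast i => exact h' i
    | cast j =>
      induction i using Fin.lastCases with
      | last => exact absurd hij (not_lt.2 (Fin.le_last _))
      | cast i => exact h (by simpa using hij)

theorem isBelow_snoc_iff {n k : ℕ} {B : Fin (k + 1) → Fin n} (hB : StrictMono B)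
    (A : Fin k → Fin n) (a : Fin n) :
    IsBelow (Fin.snoc A a : Fin (k + 1) → Fin n) B ↔
      IsBelow A (fun i => B i.castSucc) ∧ a < B (Fin.last k) ∧ (∀ i, a ≠ A i) ∧
        ∀ i : Fin k, a ≠ B i.castSucc := by
  have hlast : ∀ i : Fin k, B i.castSucc < B (Fin.last k) := fun i => hB (Fin.castSucc_lt_last i)
  constructor
  · rintro ⟨h1, h2, h3⟩
    refine ⟨⟨fun i j hij => ?_, fun i j => ?_, fun i => ?_⟩, ?_, fun i hi => ?_, fun i => ?_⟩
    · have := @h1 i.castSucc j.castSucc (by simpa using hij)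
      simpa using this
    · simpa using h2 i.castSucc j.castSucc
    · simpa using h3 i.castSucc
    · simpa using h3 (Fin.last k)
    · have := @h1 (Fin.last k) i.castSucc (by simpa using hi)
      exact absurd this (Fin.castSucc_lt_last i).ne'
    · simpa using h2 (Fin.last k) i.castSucc
  · rintro ⟨⟨h1, h2, h3⟩, h4, h5, h6⟩
    refine ⟨?_, ?_, ?_⟩
    · intro i j hij
      induction i using Fin.lastCases with
      | last =>
        induction j using Fin.lastCases with
        | last => rfl
        | cast j => simp at hij; exact absurd hij (h5 j)
      | cast i =>
        induction j using Fin.lastCases with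
        | last => simp at hij; exact absurd hij.symm (h5 i)
        | cast j => simp at hij; rw [h1 hij]
    · intro i j
      induction i using Fin.lastCases with
      | last =>
        induction j using Fin.lastCases with
        | last => simpa using h4.ne
        | cast j => simpa using h6 j
      | cast i =>
        induction j using Fin.lastCases with
        | last => simpa using ((h3 i).trans (hlast i)).ne
        | cast j => simpa using h2 i j
    · intro i
      induction i using Fin.lastCases with
      | last => simpa using h4
      | cast i => simpa using h3 i

theorem card_used {n k : ℕ} {A B : Fin k → Fin n} (hB : StrictMono B) (h : IsBelow A B) :
    Disjoint (univ.image A) (univ.image B) ∧ (univ.image A).card = k ∧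
      (univ.image B).card = k := by
  refine ⟨?_, ?_, ?_⟩
  · rw [disjoint_left]
    rintro a ha hb
    simp only [mem_image, mem_univ, true_and] at ha hb
    obtain ⟨i, rfl⟩ := ha
    obtain ⟨j, hj⟩ := hb
    exact h.2.1 i j hj.symm
  · rw [card_image_of_injective _ h.1]; simp
  · rw [card_image_of_injective _ hB.injective]; simp

theorem used_subset {n k : ℕ} {A : Fin k → Fin n} {B : Fin k → Fin n} {b : Fin n}
    (hB : ∀ i, B i < b) (h : IsBelow A B) :
    univ.image A ∪ univ.image B ⊆ univ.filter (· < b) := by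
  intro a ha
  simp only [mem_union, mem_image, mem_univ, true_and, mem_filter] at ha ⊢
  rcases ha with ⟨i, rfl⟩ | ⟨i, rfl⟩
  · exact (h.2.2 i).trans (hB i)
  · exact hB i

theorem card_lt_fin {n : ℕ} (b : Fin n) : (univ.filter (· < b)).card = (b : ℕ) := by
  simp [Finset.filter_gt_eq_Iio]

/-- The partners can be chosen greedily: after `k` pairs below `b` exactly `2 k` of the `b` smaller
coordinates are used, so a partner for `b` exists if and only if `2 k < b`, whichever partners were
chosen before. -/
theorem isTopSet_iff {n k : ℕ} (B : Fin k → Fin n) : IsTopSet B ↔ IsTopList (toDesc B) := by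
  induction k with
  | zero =>
    have : toDesc B = [] := by simp [toDesc]
    rw [this]
    simp only [IsTopList, iff_true]
    exact ⟨fun i => i.elim0, B, fun i => i.elim0, fun i => i.elim0, fun i => i.elim0⟩
  | succ k ih =>
    rw [toDesc_succ]
    simp only [IsTopList, ← ih, length_toDesc]
    have hmem : (∀ a ∈ toDesc (fun i : Fin k => B i.castSucc), a < (B (Fin.last k) : ℕ)) ↔
        ∀ i : Fin k, B i.castSucc < B (Fin.last k) := by
      simp [toDesc, List.mem_ofFn]
    rw [hmem]
    constructor
    · rintro ⟨hB, A, hA⟩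
      have hB' := (strictMono_succ_iff B).1 hB
      rw [← Fin.snoc_init_self A, isBelow_snoc_iff hB] at hA
      obtain ⟨h1, h2, h3, h4⟩ := hA
      refine ⟨⟨hB'.1, _, h1⟩, hB'.2, ?_⟩
      obtain ⟨c1, c2, c3⟩ := card_used hB'.1 h1
      have hsub := used_subset hB'.2 h1
      have hss : univ.image (Fin.init A) ∪ univ.image (fun i : Fin k => B i.castSucc) ⊂
          univ.filter (· < B (Fin.last k)) := by
        refine (ssubset_iff_of_subset hsub).2 ⟨A (Fin.last k), by simpa using h2, ?_⟩
        simp only [mem_union, mem_image, mem_univ, true_and, not_or, not_exists]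
        exact ⟨fun i hi => h3 i hi.symm, fun i hi => h4 i hi.symm⟩
      have := card_lt_card hss
      rw [card_union_of_disjoint c1, c2, c3, card_lt_fin] at this
      omega
    · rintro ⟨⟨hB, A, hA⟩, hlt, hcard⟩
      have hB' := (strictMono_succ_iff B).2 ⟨hB, hlt⟩
      refine ⟨hB', ?_⟩
      obtain ⟨c1, c2, c3⟩ := card_used hB hA
      obtain ⟨a, ha, ha'⟩ : ∃ a ∈ univ.filter (· < B (Fin.last k)),
          a ∉ univ.image A ∪ univ.image (fun i : Fin k => B i.castSucc) := by
        refine exists_mem_notMem_of_card_lt_card ?_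
        rw [card_union_of_disjoint c1, c2, c3, card_lt_fin]
        omega
      simp only [mem_union, mem_image, mem_univ, true_and, not_or, not_exists, mem_filter] at ha ha'
      exact ⟨Fin.snoc A a, (isBelow_snoc_iff hB' A a).2
        ⟨hA, ha, fun i hi => ha'.1 i hi.symm, fun i hi => ha'.2 i hi.symm⟩⟩

theorem mem_topSets {n k : ℕ} {B : Fin k → Fin n} : B ∈ topSets n k ↔ IsTopSet B := by
  simp [topSets]

theorem toDesc_mem_topLists {n k : ℕ} {B : Fin k → Fin n} :
    toDesc B ∈ topLists n ↔ IsTopSet B := by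
  rw [mem_topLists_iff, ← isTopSet_iff, and_iff_left]
  simp [toDesc, List.mem_ofFn]

theorem exists_toDesc_eq {n : ℕ} {L : List ℕ} (h : ∀ a ∈ L, a < n) :
    ∃ B : Fin L.length → Fin n, toDesc B = L := by
  have hlen : L.length = L.reverse.length := by simp
  refine ⟨fun i => ⟨L.reverse.get (Fin.cast hlen i), h _ ?_⟩, ?_⟩
  · exact List.mem_reverse.1 (List.get_mem _ _)
  · rw [toDesc, List.reverse_eq_iff]
    refine List.ext_get (by simp) fun i h1 h2 => ?_
    simp

theorem sum_topSets_of_length (n k : ℕ) (G : List ℕ → ℝ) :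
    ∑ B ∈ topSets n k, G (toDesc B) = ∑ L ∈ (topLists n).filter (fun L => L.length = k), G L := by
  refine sum_nbij toDesc ?_ ?_ ?_ fun _ _ => rfl
  · intro B hB
    rw [mem_filter]
    exact ⟨toDesc_mem_topLists.2 (mem_topSets.1 hB), length_toDesc B⟩
  · exact fun B _ B' _ h => toDesc_injective h
  · intro L hL
    rw [mem_coe, mem_filter] at hL
    obtain ⟨hL, rfl⟩ := hL
    obtain ⟨B, hB⟩ := exists_toDesc_eq (lt_of_mem_topLists hL)
    refine ⟨B, ?_, hB⟩
    rw [mem_coe, mem_topSets, ← toDesc_mem_topLists, hB]; exact hL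

/-- Replaces a sum over lengths and functions on `Fin k` by one sum over lists, to which the
recursion applies. No length is missed since top sets have length at most `n / 2`. -/
theorem sum_topSets_filter {n N : ℕ} (hN : n ≤ N) (p : ℕ → Prop) [DecidablePred p]
    (G : List ℕ → ℝ) :
    ∑ k ∈ (range (N + 1)).filter p, ∑ B ∈ topSets n k, G (toDesc B) =
      ∑ L ∈ (topLists n).filter (fun L => p L.length), G L := by
  simp only [sum_topSets_of_length]
  rw [← sum_fiberwise_of_maps_to (s := (topLists n).filter (fun L => p L.length))
    (t := (range (N + 1)).filter p) (g := List.length)]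
  · refine sum_congr rfl fun k hk => ?_
    rw [filter_filter]
    refine sum_congr (filter_congr fun L _ => ?_) fun _ _ => rfl
    have := (mem_filter.1 hk).2
    constructor
    · rintro rfl; exact ⟨this, rfl⟩
    · exact fun h => h.2
  · intro L hL
    rw [mem_filter] at hL ⊢
    refine ⟨?_, hL.2⟩
    have := length_of_mem_topLists hL.1
    rw [mem_range]; omega

/-! ## The functions `χ_B` -/

/-- The coordinates at which `x` is `1`. -/
def support {n : ℕ} (x : Cube n) : Finset ℕ :=
  (univ.filter fun i => x i = true).map Fin.valEmbedding

theorem mem_support {n : ℕ} (x : Cube n) (i : Fin n) : (i : ℕ) ∈ support x ↔ x i = true := by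
  simp only [support, mem_map, mem_filter, mem_univ, true_and, Fin.valEmbedding_apply]
  constructor
  · rintro ⟨j, hj, hji⟩
    rwa [← Fin.ext hji]
  · exact fun h => ⟨i, h, rfl⟩

theorem bit_eq {n : ℕ} (x : Cube n) (i : Fin n) : bit x i = if (i : ℕ) ∈ support x then 1 else 0 := by
  simp [bit, mem_support]

theorem card_support_filter {n : ℕ} (x : Cube n) (b : Fin n) :
    (((support x).filter (· < (b : ℕ))).card : ℝ) = ∑ a ∈ univ.filter (· < b), bit x a := by
  rw [support, filter_map, card_map]
  simp only [bit]
  rw [sum_ite, sum_const_zero, add_zero, sum_const, nsmul_eq_mul, mul_one, filter_filter,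
    filter_filter]
  congr 2
  ext i
  simp [and_comm]

/-- Where `χ_{A,B}(x) ≠ 0`, each pair `a_i, b_i` contains exactly one coordinate with value `1`. The
used coordinates thus contribute `k - 2 k x_b` whatever `A` is, and the sum over the unused ones
depends only on the number of ones below `b` and on `x_b`. -/
theorem sum_bit_sub {n k : ℕ} {A B : Fin k → Fin n} (hB : StrictMono B) (h : IsBelow A B)
    {b : Fin n} (hb : ∀ i, B i < b) (x : Cube n) (hx : chiPair A B x ≠ 0) :
    ∑ a ∈ univ.filter (fun a => a < b ∧ (∀ i, a ≠ A i) ∧ ∀ i, a ≠ B i), (bit x a - bit x b) =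
      ((support x).filter (· < (b : ℕ))).card - k - ((b : ℝ) - 2 * k) * bit x b := by
  obtain ⟨c1, c2, c3⟩ := card_used hB h
  have hsub := used_subset hb h
  have hset : univ.filter (fun a => a < b ∧ (∀ i, a ≠ A i) ∧ ∀ i, a ≠ B i) =
      univ.filter (· < b) \ (univ.image A ∪ univ.image B) := by
    ext a
    simp only [mem_filter, mem_univ, true_and, mem_sdiff, mem_union, mem_image, not_or, not_exists]
    simp only [ne_comm, ne_eq]
  have hpair : ∀ i, bit x (A i) + bit x (B i) = 1 := by
    intro i
    have := (prod_ne_zero_iff.1 hx) i (mem_univ i)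
    unfold bit at this ⊢
    split_ifs at this ⊢ <;> simp_all
  have hsum : ∑ a ∈ univ.image A ∪ univ.image B, (bit x a - bit x b) = k - 2 * k * bit x b := by
    rw [sum_union c1, sum_image (fun i _ j _ hij => h.1 hij),
      sum_image (fun i _ j _ hij => hB.injective hij), ← sum_add_distrib]
    have : ∀ i, bit x (A i) - bit x b + (bit x (B i) - bit x b) = 1 - 2 * bit x b := by
      intro i; rw [← hpair i]; ring
    simp only [this, sum_const, card_univ, Fintype.card_fin, nsmul_eq_mul]
    ring
  have h1 := sum_sdiff (f := fun a => bit x a - bit x b) hsub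
  have h2 : ∑ a ∈ univ.filter (· < b), (bit x a - bit x b) =
      ∑ a ∈ univ.filter (· < b), bit x a - (b : ℕ) * bit x b := by
    rw [sum_sub_distrib, sum_const, card_lt_fin, nsmul_eq_mul]
  rw [hset, card_support_filter]
  rw [hsum, h2] at h1
  linarith

/-- Summing first over the partner of the largest element gives, by `sum_bit_sub`, a factor
independent of the other partners, which is the recursion of `youngFun`. -/
theorem chi_eq {n k : ℕ} {B : Fin k → Fin n} (hB : StrictMono B) (x : Cube n) :
    chi B x = youngFun (toDesc B) (support x) := by
  classical
  induction k with
  | zero =>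
    have : toDesc B = [] := by simp [toDesc]
    rw [this]
    have h : (univ.filter fun A : Fin 0 → Fin n => IsBelow A B) = univ := by
      rw [filter_true_of_mem]
      exact fun A _ => ⟨fun i => i.elim0, fun i => i.elim0, fun i => i.elim0⟩
    rw [chi, h]
    simp [chiPair, youngFun]
  | succ k ih =>
    have hB' := (strictMono_succ_iff B).1 hB
    rw [toDesc_succ, youngFun, ← ih hB'.1, length_toDesc, ← bit_eq]
    simp only [chi]
    rw [sum_filter, ← (Fin.snocEquiv fun _ => Fin n).sum_comp, Fintype.sum_prod_type_right, sum_filter,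
      sum_mul]
    refine sum_congr rfl fun A _ => ?_
    have key : ∀ a : Fin n, (if IsBelow ((Fin.snocEquiv fun _ => Fin n) (a, A)) B then
        chiPair ((Fin.snocEquiv fun _ => Fin n) (a, A)) B x else 0) =
        if IsBelow A (fun i => B i.castSucc) then chiPair A (fun i => B i.castSucc) x *
          (if (a < B (Fin.last k) ∧ (∀ i, a ≠ A i) ∧ ∀ i : Fin k, a ≠ B i.castSucc) then
            bit x a - bit x (B (Fin.last k)) else 0) else 0 := by
      intro a
      have e : ((Fin.snocEquiv fun _ : Fin (k + 1) => Fin n) (a, A)) =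
        (Fin.snoc A a : Fin (k + 1) → Fin n) := rfl
      rw [e]
      simp only [isBelow_snoc_iff hB]
      by_cases h1 : IsBelow A (fun i => B i.castSucc)
      · simp only [h1, true_and, if_true]
        split_ifs with h2
        · simp only [chiPair]
          rw [Fin.prod_univ_castSucc]
          simp
        · simp
      · simp [h1]
    simp only [key]
    split_ifs with h
    · rw [← mul_sum, ← sum_filter]
      -- The formula for the sum over `a` may fail where the product of the other factors is zero,
      -- but there it is not needed.
      by_cases hx : chiPair A (fun i => B i.castSucc) x = 0
      · simp [hx]
      · rw [sum_bit_sub hB'.1 h hB'.2 x hx]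
    · simp

/-- Complementing negates every factor `x_a - x_b`. The convention for `r > n / 2` thus changes
`χ_B` by a sign only, which cancels in weights and norms. -/
theorem chi_compl {n k : ℕ} (B : Fin k → Fin n) (x : Cube n) :
    chi B (fun i => !x i) = (-1) ^ k * chi B x := by
  have hb : ∀ i, bit (fun i => !x i) i = 1 - bit x i := by
    intro i; unfold bit; by_cases h : x i = true <;> simp [h]
  simp only [chi, mul_sum]
  refine sum_congr rfl fun A _ => ?_
  simp only [chiPair, hb]
  have : ∀ i, (1 - bit x (A i) - (1 - bit x (B i))) = (-1) * (bit x (A i) - bit x (B i)) := by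
    intro i; ring
  simp only [this]
  rw [prod_mul_distrib]; simp

/-- The basis function of a top set given as a decreasing list. -/
noncomputable def listBasis {n : ℕ} (r : ℕ) (L : List ℕ) (x : Cube n) : ℝ :=
  (if 2 * r ≤ n then 1 else (-1) ^ L.length) * youngFun L (support x)

theorem basis_eq {n k : ℕ} {B : Fin k → Fin n} (hB : StrictMono B) (r : ℕ) :
    basis r B = listBasis r (toDesc B) := by
  funext x
  unfold basis listBasis
  split_ifs
  · rw [chi_eq hB, one_mul]
  · rw [chi_compl, chi_eq hB, length_toDesc]

/-! ## Sums over slices -/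

theorem card_support {n : ℕ} (x : Cube n) : (support x).card = weight x := by
  simp [support, weight]

theorem sum_slice_eq {n : ℕ} (r : ℕ) (G : Finset ℕ → ℝ) :
    ∑ x ∈ slice n r, G (support x) = sliceSum n r G := by
  classical
  rw [sliceSum, ← sum_filter]
  refine sum_nbij' support (fun S i => decide ((i : ℕ) ∈ S)) ?_ ?_ ?_ ?_ fun _ _ => rfl
  · intro x hx
    simp only [slice, mem_filter, mem_univ, true_and] at hx
    simp only [mem_filter, mem_powerset, card_support, hx, and_true]
    intro i hi
    simp only [support, mem_map, mem_filter, mem_univ, true_and, Fin.valEmbedding_apply] at hi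
    obtain ⟨j, -, rfl⟩ := hi
    simp
  all_goals
    have hS : ∀ S ∈ (range n).powerset, support (fun i : Fin n => decide ((i : ℕ) ∈ S)) = S := by
      intro S hS
      ext i
      simp only [support, mem_map, mem_filter, mem_univ, true_and, Fin.valEmbedding_apply,
        decide_eq_true_eq]
      constructor
      · rintro ⟨j, hj, rfl⟩; exact hj
      · intro hi
        exact ⟨⟨i, by simpa using mem_powerset.1 hS hi⟩, hi, rfl⟩
  · intro S hS'
    rw [mem_filter] at hS'
    simp only [slice, mem_filter, mem_univ, true_and]
    rw [← card_support, hS S hS'.1]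
    exact_mod_cast hS'.2
  · intro x _
    funext i
    simp [mem_support]
  · intro S hS'
    exact hS S (mem_filter.1 hS').1

/-- The point with given support. -/
def ofSupport (n : ℕ) (S : Finset ℕ) : Cube n := fun i => decide ((i : ℕ) ∈ S)

theorem ofSupport_support {n : ℕ} (x : Cube n) : ofSupport n (support x) = x := by
  funext i; simp [ofSupport, mem_support]

theorem card_slice (n r : ℕ) : (slice n r).card = n.choose r := by
  have h := sum_slice_eq (n := n) r (fun _ => 1)
  have h' : sliceSum n r (fun _ => 1) = ((powersetCard r (range n)).card : ℝ) := by
    rw [sliceSum, ← sum_filter, powersetCard_eq_filter]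
    simp
  rw [h', card_powersetCard, card_range] at h
  simpa using h

/-- The squared norm of the basis function of `L` on the slice of weight `r`. -/
noncomputable def basisNorm (n r : ℕ) (L : List ℕ) : ℝ :=
  normConst L * intChoose (n - 2 * L.length) ((r : ℤ) - L.length) / n.choose r

theorem listSign_sq (n r : ℕ) (L : List ℕ) :
    ((if 2 * r ≤ n then 1 else (-1) ^ L.length : ℝ)) ^ 2 = 1 := by
  split_ifs
  · simp
  · rw [← pow_mul, mul_comm, pow_mul]; simp

theorem sliceInner_listBasis_self {n r : ℕ} {L : List ℕ} (hL : L ∈ topLists n) :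
    sliceInner (n := n) r (listBasis r L) (listBasis r L) = basisNorm n r L := by
  unfold sliceInner basisNorm
  rw [card_slice, ← sliceSum_youngFun_sq hL, ← sum_slice_eq]
  congr 1
  refine sum_congr rfl fun x _ => ?_
  unfold listBasis
  linear_combination (youngFun L (support x) ^ 2) * listSign_sq n r L

theorem sliceInner_listBasis_of_ne {n r : ℕ} {L L' : List ℕ} (hL : L ∈ topLists n)
    (hL' : L' ∈ topLists n) (h : L ≠ L') :
    sliceInner (n := n) r (listBasis r L) (listBasis r L') = 0 := by
  have := sliceSum_youngFun_mul hL hL' r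
  rw [if_neg h, ← sum_slice_eq] at this
  unfold sliceInner listBasis
  rw [div_eq_zero_iff]; left
  have h2 : ∀ x : Cube n, (if 2 * r ≤ n then (1 : ℝ) else (-1) ^ L.length) *
      youngFun L (support x) * ((if 2 * r ≤ n then 1 else (-1) ^ L'.length) *
        youngFun L' (support x)) =
      ((if 2 * r ≤ n then (1 : ℝ) else (-1) ^ L.length) *
        (if 2 * r ≤ n then 1 else (-1) ^ L'.length)) *
        (youngFun L (support x) * youngFun L' (support x)) := by intro x; ring
  simp only [h2]
  rw [← mul_sum, this, mul_zero]

/-- The weight of `g` at the top set `L`. -/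
noncomputable def listWeight {n : ℕ} (r : ℕ) (g : Cube n → ℝ) (L : List ℕ) : ℝ :=
  sliceInner r g (listBasis r L) ^ 2 / basisNorm n r L

/-- Parseval, with sums replaced by expectations; the signs of the convention for `r > n / 2`
disappear in the squares. -/
theorem sum_listWeight {n : ℕ} (r : ℕ) (g : Cube n → ℝ) :
    ∑ L ∈ topLists n, listWeight r g L = sliceInner r g g := by
  have h := sliceSum_parseval n r (fun S => g (ofSupport n S))
  simp only [← sum_slice_eq, ofSupport_support] at h
  unfold listWeight basisNorm sliceInner
  simp only [card_slice, ← sq, ← h]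
  rw [sum_div]
  refine sum_congr rfl fun L _ => ?_
  have hs : (∑ x ∈ slice n r, g x * listBasis r L x) ^ 2 =
      (∑ x ∈ slice n r, g x * youngFun L (support x)) ^ 2 := by
    have : ∑ x ∈ slice n r, g x * listBasis r L x =
        (if 2 * r ≤ n then 1 else (-1) ^ L.length : ℝ) *
          ∑ x ∈ slice n r, g x * youngFun L (support x) := by
      rw [mul_sum]
      exact sum_congr rfl fun x _ => by unfold listBasis; ring
    rw [this, mul_pow, listSign_sq, one_mul]
  rw [div_pow, hs]
  generalize normConst L * intChoose (n - 2 * L.length) (↑r - ↑L.length) = D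
  rcases eq_or_ne ((n.choose r : ℕ) : ℝ) 0 with h0 | h0
  · simp [h0]
  · rcases eq_or_ne D 0 with hD | hD
    · simp [hD]
    · field_simp

theorem levelWeight_eq {n : ℕ} (r k : ℕ) (g : Cube n → ℝ) :
    levelWeight r k g = ∑ B ∈ topSets n k, listWeight r g (toDesc B) := by
  unfold levelWeight
  refine sum_congr rfl fun B hB => ?_
  have hB' := mem_topSets.1 hB
  unfold fourierCoeff listWeight
  rw [basis_eq hB'.1, sliceInner_listBasis_self (toDesc_mem_topLists.2 hB'), div_pow]
  rcases eq_or_ne (basisNorm n r (toDesc B)) 0 with h0 | h0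
  · simp [h0]
  · field_simp

theorem basisNorm_nonneg {n r : ℕ} {L : List ℕ} (hL : L ∈ topLists n) : 0 ≤ basisNorm n r L := by
  have := one_le_normConst hL
  have := intChoose_nonneg (n - 2 * L.length) ((r : ℤ) - L.length)
  unfold basisNorm; positivity

/-- Levels above `min r (n - r)` do not exist on the slice, so it makes no difference that
`tailWeight` omits them while Parseval's sum includes them. -/
theorem basisNorm_eq_zero {n r : ℕ} (hr : r ≤ n) {L : List ℕ} (hL : L ∈ topLists n)
    (h : min r (n - r) < L.length) :
    basisNorm n r L = 0 := by
  have := length_of_mem_topLists hL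
  unfold basisNorm intChoose
  split_ifs with h1
  · rw [Nat.choose_eq_zero_of_lt]
    · simp
    · omega
  · simp

/-- What is not in the tail is at levels at most `⌊d⌋`: lengths are integers, so rounding `d` down
loses nothing. -/
theorem sum_listWeight_le_of_concentrated {n r : ℕ} (hr : r ≤ n) {d ε : ℝ} (hd : 0 ≤ d)
    {g : Cube n → ℝ} (h : tailWeight r d g < ε) :
    sliceInner r g g - ε < ∑ L ∈ (topLists n).filter (fun L => L.length ≤ ⌊d⌋₊), listWeight r g L := by
  classical
  have hw : ∀ L ∈ topLists n, min r (n - r) < L.length → listWeight r g L = 0 := by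
    intro L hL hl
    rw [listWeight, basisNorm_eq_zero hr hL hl, div_zero]
  have e : tailWeight r d g = ∑ L ∈ (topLists n).filter (fun L => ¬ L.length ≤ ⌊d⌋₊),
      listWeight r g L := by
    unfold tailWeight
    simp only [levelWeight_eq]
    have h2 := sum_topSets_filter (le_refl n)
      (fun k : ℕ => d < (k : ℝ) ∧ k ≤ min r (n - r)) (listWeight r g)
    have h3 : (range (min r (n - r) + 1)).filter (fun k : ℕ => d < (k : ℝ)) =
        (range (n + 1)).filter (fun k : ℕ => d < (k : ℝ) ∧ k ≤ min r (n - r)) := by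
      ext k
      simp only [mem_filter, mem_range]
      constructor
      · rintro ⟨h, h'⟩; exact ⟨by omega, h', by omega⟩
      · rintro ⟨h, h', h''⟩; exact ⟨by omega, h'⟩
    rw [h3, h2]
    refine sum_subset_zero_on_sdiff ?_ ?_ fun _ _ => rfl
    · intro L hL
      rw [mem_filter] at hL ⊢
      refine ⟨hL.1, ?_⟩
      rw [not_le, Nat.floor_lt hd]; exact hL.2.1
    · intro L hL
      simp only [mem_sdiff, mem_filter, not_and, not_le] at hL
      rw [Nat.floor_lt hd] at hL
      exact hw L hL.1.1 (hL.2 hL.1.1 hL.1.2)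
  have := sum_filter_add_sum_filter_not (topLists n) (fun L => L.length ≤ ⌊d⌋₊) (listWeight r g)
  rw [sum_listWeight, ← e] at this
  linarith

/-- The squared distance of `g` from a combination of basis functions. -/
theorem sliceInner_sub_combination {n r : ℕ} (g : Cube n → ℝ) {T : Finset (List ℕ)}
    (hT : T ⊆ topLists n) (κ : List ℕ → ℝ) :
    sliceInner r (fun x => g x - ∑ L ∈ T, κ L * listBasis r L x)
      (fun x => g x - ∑ L ∈ T, κ L * listBasis r L x) =
    sliceInner r g g - 2 * ∑ L ∈ T, κ L * sliceInner r g (listBasis r L) +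
      ∑ L ∈ T, κ L ^ 2 * basisNorm n r L := by
  have h1 : ∑ L ∈ T, κ L ^ 2 * basisNorm n r L =
      sliceInner (n := n) r (fun x => ∑ L ∈ T, κ L * listBasis r L x)
        (fun x => ∑ L ∈ T, κ L * listBasis r L x) := by
    have h2 : ∀ L ∈ T, κ L ^ 2 * basisNorm n r L =
        ∑ L' ∈ T, κ L * κ L' * sliceInner (n := n) r (listBasis r L) (listBasis r L') := by
      intro L hL
      rw [sum_eq_single L, sliceInner_listBasis_self (hT hL), sq]
      · intro L' hL' hne
        rw [sliceInner_listBasis_of_ne (hT hL) (hT hL') hne.symm, mul_zero]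
      · exact fun h => absurd hL h
    rw [sum_congr rfl h2]
    simp only [sliceInner, mul_div_assoc', mul_sum, sum_mul, sum_div]
    simp only [sum_comm (s := slice n r)]
    rw [sum_comm]
    refine sum_congr rfl fun L _ => sum_congr rfl fun L' _ => sum_congr rfl fun x _ => ?_
    ring
  have h3 : ∑ L ∈ T, κ L * sliceInner r g (listBasis r L) =
      sliceInner r g (fun x => ∑ L ∈ T, κ L * listBasis r L x) := by
    simp only [sliceInner, mul_div_assoc', mul_sum, sum_div]
    simp only [sum_comm (s := slice n r)]
    refine sum_congr rfl fun L _ => sum_congr rfl fun x _ => ?_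
    ring
  rw [h1, h3]
  simp only [sliceInner]
  rw [mul_div_assoc', ← sub_div, ← add_div, mul_sum, ← sum_sub_distrib, ← sum_add_distrib]
  congr 1
  refine sum_congr rfl fun x _ => ?_
  ring

end SliceLearner


namespace SliceLearner

/-! ## Sizes of rational numbers -/

/-- Numerator and denominator of `q` have at most `L` binary digits. -/
def Fits (L : ℕ) (q : ℚ) : Prop := q.num.natAbs.size ≤ L ∧ q.den.size ≤ L

theorem Fits.mono {L L' : ℕ} {q : ℚ} (h : Fits L q) (hL : L ≤ L') : Fits L' q :=
  ⟨h.1.trans hL, h.2.trans hL⟩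

/-- Cancelling common factors only makes numerator and denominator smaller, so any representation as
a fraction bounds the size. -/
theorem fits_div_int {L : ℕ} {a b : ℤ} (hb : b ≠ 0) (ha : a.natAbs < 2 ^ L)
    (hb' : b.natAbs < 2 ^ L) : Fits L ((a : ℚ) / b) := by
  rw [← Rat.divInt_eq_div]
  constructor
  · rw [Nat.size_le]
    refine lt_of_le_of_lt ?_ ha
    rcases eq_or_ne a 0 with rfl | h
    · simp
    · exact Nat.le_of_dvd (Int.natAbs_pos.2 h) (Int.natAbs_dvd_natAbs.2 (Rat.num_dvd a hb))
  · rw [Nat.size_le]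
    refine lt_of_le_of_lt ?_ hb'
    have := Int.natAbs_dvd_natAbs.2 (Rat.den_dvd a b)
    exact Nat.le_of_dvd (Int.natAbs_pos.2 hb) (by simpa using this)

theorem Fits.num_lt {L : ℕ} {q : ℚ} (h : Fits L q) : q.num.natAbs < 2 ^ L := Nat.size_le.1 h.1
theorem Fits.den_lt {L : ℕ} {q : ℚ} (h : Fits L q) : q.den < 2 ^ L := Nat.size_le.1 h.2

theorem Fits.mul {L L' : ℕ} {x y : ℚ} (hx : Fits L x) (hy : Fits L' y) :
    Fits (L + L') (x * y) := by
  have e : x * y = ((x.num * y.num : ℤ) : ℚ) / ((x.den * y.den : ℕ) : ℤ) := by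
    conv_lhs => rw [← Rat.num_div_den x, ← Rat.num_div_den y]
    push_cast; rw [div_mul_div_comm]
  rw [e]
  refine fits_div_int (by have := x.den_pos; have := y.den_pos; positivity) ?_ ?_
  · rw [Int.natAbs_mul, pow_add]; exact Nat.mul_lt_mul'' hx.num_lt hy.num_lt
  · rw [Int.natAbs_natCast, pow_add]; exact Nat.mul_lt_mul'' hx.den_lt hy.den_lt

theorem Fits.add {L L' : ℕ} {x y : ℚ} (hx : Fits L x) (hy : Fits L' y) :
    Fits (L + L' + 1) (x + y) := by
  have hx0 : (x.den : ℚ) ≠ 0 := by have := x.den_pos; positivity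
  have hy0 : (y.den : ℚ) ≠ 0 := by have := y.den_pos; positivity
  have e : x + y = ((x.num * y.den + x.den * y.num : ℤ) : ℚ) / ((x.den * y.den : ℕ) : ℤ) := by
    conv_lhs => rw [← Rat.num_div_den x, ← Rat.num_div_den y, div_add_div _ _ hx0 hy0]
    push_cast; rfl
  have h1 := Nat.mul_lt_mul'' hx.num_lt hy.den_lt
  have h2 := Nat.mul_lt_mul'' hx.den_lt hy.num_lt
  have h3 := Nat.mul_lt_mul'' hx.den_lt hy.den_lt
  rw [← pow_add] at h1 h2 h3
  rw [e]
  refine fits_div_int (by have := x.den_pos; have := y.den_pos; positivity) ?_ ?_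
  · refine (Int.natAbs_add_le _ _).trans_lt ?_
    rw [Int.natAbs_mul, Int.natAbs_mul, Int.natAbs_natCast, Int.natAbs_natCast, pow_succ]
    omega
  · rw [Int.natAbs_natCast, pow_succ]; omega

theorem Fits.neg {L : ℕ} {x : ℚ} (hx : Fits L x) : Fits L (-x) := by
  simpa [Fits] using hx

theorem Fits.sub {L L' : ℕ} {x y : ℚ} (hx : Fits L x) (hy : Fits L' y) :
    Fits (L + L' + 1) (x - y) := by
  rw [sub_eq_add_neg]; exact hx.add hy.neg

/-- Deliberately wasteful: the value, not its logarithm, is compared with `L`. As `L` is itself a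
power of `n ^ O(D)`, this affects only the constant in the exponent. -/
theorem fits_int {L : ℕ} {z : ℤ} (h : z.natAbs ≤ L) (hL : 1 ≤ L) : Fits L (z : ℚ) := by
  constructor
  · rw [Nat.size_le]; simpa using h.trans_lt Nat.lt_two_pow_self
  · simpa using hL

theorem fits_nat {L m : ℕ} (h : m ≤ L) (hL : 1 ≤ L) : Fits L (m : ℚ) :=
  fits_int (z := m) (by simpa using h) hL

theorem fits_zero {L : ℕ} (hL : 1 ≤ L) : Fits L 0 := fits_nat (m := 0) (by omega) hL
theorem fits_one {L : ℕ} (hL : 1 ≤ L) : Fits L 1 := by simpa using fits_nat (m := 1) hL hL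

theorem Fits.inv {L : ℕ} {x : ℚ} (hx : Fits L x) : Fits (L + 1) x⁻¹ := by
  rcases eq_or_ne x 0 with rfl | h
  · simpa using fits_zero (L := L + 1) (by omega)
  · have e : x⁻¹ = ((x.den : ℤ) : ℚ) / x.num := by
      conv_lhs => rw [← Rat.num_div_den x]
      rw [inv_div]; rfl
    rw [e]
    have h1 := hx.num_lt
    have h2 := hx.den_lt
    refine fits_div_int (Rat.num_ne_zero.2 h) ?_ ?_
    · rw [pow_succ, Int.natAbs_natCast]; omega
    · rw [pow_succ]; omega

theorem Fits.div {L L' : ℕ} {x y : ℚ} (hx : Fits L x) (hy : Fits L' y) :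
    Fits (L + L' + 1) (x / y) := by
  rw [div_eq_mul_inv]; exact hx.mul hy.inv

theorem Fits.sum {ι : Type*} {L : ℕ} (l : List ι) (g : ι → ℚ) (h : ∀ i ∈ l, Fits L (g i)) :
    Fits (l.length * (L + 1) + 1) (l.map g).sum := by
  induction l with
  | nil => simpa using fits_zero (L := 1) le_rfl
  | cons a l ih =>
    rw [List.map_cons, List.sum_cons]
    refine ((h a (by simp)).add (ih fun i hi => h i (by simp [hi]))).mono ?_
    simp; ring_nf; omega

theorem arithCost_le {L : ℕ} {x y : ℚ} (hx : Fits L x) (hy : Fits L y) :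
    arithCost x y ≤ (1 + 4 * L) ^ 2 := by
  unfold arithCost bitSize
  refine Nat.pow_le_pow_left ?_ 2
  have := hx.1; have := hx.2; have := hy.1; have := hy.2
  omega

/-! ## Running programs -/

theorem Eval.bind {E : Env} {α : Type} {p : Prog Ty.denote α} {s s₁ : State} {a : α}
    (h : Eval E p s a s₁) : ∀ {β : Type} {g : α → Prog Ty.denote β} {b : β} {s₂ : State},
      Eval E (g a) s₁ b s₂ → Eval E (p.bind g) s b s₂ := by
  induction h with
  | ret a s => intro β g b s₂ h; exact h
  | op o k s a s' h ih => intro β g b s₂ h'; exact Eval.op _ _ _ _ _ (ih h')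
  | branch c p q s a s' h ih =>
    intro β g b s₂ h'
    refine Eval.branch _ _ _ _ _ _ ?_
    cases c <;> exact ih h'
  | again body x y k s s₁ s₂ a h₁ h₂ _ ih₂ =>
    intro β g b s₃ h'
    exact Eval.again _ _ _ _ _ _ _ _ h₁ (ih₂ h')
  | done body x z k s s₁ s₂ a h₁ h₂ _ ih₂ =>
    intro β g b s₃ h'
    exact Eval.done _ _ _ _ _ _ _ _ h₁ (ih₂ h')

/-! ### A calculus for runs: results, resources and operation counts -/

/-- Started after the use of `e` examples and `c` bits, the program `p` halts with result `a` after
the use of `e'` examples and `c'` bits, in time `N * (1 + 4 * L) ^ 2`. -/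
def Runs (E : Env) (L : ℕ) {α : Type} (p : Prog Ty.denote α) (e c : ℕ) (a : α) (e' c' N : ℕ) :
    Prop :=
  ∀ τ, ∃ τ', τ' ≤ τ + N * (1 + 4 * L) ^ 2 ∧ Eval E p ⟨e, c, τ⟩ a ⟨e', c', τ'⟩

variable {E : Env} {L : ℕ} {α β : Type} {e c e₁ c₁ e₂ c₂ N N₁ N₂ : ℕ}

theorem Runs.mono {p : Prog Ty.denote α} {a : α} (h : Runs E L p e c a e₁ c₁ N₁) (hN : N₁ ≤ N) :
    Runs E L p e c a e₁ c₁ N := by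
  intro τ
  obtain ⟨τ', h1, h2⟩ := h τ
  exact ⟨τ', h1.trans (by gcongr), h2⟩

theorem runs_ret (a : α) : Runs E L (.ret a) e c a e c 0 :=
  fun τ => ⟨τ, by simp, Eval.ret _ _⟩

theorem runs_pure (a : α) : Runs E L (pure a) e c a e c 0 := runs_ret a

theorem Runs.bind {p : Prog Ty.denote α} {g : α → Prog Ty.denote β} {a : α} {b : β}
    (h₁ : Runs E L p e c a e₁ c₁ N₁) (h₂ : Runs E L (g a) e₁ c₁ b e₂ c₂ N₂) :
    Runs E L (p >>= g) e c b e₂ c₂ (N₁ + N₂) := by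
  intro τ
  obtain ⟨τ₁, t1, h1⟩ := h₁ τ
  obtain ⟨τ₂, t2, h2⟩ := h₂ τ₁
  exact ⟨τ₂, by rw [add_mul]; omega, h1.bind h2⟩

theorem one_le_cost (L : ℕ) : 1 ≤ (1 + 4 * L) ^ 2 := Nat.one_le_pow _ _ (by omega)

theorem Runs.branch {b : Bool} {p q : Prog Ty.denote α} {a : α}
    (h : Runs E L (cond b p q) e c a e₁ c₁ N) :
    Runs E L (.branch (V := Ty.denote) b p q) e c a e₁ c₁ (N + 1) := by
  intro τ
  obtain ⟨τ', t, h⟩ := h (τ + 1)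
  have := one_le_cost L
  exact ⟨τ', by rw [add_mul]; omega, Eval.branch _ _ _ _ _ _ h⟩

theorem Runs.op {τ : Ty} {o : Op Ty.denote τ} {k : τ.denote → Prog Ty.denote α} {v : τ.denote}
    {a : α} (h₁ : Runs E L (instr o) e c v e₁ c₁ N₁) (h₂ : Runs E L (k v) e₁ c₁ a e₂ c₂ N₂) :
    Runs E L (.op o k) e c a e₂ c₂ (N₁ + N₂) := h₁.bind h₂

theorem runs_of_tick {τ : Ty} {o : Op Ty.denote τ} {v : τ.denote} {m : ℕ}
    (h : ∀ s, o.exec E s = (v, s.tick m)) (hm : m ≤ (1 + 4 * L) ^ 2) :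
    Runs E L (instr o) e c v e c 1 := by
  intro t
  refine ⟨t + m, by omega, Eval.op _ _ _ _ _ ?_⟩
  rw [h]; exact Eval.ret _ _

theorem runs_lit {q : ℚ} (h : Fits L q) : Runs E L (lit q) e c q e c 1 := by
  refine runs_of_tick (m := 1 + bitSize q) (fun _ => rfl) ?_
  have := h.1; have := h.2
  unfold bitSize; nlinarith

theorem runs_tt : Runs E L tt e c true e c 1 := runs_of_tick (fun _ => rfl) (one_le_cost L)
theorem runs_ff : Runs E L ff e c false e c 1 := runs_of_tick (fun _ => rfl) (one_le_cost L)

theorem runs_plus {x y : ℚ} (hx : Fits L x) (hy : Fits L y) :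
    Runs E L (plus (V := Ty.denote) x y) e c (x + y : ℚ) e c 1 :=
  runs_of_tick (fun _ => rfl) (arithCost_le hx hy)

theorem runs_minus {x y : ℚ} (hx : Fits L x) (hy : Fits L y) :
    Runs E L (minus (V := Ty.denote) x y) e c (x - y : ℚ) e c 1 :=
  runs_of_tick (fun _ => rfl) (arithCost_le hx hy)

theorem runs_times {x y : ℚ} (hx : Fits L x) (hy : Fits L y) :
    Runs E L (times (V := Ty.denote) x y) e c (x * y : ℚ) e c 1 :=
  runs_of_tick (fun _ => rfl) (arithCost_le hx hy)

theorem runs_divide {x y : ℚ} (hx : Fits L x) (hy : Fits L y) :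
    Runs E L (divide (V := Ty.denote) x y) e c (x / y : ℚ) e c 1 :=
  runs_of_tick (fun _ => rfl) (arithCost_le hx hy)

theorem runs_nil {σ : Ty} : Runs E L (nil (σ := σ)) e c ([] : List σ.denote) e c 1 :=
  runs_of_tick (fun _ => rfl) (one_le_cost L)

theorem runs_cons {σ : Ty} (x : σ.denote) (l : List σ.denote) :
    Runs E L (cons (V := Ty.denote) (σ := σ) x l) e c (x :: l) e c 1 :=
  runs_of_tick (fun _ => rfl) (one_le_cost L)

theorem runs_isNil {σ : Ty} (l : List σ.denote) :
    Runs E L (isNil (V := Ty.denote) (σ := σ) l) e c l.isEmpty e c 1 :=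
  runs_of_tick (fun _ => rfl) (one_le_cost L)

theorem runs_head {σ : Ty} (l : List σ.denote) :
    Runs E L (head (V := Ty.denote) (σ := σ) l) e c (l.headD σ.dflt) e c 1 :=
  runs_of_tick (fun _ => rfl) (one_le_cost L)

theorem runs_tail {σ : Ty} (l : List σ.denote) :
    Runs E L (tail (V := Ty.denote) (σ := σ) l) e c l.tail e c 1 :=
  runs_of_tick (fun _ => rfl) (one_le_cost L)

theorem runs_pair {σ τ : Ty} (x : σ.denote) (y : τ.denote) :
    Runs E L (pair (V := Ty.denote) (σ := σ) (τ := τ) x y) e c (x, y) e c 1 :=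
  runs_of_tick (fun _ => rfl) (one_le_cost L)

theorem runs_fst {σ τ : Ty} (p : σ.denote × τ.denote) :
    Runs E L (fst (V := Ty.denote) (σ := σ) (τ := τ) p) e c p.1 e c 1 :=
  runs_of_tick (fun _ => rfl) (one_le_cost L)

theorem runs_snd {σ τ : Ty} (p : σ.denote × τ.denote) :
    Runs E L (snd (V := Ty.denote) (σ := σ) (τ := τ) p) e c p.2 e c 1 :=
  runs_of_tick (fun _ => rfl) (one_le_cost L)

theorem runs_sample (h : (E.example_ e).1.length ≤ L) :
    Runs E L sample e c (E.example_ e) (e + 1) c 1 := by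
  intro t
  exact ⟨t + ((E.example_ e).1.length + 1), by nlinarith, Eval.op _ _ _ _ _ (Eval.ret _ _)⟩

theorem runs_flip : Runs E L flip e c (E.coin c) e (c + 1) 1 := by
  intro t
  have := one_le_cost L
  exact ⟨t + 1, by omega, Eval.op _ _ _ _ _ (Eval.ret _ _)⟩

theorem runs_ifLe {x y : ℚ} {p q : Prog Ty.denote α} {a : α} (hx : Fits L x) (hy : Fits L y)
    (h₁ : x ≤ y → Runs E L p e c a e₁ c₁ N) (h₂ : y < x → Runs E L q e c a e₁ c₁ N) :
    Runs E L (ifLe (V := Ty.denote) x y p q) e c a e₁ c₁ (N + 2) := by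
  have h : Runs E L (instr (.le (V := Ty.denote) x y)) e c (decide (x ≤ y)) e c 1 :=
    runs_of_tick (fun _ => rfl) (arithCost_le hx hy)
  refine (h.op (a := a) (e₂ := e₁) (c₂ := c₁) (N₂ := N + 1) (Runs.branch ?_)).mono (by omega)
  by_cases hxy : x ≤ y
  · simpa [hxy] using h₁ hxy
  · simpa [hxy] using h₂ (not_le.1 hxy)

theorem runs_ifLt {x y : ℚ} {p q : Prog Ty.denote α} {a : α} (hx : Fits L x) (hy : Fits L y)
    (h₁ : x < y → Runs E L p e c a e₁ c₁ N) (h₂ : y ≤ x → Runs E L q e c a e₁ c₁ N) :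
    Runs E L (ifLt (V := Ty.denote) x y p q) e c a e₁ c₁ (N + 2) :=
  runs_ifLe hy hx h₂ h₁

theorem runs_ifEq {x y : ℚ} {p q : Prog Ty.denote α} {a : α} (hx : Fits L x) (hy : Fits L y)
    (h₁ : x = y → Runs E L p e c a e₁ c₁ N) (h₂ : x ≠ y → Runs E L q e c a e₁ c₁ N) :
    Runs E L (ifEq (V := Ty.denote) x y p q) e c a e₁ c₁ (N + 4) :=
  runs_ifLe hx hy
    (fun h => runs_ifLe hy hx (fun h' => h₁ (le_antisymm h h')) fun h' => h₂ h'.ne)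
    fun h => (h₂ h.ne').mono (by omega)

/-! ### Loops -/

theorem Runs.iter_done {ρ : Type} {σ : Ty} {body : σ.denote → Prog Ty.denote (σ.denote ⊕ ρ)}
    {x : σ.denote} {z : ρ} {k : ρ → Prog Ty.denote α} {a : α}
    (h₁ : Runs E L (body x) e c (.inr z) e₁ c₁ N₁) (h₂ : Runs E L (k z) e₁ c₁ a e₂ c₂ N₂) :
    Runs E L (.iter body x k) e c a e₂ c₂ (N₁ + 1 + N₂) := by
  intro τ
  obtain ⟨τ₁, t1, h1⟩ := h₁ (τ + 1)
  obtain ⟨τ₂, t2, h2⟩ := h₂ τ₁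
  have := one_le_cost L
  exact ⟨τ₂, by simp only [add_mul]; omega, Eval.done _ _ _ _ _ _ _ _ h1 h2⟩

theorem Runs.iter_again {ρ : Type} {σ : Ty} {body : σ.denote → Prog Ty.denote (σ.denote ⊕ ρ)}
    {x y : σ.denote} {k : ρ → Prog Ty.denote α} {a : α}
    (h₁ : Runs E L (body x) e c (.inl y) e₁ c₁ N₁)
    (h₂ : Runs E L (.iter body y k) e₁ c₁ a e₂ c₂ N₂) :
    Runs E L (.iter body x k) e c a e₂ c₂ (N₁ + 1 + N₂) := by
  intro τ
  obtain ⟨τ₁, t1, h1⟩ := h₁ (τ + 1)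
  obtain ⟨τ₂, t2, h2⟩ := h₂ τ₁
  have := one_le_cost L
  exact ⟨τ₂, by simp only [add_mul]; omega, Eval.again _ _ _ _ _ _ _ _ h1 h2⟩

/-- A loop is described by the whole sequence of its states and of its resource counters, so that
termination after `j` rounds and the result need no separate invariant. -/
theorem Runs.iter_seq {ρ : Type} {σ : Ty} {body : σ.denote → Prog Ty.denote (σ.denote ⊕ ρ)}
    {z : ρ} {k : ρ → Prog Ty.denote α} {a : α} (j : ℕ) (st : ℕ → σ.denote) (es cs : ℕ → ℕ)
    (hstep : ∀ i < j, Runs E L (body (st i)) (es i) (cs i) (.inl (st (i + 1))) (es (i + 1))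
      (cs (i + 1)) N)
    (hlast : Runs E L (body (st j)) (es j) (cs j) (.inr z) e₁ c₁ N)
    (hk : Runs E L (k z) e₁ c₁ a e₂ c₂ N₂) :
    Runs E L (.iter body (st 0) k) (es 0) (cs 0) a e₂ c₂ ((j + 1) * (N + 1) + N₂) := by
  induction j generalizing st es cs with
  | zero => exact (hlast.iter_done hk).mono (by omega)
  | succ j ih =>
    refine ((hstep 0 (by omega)).iter_again (ih (fun i => st (i + 1)) (fun i => es (i + 1))
      (fun i => cs (i + 1)) (fun i hi => hstep (i + 1) (by omega)) hlast)).mono ?_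
    ring_nf; omega

theorem Runs.iter_seq_of_eq {ρ : Type} {σ : Ty}
    {body : σ.denote → Prog Ty.denote (σ.denote ⊕ ρ)} {x : σ.denote}
    {z : ρ} {k : ρ → Prog Ty.denote α} {a : α} (j : ℕ) (st : ℕ → σ.denote) (es cs : ℕ → ℕ)
    (hx : x = st 0) (he : e = es 0) (hc : c = cs 0)
    (hstep : ∀ i < j, Runs E L (body (st i)) (es i) (cs i) (.inl (st (i + 1))) (es (i + 1))
      (cs (i + 1)) N)
    (hlast : Runs E L (body (st j)) (es j) (cs j) (.inr z) e₁ c₁ N)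
    (hk : Runs E L (k z) e₁ c₁ a e₂ c₂ N₂) :
    Runs E L (.iter body x k) e c a e₂ c₂ ((j + 1) * (N + 1) + N₂) := by
  subst hx he hc
  exact Runs.iter_seq j st es cs hstep hlast hk

theorem runs_fold_seq {σ ρ : Ty} (l : List σ.denote)
    {body : ρ.denote → σ.denote → Prog Ty.denote ρ.denote} (acc : ℕ → ρ.denote) (es cs : ℕ → ℕ)
    (h : ∀ i (hi : i < l.length), Runs E L (body (acc i) l[i]) (es i) (cs i) (acc (i + 1))
      (es (i + 1)) (cs (i + 1)) N) :
    Runs E L (fold (V := Ty.denote) (σ := σ) (ρ := ρ) l (acc 0) body) (es 0) (cs 0) (acc l.length)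
      (es l.length) (cs l.length) ((l.length + 1) * (N + 10)) := by
  unfold fold
  apply Runs.mono
  · apply Runs.bind (runs_pair _ _)
    refine Runs.iter_seq (N := N + 8) (σ := .prod (.list σ) ρ) l.length
      (fun i => (l.drop i, acc i)) es cs ?_ ?_ (runs_ret _)
    · intro i hi
      have hd : l.drop i = l[i] :: l.drop (i + 1) := (List.cons_getElem_drop_succ).symm
      apply Runs.mono
      · apply Runs.bind (runs_fst _)
        apply Runs.bind (runs_snd _)
        apply Runs.bind (runs_isNil _)
        apply Runs.branch
        simp only [hd, List.isEmpty_cons, cond_false]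
        apply Runs.bind (runs_head _)
        apply Runs.bind (runs_tail _)
        apply Runs.bind (h i hi)
        apply Runs.bind (runs_pair _ _)
        exact runs_pure _
      · omega
    · apply Runs.mono
      · apply Runs.bind (runs_fst _)
        apply Runs.bind (runs_snd _)
        apply Runs.bind (runs_isNil _)
        apply Runs.branch
        simp only [List.drop_length, List.isEmpty_nil, cond_true]
        exact runs_pure _
      · omega
  · ring_nf; omega

/-- The invariant `P` records the bit size of the accumulator after `i` rounds; the cost of
arithmetic in the body can only be bounded with its help. -/
theorem runs_fold_inv {σ ρ : Ty} {l : List σ.denote}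
    {body : ρ.denote → σ.denote → Prog Ty.denote ρ.denote} {a : ρ.denote}
    {M : ℕ} (F : ρ.denote → σ.denote → ρ.denote) (hM : l.length + 1 ≤ M)
    (P : ℕ → ρ.denote → Prop) (h0 : P 0 a)
    (h : ∀ i (hi : i < l.length) (b : ρ.denote), P i b → P (i + 1) (F b l[i]) ∧
      Runs E L (body b l[i]) e c (F b l[i]) e c N) :
    Runs E L (fold (V := Ty.denote) (σ := σ) (ρ := ρ) l a body) e c (l.foldl F a) e c
      (M * (N + 10)) := by
  have hs : ∀ i (hi : i < l.length), (l.take (i + 1)).foldl F a = F ((l.take i).foldl F a) l[i] := by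
    intro i hi
    rw [List.take_succ_eq_append_getElem hi, List.foldl_append]; rfl
  have hP : ∀ i, i ≤ l.length → P i ((l.take i).foldl F a) := by
    intro i
    induction i with
    | zero => intro _; simpa using h0
    | succ i ih =>
      intro hi
      rw [hs i hi]
      exact (h i hi _ (ih (by omega))).1
  have := runs_fold_seq (E := E) (L := L) (N := N) (σ := σ) (ρ := ρ) (body := body) l
    (fun i => (l.take i).foldl F a) (fun _ => e) (fun _ => c)
    (fun i hi => by rw [hs i hi]; exact (h i hi _ (hP i (by omega))).2)
  exact Runs.mono (by simpa using this) (by gcongr)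

theorem runs_fold {σ ρ : Ty} {l : List σ.denote}
    {body : ρ.denote → σ.denote → Prog Ty.denote ρ.denote} {a : ρ.denote}
    {M : ℕ} (F : ρ.denote → σ.denote → ρ.denote) (hM : l.length + 1 ≤ M)
    (h : ∀ b, ∀ x ∈ l, Runs E L (body b x) e c (F b x) e c N) :
    Runs E L (fold (V := Ty.denote) (σ := σ) (ρ := ρ) l a body) e c (l.foldl F a) e c
      (M * (N + 10)) :=
  runs_fold_inv F hM (fun _ _ => True) trivial fun _ _ b _ => ⟨trivial, h b _ (List.getElem_mem _)⟩

theorem runs_fold₂_inv {σ τ ρ : Ty} {l : List σ.denote} {m : List τ.denote}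
    (hlm : l.length = m.length)
    {body : ρ.denote → σ.denote → τ.denote → Prog Ty.denote ρ.denote} {a : ρ.denote}
    {M : ℕ} (F : ρ.denote → σ.denote → τ.denote → ρ.denote) (hM : m.length + 1 ≤ M) (P : ρ.denote → Prop) (h0 : P a)
    (h : ∀ b, P b → ∀ x ∈ l, ∀ y ∈ m, P (F b x y) ∧
      Runs E L (body b x y) e c (F b x y) e c N) :
    Runs E L (fold₂ (V := Ty.denote) (σ := σ) (τ := τ) (ρ := ρ) l m a body) e c
      ((l.zip m).foldl (fun b p => F b p.1 p.2) a) e c (M * (N + 20)) := by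
  unfold fold₂
  refine Runs.mono (N₁ := (m.length + 1) * (N + 20)) ?_ (by gcongr)
  have hzlen : (l.zip m).length = m.length := by simp [hlm]
  set acc : ℕ → ρ.denote := fun i => ((l.zip m).take i).foldl (fun b p => F b p.1 p.2) a with hacc
  have hs : ∀ i (hi : i < m.length), acc (i + 1) = F (acc i) (l[i]'(by omega)) m[i] := by
    intro i hi
    simp only [hacc]
    rw [List.take_succ_eq_append_getElem (by omega), List.foldl_append]; simp
  have hP : ∀ i, i ≤ m.length → P (acc i) := by
    intro i
    induction i with
    | zero => intro _; simpa [hacc] using h0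
    | succ i ih =>
      intro hi
      rw [hs i hi]
      exact (h _ (ih (by omega)) _ (List.getElem_mem _) _ (List.getElem_mem _)).1
  apply Runs.mono
  · apply Runs.bind (runs_pair _ _)
    have key := runs_fold_seq (E := E) (L := L) (N := N + 5) (σ := τ) (ρ := .prod (.list σ) ρ)
      (body := fun s y => do
        let l ← fst s
        let a ← snd s
        let x ← head l
        let l' ← tail l
        let a' ← body a x y
        pair l' a') m
      (fun i => (l.drop i, acc i)) (fun _ => e) (fun _ => c) (by
        intro i hi
        have hd : l.drop i = l[i] :: l.drop (i + 1) := (List.cons_getElem_drop_succ).symm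
        have := (h _ (hP i (by omega)) (l[i]'(by omega)) (List.getElem_mem _) _
          (List.getElem_mem hi)).2
        rw [← hs i hi] at this
        apply Runs.mono
        · apply Runs.bind (runs_fst _)
          apply Runs.bind (runs_snd _)
          simp only [hd]
          apply Runs.bind (runs_head _)
          apply Runs.bind (runs_tail _)
          apply Runs.bind this
          exact runs_pair _ _
        · omega)
    have h0 : (l.drop 0, acc 0) = (l, a) := by simp [hacc]
    rw [h0] at key
    apply Runs.bind key
    have hres : (l.zip m).foldl (fun b p => F b p.1 p.2) a = acc m.length := by
      simp only [hacc]; rw [List.take_of_length_le (by omega)]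
    rw [hres]
    exact runs_snd _
  · ring_nf; omega

theorem runs_repeatTimes_seq {ρ : Ty} (m : ℕ) {body : ρ.denote → Prog Ty.denote ρ.denote}
    (acc : ℕ → ρ.denote) (es cs : ℕ → ℕ) (hm : m ≤ L) (hL : 1 ≤ L)
    (h : ∀ i < m, Runs E L (body (acc i)) (es i) (cs i) (acc (i + 1)) (es (i + 1)) (cs (i + 1)) N) :
    Runs E L (repeatTimes (V := Ty.denote) (ρ := ρ) (m : ℚ) (acc 0) body) (es 0) (cs 0) (acc m)
      (es m) (cs m) ((m + 1) * (N + 12)) := by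
  unfold repeatTimes
  apply Runs.mono
  · apply Runs.bind (runs_lit (fits_zero hL))
    apply Runs.bind (runs_lit (fits_one hL))
    apply Runs.bind (runs_pair _ _)
    have key : Runs E L _ (es 0) (cs 0) _ (es m) (cs m) _ :=
      Runs.iter_seq (N := N + 7) (σ := .prod .num ρ) (ρ := ρ.denote) (k := .ret)
        (body := fun s => do
          let m ← fst s
          let a ← snd s
          ifLe m (0 : ℚ) (pure (.inr a)) (do
            let m' ← minus m (1 : ℚ)
            let a' ← body a
            let s' ← pair m' a'
            pure (.inl s'))) m
        (fun i => (((m : ℚ) - i : ℚ), acc i)) es cs ?_ ?_ (runs_ret (acc m))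
    · simpa using key
    · intro i hi
      have hi' : (i : ℚ) + 1 ≤ m := by exact_mod_cast hi
      have hf : Fits L ((m : ℚ) - i) := by
        have := fits_nat (L := L) (m := m - i) (by omega) hL
        rwa [Nat.cast_sub hi.le] at this
      apply Runs.mono
      · apply Runs.bind (runs_fst _)
        apply Runs.bind (runs_snd _)
        apply runs_ifLe hf (fits_zero hL)
        · intro h
          have h' : (m : ℚ) - i ≤ 0 := h
          exfalso; linarith
        · intro _
          apply Runs.bind (runs_minus hf (fits_one hL))
          apply Runs.bind (h i hi)
          apply Runs.bind (runs_pair _ _)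
          have e1 : (m : ℚ) - i - 1 = m - ((i + 1 : ℕ) : ℚ) := by push_cast; ring
          rw [e1]
          exact runs_pure _
      · omega
    · apply Runs.mono
      · apply Runs.bind (runs_fst _)
        apply Runs.bind (runs_snd _)
        have hf : Fits L ((m : ℚ) - m) := by rw [sub_self]; exact fits_zero hL
        apply runs_ifLe (N := 0) hf (fits_zero hL)
        · intro _; exact runs_pure _
        · intro h; exfalso; simp at h
      · omega
  · ring_nf; omega

theorem runs_repeatTimes {ρ : Ty} {m M : ℕ} {body : ρ.denote → Prog Ty.denote ρ.denote}
    (acc : ℕ → ρ.denote) (hM : m + 1 ≤ M) (hm : m ≤ L) (hL : 1 ≤ L)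
    (h : ∀ i < m, Runs E L (body (acc i)) e c (acc (i + 1)) e c N) :
    Runs E L (repeatTimes (V := Ty.denote) (ρ := ρ) (m : ℚ) (acc 0) body) e c (acc m) e c
      (M * (N + 12)) :=
  (runs_repeatTimes_seq m acc (fun _ => e) (fun _ => c) hm hL h).mono (by gcongr)

end SliceLearner


namespace SliceLearner

variable {E : Env} {L : ℕ} {α β : Type} {e c e₁ c₁ e₂ c₂ N N₁ N₂ : ℕ}

/-! ## Enumeration of sequences and top sets -/

/-- The list `[1, …, n]`. -/
def coordList (n : ℕ) : List ℚ := (List.range n).map fun i : ℕ => (i : ℚ) + 1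

theorem length_coordList (n : ℕ) : (coordList n).length = n := by simp [coordList]

theorem mem_coordList {n : ℕ} {b : ℚ} : b ∈ coordList n ↔ ∃ j < n, b = (j : ℚ) + 1 := by
  simp [coordList, eq_comm]

theorem nodup_coordList (n : ℕ) : (coordList n).Nodup := by
  refine List.Nodup.map (fun i j h => ?_) List.nodup_range
  simpa using h

theorem fits_of_mem_coordList {n : ℕ} (hn : n ≤ L) {b : ℚ} (hb : b ∈ coordList n) : Fits L b := by
  obtain ⟨j, hj, rfl⟩ := mem_coordList.1 hb
  have := fits_nat (L := L) (m := j + 1) (by omega) (by omega)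
  simpa using this

theorem runs_coordinates {n M : ℕ} (hM : n + 1 ≤ M) (hL : M ≤ L) :
    Runs E L (coordinates (V := Ty.denote) (n : ℚ)) e c (coordList n) e c (30 * M) := by
  unfold coordinates
  have h1 : 1 ≤ L := by omega
  apply Runs.mono
  · apply Runs.bind (runs_lit (fits_one h1))
    apply Runs.bind runs_nil
    apply Runs.bind (runs_pair _ _)
    have key := runs_repeatTimes (E := E) (L := L) (e := e) (c := c) (ρ := .prod .num (.list .num))
      (m := n) (M := M) (N := 5)
      (body := fun s => do
        let i ← fst s
        let l ← snd s
        let l' ← cons i l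
        let i' ← minus i (1 : ℚ)
        pair i' l')
      -- Counting down: after `i` rounds the accumulator holds the last `i` coordinates.
      (fun i => ((n : ℚ) - i, (coordList n).drop (n - i))) hM (by omega) h1 (by
        intro i hi
        have e1 : (n : ℚ) - i = ((n - i : ℕ) : ℚ) := by push_cast [hi.le]; ring
        have hf : Fits L ((n : ℚ) - i) := by
          rw [e1]; exact fits_nat (by omega) h1
        apply Runs.mono
        · apply Runs.bind (runs_fst _)
          apply Runs.bind (runs_snd _)
          apply Runs.bind (runs_cons _ _)
          apply Runs.bind (runs_minus hf (fits_one h1))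
          have e2 : ((n : ℚ) - ((i + 1 : ℕ) : ℚ), (coordList n).drop (n - (i + 1))) =
              ((n : ℚ) - i - 1, ((n : ℚ) - i) :: (coordList n).drop (n - i)) := by
            congr 1
            · push_cast; ring
            · have h2 : n - (i + 1) < (coordList n).length := by rw [length_coordList]; omega
              rw [← List.cons_getElem_drop_succ (h := h2)]
              congr 1
              · simp only [coordList, List.getElem_map, List.getElem_range]
                rw [e1, show n - i = n - (i + 1) + 1 by omega]; push_cast; ring
              · congr 1; omega
          rw [e2]
          exact runs_pair _ _
        · omega)
    have e0 : ((n : ℚ) - ((0 : ℕ) : ℚ), (coordList n).drop (n - 0)) = ((n : ℚ), ([] : List ℚ)) := by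
      rw [Nat.sub_zero, List.drop_of_length_le (by rw [length_coordList])]; simp
    rw [e0, Nat.sub_self n, List.drop_zero] at key
    apply Runs.bind key
    exact runs_snd _
  · omega

theorem foldl_member (j : ℚ) (l : List ℚ) (b : Bool) :
    l.foldl (fun b i => if i = j then true else b) b = (b || decide (j ∈ l)) := by
  induction l generalizing b with
  | nil => simp
  | cons i l ih =>
    rw [List.foldl_cons, ih]
    by_cases h : i = j
    · simp [h]
    · simp [h, Ne.symm h]

theorem runs_member {j : ℚ} {l : List ℚ} {M : ℕ} (hj : Fits L j) (hl : ∀ i ∈ l, Fits L i)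
    (hM : l.length + 1 ≤ M) :
    Runs E L (member (V := Ty.denote) j l) e c (decide (j ∈ l)) e c (16 * M) := by
  unfold member
  apply Runs.mono
  · apply Runs.bind runs_ff
    have key := runs_fold (E := E) (L := L) (e := e) (c := c) (N := 5) (σ := .num) (ρ := .bool)
      (l := l) (a := false) (body := fun b i => ifEq i j tt (pure b))
      (fun b i => if i = j then true else b) hM (by
        intro b x hx
        refine runs_ifEq (N := 1) (hl x hx) hj ?_ ?_
        · intro h; simp only [h, if_true]; exact runs_tt
        · intro h; simp only [h, if_false]; exact (runs_pure _).mono (by omega))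
    rw [foldl_member, Bool.false_or] at key
    exact key
  · omega

theorem foldl_filter_cons {σ τ : Type*} (p : σ → Bool) (g : σ → τ) (l : List σ) (out : List τ) :
    l.foldl (fun out s => bif p s then g s :: out else out) out =
      ((l.filter p).map g).reverse ++ out := by
  induction l generalizing out with
  | nil => simp
  | cons a l ih =>
    rw [List.foldl_cons, ih]
    cases h : p a <;> simp [h]

theorem foldl_append_flatMap {σ τ : Type*} (g : σ → List τ) (l : List σ) (out : List τ) :
    l.foldl (fun out s => (g s).reverse ++ out) out = (l.flatMap g).reverse ++ out := by
  induction l generalizing out with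
  | nil => simp
  | cons a l ih => simp [List.foldl_cons, ih]

/-- The sequences of `k` distinct elements of `{1, …, n}`. -/
def seqList (n : ℕ) : ℕ → List (List ℚ)
  | 0 => [[]]
  | k + 1 => ((seqList n k).flatMap fun s =>
      ((coordList n).filter fun j => !decide (j ∈ s)).map fun j => j :: s).reverse

theorem mem_seqList {n k : ℕ} {s : List ℚ} :
    s ∈ seqList n k ↔ s.length = k ∧ s.Nodup ∧ ∀ j ∈ s, j ∈ coordList n := by
  induction k generalizing s with
  | zero =>
    simp only [seqList, List.mem_singleton]
    constructor
    · rintro rfl; simp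
    · exact fun h => List.length_eq_zero_iff.1 h.1
  | succ k ih =>
    simp only [seqList, List.mem_reverse, List.mem_flatMap, List.mem_map, List.mem_filter, ih]
    constructor
    · rintro ⟨s, ⟨h1, h2, h3⟩, j, ⟨hj, hjs⟩, rfl⟩
      refine ⟨by simp [h1], List.nodup_cons.2 ⟨by simpa using hjs, h2⟩, ?_⟩
      intro i hi
      rcases List.mem_cons.1 hi with rfl | hi
      · exact hj
      · exact h3 i hi
    · rintro ⟨h1, h2, h3⟩
      cases s with
      | nil => simp at h1
      | cons j s =>
        rw [List.nodup_cons] at h2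
        exact ⟨s, ⟨by simpa using h1, h2.2, fun i hi => h3 i (by simp [hi])⟩, j,
          ⟨h3 j (by simp), by simpa using h2.1⟩, rfl⟩

theorem nodup_seqList (n k : ℕ) : (seqList n k).Nodup := by
  induction k with
  | zero => simp [seqList]
  | succ k ih =>
    rw [seqList, List.nodup_reverse, List.nodup_flatMap]
    constructor
    · intro s _
      exact ((nodup_coordList n).filter _).map fun i j h => by simpa using h
    · refine ih.imp fun {s s'} hne => ?_
      simp only [Function.onFun, List.disjoint_left, List.mem_map, not_exists, not_and]
      rintro _ ⟨j, -, rfl⟩ i - h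
      exact hne (List.cons.inj h).2.symm

theorem length_seqList_le (n k : ℕ) : (seqList n k).length ≤ n ^ k := by
  induction k with
  | zero => simp [seqList]
  | succ k ih =>
    rw [seqList, List.length_reverse, List.length_flatMap, pow_succ]
    refine (List.sum_le_card_nsmul _ n ?_).trans ?_
    · intro x hx
      simp only [List.mem_map] at hx
      obtain ⟨s, -, rfl⟩ := hx
      rw [List.length_map]
      exact (List.length_filter_le _ _).trans (length_coordList n).le
    · rw [List.length_map, smul_eq_mul]; gcongr

theorem runs_sequences {n k M : ℕ} (hn : n + 1 ≤ M) (hk : k + 1 ≤ M) (hs : n ^ k + 1 ≤ M)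
    (hn1 : 1 ≤ n) (hL : M ≤ L) :
    Runs E L (sequences (V := Ty.denote) (n : ℚ) (k : ℚ)) e c (seqList n k) e c (200 * M ^ 4) := by
  unfold sequences
  have h1 : 1 ≤ L := by omega
  apply Runs.mono
  · apply Runs.bind (runs_coordinates hn hL)
    apply Runs.bind runs_nil
    apply Runs.bind runs_nil
    apply Runs.bind (runs_cons _ _)
    refine runs_repeatTimes (ρ := .list (.list .num)) (N := 1 + M * (M * (16 * M + 2 + 1 + 10) + 10))
      (seqList n) hk (by omega) h1 ?_
    intro i hi
    apply Runs.bind runs_nil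
    have hlen : (seqList n i).length + 1 ≤ M := by
      have := length_seqList_le n i
      have := Nat.pow_le_pow_right hn1 hi.le
      omega
    have hstep : seqList n (i + 1) = (seqList n i).foldl
        (fun out s => (coordList n).foldl
          (fun out j => bif !decide (j ∈ s) then (j :: s) :: out else out) out) [] := by
      simp only [foldl_filter_cons (fun j => !decide (j ∈ _)) (fun j => j :: _)]
      rw [foldl_append_flatMap (fun s => ((coordList n).filter fun j => !decide (j ∈ s)).map
        fun j => j :: s), List.append_nil, seqList]
    rw [hstep]
    refine runs_fold (σ := .list .num) (ρ := .list (.list .num)) _ hlen ?_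
    intro out s hsm
    obtain ⟨hs1, hs2, hs3⟩ := mem_seqList.1 hsm
    refine runs_fold (σ := .num) (ρ := .list (.list .num)) _ (by rw [length_coordList]; exact hn) ?_
    intro out j hj
    apply Runs.mono
    · apply Runs.bind (runs_member (M := M) (fits_of_mem_coordList (by omega) hj)
        (fun i hi => fits_of_mem_coordList (by omega) (hs3 i hi)) (by omega))
      apply Runs.branch (N := 2)
      by_cases hjs : j ∈ s
      · simp only [hjs, decide_true, cond_true, Bool.not_true, cond_false]
        exact (runs_pure _).mono (by omega)
      · simp only [hjs, decide_false, cond_true, Bool.not_false, cond_false]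
        apply Runs.bind (N₁ := 1) (N₂ := 1) (runs_cons _ _)
        exact runs_cons _ _
    · omega
  · have h2 : M ≤ M ^ 2 := Nat.le_self_pow (by omega) M
    have h3 : M ^ 2 ≤ M ^ 3 := Nat.pow_le_pow_right (by omega) (by omega)
    have h4 : M ^ 3 ≤ M ^ 4 := Nat.pow_le_pow_right (by omega) (by omega)
    ring_nf; omega

/-! ### Recognising and listing top sets -/

/-- Whether `A` is disjoint from `B` and below `B` entry by entry. -/
def belowList (A B : List ℚ) : Bool :=
  (A.zip B).foldl (fun b p => bif decide (p.1 ∈ B) then false else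
    bif decide (p.1 < p.2) then b else false) true

theorem belowList_iff {A B : List ℚ} :
    belowList A B = true ↔ ∀ p ∈ A.zip B, p.1 ∉ B ∧ p.1 < p.2 := by
  unfold belowList
  suffices h : ∀ (l : List (ℚ × ℚ)) (b : Bool),
      (l.foldl (fun b p => bif decide (p.1 ∈ B) then false else
        bif decide (p.1 < p.2) then b else false) b = true) ↔
      (b = true ∧ ∀ p ∈ l, p.1 ∉ B ∧ p.1 < p.2) by simpa using h (A.zip B) true
  intro l
  induction l with
  | nil => simp
  | cons p l ih =>
    intro b
    rw [List.foldl_cons, ih, List.forall_mem_cons]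
    by_cases h1 : p.1 ∈ B <;> by_cases h2 : p.1 < p.2 <;> simp [h1, h2]

theorem runs_below {n M : ℕ} {A B : List ℚ} (hAB : A.length = B.length)
    (hA : ∀ a ∈ A, a ∈ coordList n) (hB : ∀ b ∈ B, b ∈ coordList n) (hn : n ≤ L)
    (hM : B.length + 1 ≤ M) :
    Runs E L (below (V := Ty.denote) A B) e c (belowList A B) e c (50 * M ^ 2) := by
  unfold below
  apply Runs.mono
  · apply Runs.bind runs_tt
    refine runs_fold₂_inv (σ := .num) (τ := .num) (ρ := .bool) hAB (N := 16 * M + 4)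
      (fun b x y => bif decide (x ∈ B) then false else bif decide (x < y) then b else false) hM
      (fun _ => True) trivial ?_
    intro b _ x hx y hy
    have fx := fits_of_mem_coordList hn (hA x hx)
    have fy := fits_of_mem_coordList hn (hB y hy)
    refine ⟨trivial, ?_⟩
    apply Runs.mono
    · apply Runs.bind (runs_member (M := M) fx (fun i hi => fits_of_mem_coordList hn (hB i hi)) hM)
      apply Runs.branch (N := 3)
      by_cases hxB : x ∈ B
      · simp only [hxB, decide_true, cond_true]
        exact runs_ff.mono (by omega)
      · simp only [hxB, decide_false, cond_false]
        refine runs_ifLt (N := 1) fx fy ?_ ?_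
        · intro h; simp only [h, decide_true, cond_true]; exact (runs_pure _).mono (by omega)
        · intro h; simp only [not_lt.2 h, decide_false, cond_false]; exact runs_ff
    · omega
  · have h2 : M ≤ M ^ 2 := Nat.le_self_pow (by omega) M
    ring_nf; omega

theorem runs_length {σ : Ty} {l : List σ.denote} {M : ℕ} (hM : l.length + 1 ≤ M) (hL : M ≤ L) :
    Runs E L (length (V := Ty.denote) (σ := σ) l) e c (l.length : ℚ) e c (20 * M) := by
  unfold length
  have h1 : 1 ≤ L := by omega
  apply Runs.mono
  · apply Runs.bind (runs_lit (fits_zero h1))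
    apply Runs.bind (runs_lit (fits_one h1))
    have key := runs_fold_seq (E := E) (L := L) (N := 1) (σ := σ) (ρ := .num)
      (body := fun m _ => plus m (1 : ℚ)) l (fun i => (i : ℚ)) (fun _ => e) (fun _ => c) (by
        intro i hi
        have := runs_plus (E := E) (e := e) (c := c) (fits_nat (L := L) (m := i) (by omega) h1)
          (fits_one h1)
        simpa using this)
    simpa using key
  · have : (l.length + 1) * (1 + 10) ≤ M * 11 := by gcongr
    omega

/-- The sequences below `B`. -/
def allBelowList (n : ℕ) (B : List ℚ) : List (List ℚ) :=
  ((seqList n B.length).filter fun A => belowList A B).reverse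

theorem length_allBelowList_le (n : ℕ) (B : List ℚ) :
    (allBelowList n B).length ≤ n ^ B.length := by
  rw [allBelowList, List.length_reverse]
  exact (List.length_filter_le _ _).trans (length_seqList_le _ _)

theorem mem_allBelowList {n : ℕ} {A B : List ℚ} : A ∈ allBelowList n B ↔
    (A.length = B.length ∧ A.Nodup ∧ ∀ j ∈ A, j ∈ coordList n) ∧ belowList A B = true := by
  rw [allBelowList, List.mem_reverse, List.mem_filter, mem_seqList]

theorem nodup_allBelowList (n : ℕ) (B : List ℚ) : (allBelowList n B).Nodup := by
  rw [allBelowList, List.nodup_reverse]; exact (nodup_seqList _ _).filter _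

theorem runs_allBelow {n M : ℕ} {B : List ℚ} (hn : n + 1 ≤ M) (hn1 : 1 ≤ n)
    (hB : ∀ b ∈ B, b ∈ coordList n) (hk : B.length + 1 ≤ M) (hs : n ^ B.length + 1 ≤ M)
    (hL : M ≤ L) :
    Runs E L (allBelow (V := Ty.denote) (n : ℚ) B) e c (allBelowList n B) e c (300 * M ^ 4) := by
  unfold allBelow
  apply Runs.mono
  · apply Runs.bind (runs_length hk hL)
    apply Runs.bind (runs_sequences hn hk hs hn1 hL)
    apply Runs.bind runs_nil
    have e1 : allBelowList n B = (seqList n B.length).foldl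
        (fun out A => bif belowList A B then A :: out else out) [] := by
      rw [foldl_filter_cons (fun A => belowList A B) (fun A => A)]
      simp [allBelowList]
    rw [e1]
    refine runs_fold (σ := .list .num) (ρ := .list (.list .num)) (M := M) (N := 50 * M ^ 2 + 2) _
      (by have := length_seqList_le n B.length; omega) ?_
    intro out A hA
    obtain ⟨h1, h2, h3⟩ := mem_seqList.1 hA
    apply Runs.mono
    · apply Runs.bind (runs_below h1 h3 hB (by omega) hk)
      apply Runs.branch (N := 1)
      cases belowList A B
      · exact (runs_pure _).mono (by omega)
      · exact runs_cons _ _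
    · omega
  · have h2 : M ≤ M ^ 2 := Nat.le_self_pow (by omega) M
    have h3 : M ^ 2 ≤ M ^ 3 := Nat.pow_le_pow_right (by omega) (by omega)
    have h4 : M ^ 3 ≤ M ^ 4 := Nat.pow_le_pow_right (by omega) (by omega)
    ring_nf; omega

/-- Whether a list of positive numbers is increasing. -/
def increasingList (B : List ℚ) : Bool :=
  (B.foldl (fun s y => (y, bif decide (s.1 < y) then s.2 else false)) ((0 : ℚ), true)).2

theorem increasingList_iff {B : List ℚ} :
    increasingList B = true ↔ List.IsChain (· < ·) (0 :: B) := by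
  unfold increasingList
  suffices h : ∀ (l : List ℚ) (x : ℚ) (b : Bool),
      ((l.foldl (fun s y => (y, bif decide (s.1 < y) then s.2 else false)) (x, b)).2 = true) ↔
      (b = true ∧ List.IsChain (· < ·) (x :: l)) by simpa using h B 0 true
  intro l
  induction l with
  | nil => simp
  | cons y l ih =>
    intro x b
    rw [List.foldl_cons, ih, List.isChain_cons_cons]
    by_cases h : x < y <;> simp [h]

theorem runs_increasing {M : ℕ} {B : List ℚ} (hB : ∀ b ∈ B, Fits L b) (hM : B.length + 1 ≤ M)
    (hL : 1 ≤ L) :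
    Runs E L (increasing (V := Ty.denote) B) e c (increasingList B) e c (30 * M) := by
  unfold increasing
  apply Runs.mono
  · apply Runs.bind (runs_lit (fits_zero hL))
    apply Runs.bind runs_tt
    apply Runs.bind (runs_pair _ _)
    have key := runs_fold_inv (E := E) (L := L) (e := e) (c := c) (σ := .num)
      (ρ := .prod .num .bool) (l := B) (a := ((0 : ℚ), true)) (N := 6)
      (body := fun s y => do
        let x ← fst s
        let b ← snd s
        let b' ← ifLt x y (pure b) ff
        pair y b')
      (fun s y => (y, bif decide (s.1 < y) then s.2 else false)) hM (fun _ s => Fits L s.1)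
      (fits_zero hL) (by
        rintro i hi ⟨x, b⟩ hx
        have hy := hB _ (List.getElem_mem hi)
        refine ⟨hy, ?_⟩
        apply Runs.mono
        · apply Runs.bind (runs_fst _)
          apply Runs.bind (runs_snd _)
          refine Runs.bind (a := bif decide (x < B[i]) then b else false) (N₁ := 3)
            (runs_ifLt (N := 1) hx hy ?_ ?_) (runs_pair _ _)
          · intro h; simp only [h, decide_true, cond_true]; exact (runs_pure _).mono (by omega)
          · intro h; simp only [not_lt.2 h, decide_false, cond_false]; exact runs_ff
        · omega)
    apply Runs.bind key
    exact runs_snd _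
  · omega

/-- Whether a sequence is a top set. -/
def isTopSeq (n : ℕ) (B : List ℚ) : Bool := increasingList B && !(allBelowList n B).isEmpty

/-- The top sets of length less than `k`. -/
def topSeqs (n : ℕ) : ℕ → List (List ℚ)
  | 0 => []
  | k + 1 => ((seqList n k).filter (isTopSeq n)).reverse ++ topSeqs n k

theorem mem_topSeqs {n k : ℕ} {B : List ℚ} : B ∈ topSeqs n k ↔
    B.length < k ∧ B.Nodup ∧ (∀ j ∈ B, j ∈ coordList n) ∧ isTopSeq n B = true := by
  induction k with
  | zero => simp [topSeqs]
  | succ k ih =>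
    simp only [topSeqs, List.mem_append, List.mem_reverse, List.mem_filter, ih, mem_seqList]
    constructor
    · rintro (⟨⟨h1, h2, h3⟩, h4⟩ | ⟨h1, h2⟩)
      · exact ⟨by omega, h2, h3, h4⟩
      · exact ⟨by omega, h2⟩
    · rintro ⟨h1, h2, h3, h4⟩
      rcases Nat.lt_succ_iff_lt_or_eq.1 h1 with h | h
      · exact Or.inr ⟨h, h2, h3, h4⟩
      · exact Or.inl ⟨⟨h, h2, h3⟩, h4⟩

theorem nodup_topSeqs (n k : ℕ) : (topSeqs n k).Nodup := by
  induction k with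
  | zero => simp [topSeqs]
  | succ k ih =>
    rw [topSeqs]
    refine List.Nodup.append (List.nodup_reverse.2 ((nodup_seqList _ _).filter _)) ih ?_
    intro B h1 h2
    rw [List.mem_reverse, List.mem_filter, mem_seqList] at h1
    rw [mem_topSeqs] at h2
    omega

theorem length_topSeqs_le {n D : ℕ} (hn : 1 ≤ n) (k : ℕ) (hk : k ≤ D + 1) :
    (topSeqs n k).length ≤ k * n ^ D := by
  induction k with
  | zero => simp [topSeqs]
  | succ k ih =>
    have h1 := ih (by omega)
    have h2 := length_seqList_le n k
    have h3 := Nat.pow_le_pow_right hn (show k ≤ D by omega)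
    have h4 := List.length_filter_le (isTopSeq n) (seqList n k)
    rw [topSeqs, List.length_append, List.length_reverse, add_mul]
    omega

/-- Each list of sequences of length `k ≤ D` has at most `n ^ k ≤ n ^ D < M` entries, including
those searched for partners; nested passes over such lists give the power of `M`. -/
theorem runs_allTopSets {n D M : ℕ} (hn1 : 1 ≤ n) (hn : n + 1 ≤ M) (hD : D + 2 ≤ M)
    (hs : n ^ D + 1 ≤ M) (hL : M ≤ L) :
    Runs E L (allTopSets (V := Ty.denote) (n : ℚ) (D : ℚ)) e c (topSeqs n (D + 1)) e c
      (1000 * M ^ 6) := by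
  unfold allTopSets
  have h1 : 1 ≤ L := by omega
  apply Runs.mono
  · apply Runs.bind (runs_lit (fits_zero h1))
    apply Runs.bind (runs_lit (fits_one h1))
    apply Runs.bind (runs_plus (fits_nat (by omega) h1) (fits_one h1))
    apply Runs.bind runs_nil
    apply Runs.bind (runs_pair _ _)
    have key := runs_repeatTimes (E := E) (L := L) (e := e) (c := c) (m := D + 1) (M := M)
      (ρ := .prod .num (.list (.list .num)))
      (N := 2 + 200 * M ^ 4 + M * (30 * M + 300 * M ^ 4 + 4 + 10) + 2)
      (body := fun s => do
        let k ← fst s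
        let out₀ ← snd s
        let seqs ← sequences (n : ℚ) k
        let out₁ ← fold seqs out₀ fun out B => do
          let inc ← increasing B
          .branch inc (do
            let As ← allBelow (n : ℚ) B
            let none_ ← isNil As
            .branch none_ (pure out) (cons B out)) (pure out)
        let k' ← plus k (1 : ℚ)
        pair k' out₁) (fun k => ((k : ℚ), topSeqs n k)) hD (by omega) h1 (by
        intro k hk
        have hpow := Nat.pow_le_pow_right hn1 (show k ≤ D by omega)
        apply Runs.mono
        · apply Runs.bind (runs_fst _)
          apply Runs.bind (runs_snd _)
          apply Runs.bind (runs_sequences (k := k) hn (by omega) (by omega) hn1 hL)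
          apply Runs.bind (a := topSeqs n (k + 1)) (e₁ := e) (c₁ := c)
            (N₁ := M * (30 * M + 300 * M ^ 4 + 4 + 10))
          · have e1 : topSeqs n (k + 1) = (seqList n k).foldl
                (fun out A => bif isTopSeq n A then A :: out else out) (topSeqs n k) := by
              rw [foldl_filter_cons (isTopSeq n) (fun A => A)]
              simp [topSeqs]
            rw [e1]
            refine runs_fold (σ := .list .num) (ρ := .list (.list .num)) _
              (by have := length_seqList_le n k; omega) ?_
            intro out B hB
            obtain ⟨b1, b2, b3⟩ := mem_seqList.1 hB
            apply Runs.mono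
            · apply Runs.bind (runs_increasing (M := M)
                (fun b hb => fits_of_mem_coordList (by omega) (b3 b hb)) (by omega) h1)
              apply Runs.branch (N := 300 * M ^ 4 + 3)
              unfold isTopSeq
              cases increasingList B
              · exact (runs_pure _).mono (by omega)
              · apply Runs.mono
                · apply Runs.bind (runs_allBelow (M := M) hn hn1 b3 (by omega)
                    (by rw [b1]; omega) hL)
                  apply Runs.bind (runs_isNil _)
                  apply Runs.branch (N := 1)
                  cases (allBelowList n B).isEmpty
                  · exact runs_cons _ _
                  · exact (runs_pure _).mono (by omega)
                · omega
            · omega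
          · have e2 : (((k + 1 : ℕ) : ℚ), topSeqs n (k + 1)) = ((k : ℚ) + 1, topSeqs n (k + 1)) := by
              push_cast; rfl
            rw [e2]
            apply Runs.bind (runs_plus (fits_nat (by omega) h1) (fits_one h1))
            exact runs_pair _ _
        · omega)
    have e1 : (((D + 1 : ℕ) : ℚ)) = (D : ℚ) + 1 := by push_cast; rfl
    have e0 : (((0 : ℕ) : ℚ), topSeqs n 0) = ((0 : ℚ), []) := by simp [topSeqs]
    rw [e0, e1] at key
    apply Runs.bind key
    exact runs_snd _
  · have h2 : M ≤ M ^ 2 := Nat.le_self_pow (by omega) M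
    have h3 : M ^ 2 ≤ M ^ 4 := Nat.pow_le_pow_right (by omega) (by omega)
    have h4 : M ^ 3 ≤ M ^ 4 := Nat.pow_le_pow_right (by omega) (by omega)
    have h4 : M ^ 4 ≤ M ^ 5 := Nat.pow_le_pow_right (by omega) (by omega)
    have h4 : M ^ 5 ≤ M ^ 6 := Nat.pow_le_pow_right (by omega) (by omega)
    ring_nf; omega

end SliceLearner


namespace SliceLearner

variable {E : Env} {L : ℕ} {α β : Type} {e c e₁ c₁ e₂ c₂ N N₁ N₂ : ℕ}

/-! ## Evaluation of basis functions, norms and combinations -/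

/-- The entry with number `a` of a list, counted from `1`. -/
def entry (X : List ℚ) (a : ℚ) : ℚ := (X.drop (a.num.toNat - 1)).headD 0

theorem entry_succ (X : List ℚ) (j : ℕ) : entry X ((j : ℚ) + 1) = (X.drop j).headD 0 := by
  have h : ((j : ℚ) + 1) = ((j + 1 : ℕ) : ℚ) := by push_cast; rfl
  have h2 : (((j + 1 : ℕ) : ℚ)).num.toNat - 1 = j := by rw [Rat.num_natCast]; simp
  rw [entry, h, h2]

/-- All entries are `0` or `1`. -/
def IsBits (X : List ℚ) : Prop := ∀ u ∈ X, u = 0 ∨ u = 1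

theorem IsBits.entry {X : List ℚ} (h : IsBits X) (a : ℚ) : entry X a = 0 ∨ entry X a = 1 := by
  unfold SliceLearner.entry
  cases hd : X.drop (a.num.toNat - 1) with
  | nil => simp
  | cons u l =>
    simp only [List.headD_cons]
    exact h u (List.mem_of_mem_drop (by rw [hd]; simp))

theorem IsBits.compl {X : List ℚ} (h : IsBits X) : IsBits (X.map fun u => 1 - u) := by
  intro u hu
  obtain ⟨v, hv, rfl⟩ := List.mem_map.1 hu
  rcases h v hv with rfl | rfl <;> simp

theorem IsBits.fits {X : List ℚ} (h : IsBits X) (hL : 1 ≤ L) {u : ℚ} (hu : u ∈ X) : Fits L u := by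
  rcases h u hu with rfl | rfl
  · exact fits_zero hL
  · exact fits_one hL

theorem runs_coordinate {n M : ℕ} (X : List ℚ) {a : ℚ} (ha : a ∈ coordList n) (hn : n + 1 ≤ M)
    (hL : M ≤ L) :
    Runs E L (coordinate (V := Ty.denote) X a) e c (entry X a) e c (20 * M) := by
  unfold coordinate
  have h1 : 1 ≤ L := by omega
  have fa := fits_of_mem_coordList (L := L) (by omega) ha
  obtain ⟨j, hj, rfl⟩ := mem_coordList.1 ha
  apply Runs.mono
  · apply Runs.bind (runs_lit (fits_one h1))
    apply Runs.bind (runs_minus fa (fits_one h1))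
    have e1 : (j : ℚ) + 1 - 1 = j := by ring
    rw [e1]
    have key := runs_repeatTimes (E := E) (L := L) (e := e) (c := c) (ρ := .list .num) (m := j)
      (M := M) (N := 1) (body := fun l => tail l) (fun i => X.drop i) (by omega) (by omega) h1 (by
        intro i hi
        have := runs_tail (E := E) (L := L) (e := e) (c := c) (σ := .num) (X.drop i)
        rwa [List.tail_drop] at this)
    apply Runs.bind key
    rw [entry_succ]
    exact runs_head _
  · omega

/-- The value of `χ_{A,B}` at a list of bits. -/
def chiPairList (X A B : List ℚ) : ℚ :=
  (A.zip B).foldl (fun p ab => p * (entry X ab.1 - entry X ab.2)) 1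

theorem chiPairList_eq (X A B : List ℚ) :
    chiPairList X A B = ((A.zip B).map fun ab => entry X ab.1 - entry X ab.2).prod := by
  unfold chiPairList
  suffices h : ∀ (l : List (ℚ × ℚ)) (p : ℚ),
      l.foldl (fun p ab => p * (entry X ab.1 - entry X ab.2)) p =
        p * (l.map fun ab => entry X ab.1 - entry X ab.2).prod by simpa using h (A.zip B) 1
  intro l
  induction l with
  | nil => simp
  | cons a l ih => intro p; simp [ih, mul_assoc]

theorem chiPairList_mem {X : List ℚ} (hX : IsBits X) (A B : List ℚ) :
    chiPairList X A B = 0 ∨ chiPairList X A B = 1 ∨ chiPairList X A B = -1 := by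
  rw [chiPairList_eq]
  generalize A.zip B = l
  induction l with
  | nil => simp
  | cons a l ih =>
    rw [List.map_cons, List.prod_cons]
    rcases hX.entry a.1 with h | h <;> rcases hX.entry a.2 with h' | h' <;>
      rcases ih with h'' | h'' | h'' <;> simp [h, h', h'']

theorem runs_evalChiPair {n M : ℕ} {X A B : List ℚ} (hX : IsBits X) (hAB : A.length = B.length)
    (hA : ∀ a ∈ A, a ∈ coordList n) (hB : ∀ b ∈ B, b ∈ coordList n) (hn : n + 1 ≤ M)
    (hM : B.length + 1 ≤ M) (hL : M ≤ L) :
    Runs E L (evalChiPair (V := Ty.denote) X A B) e c (chiPairList X A B) e c (70 * M ^ 2) := by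
  unfold evalChiPair
  have h1 : 1 ≤ L := by omega
  have fe : ∀ a, Fits L (entry X a) := by
    intro a
    rcases hX.entry a with h | h <;> rw [h]
    · exact fits_zero h1
    · exact fits_one h1
  have f3 : ∀ {p : ℚ}, p = 0 ∨ p = 1 ∨ p = -1 → Fits L p := by
    rintro p (h | h | h) <;> rw [h]
    · exact fits_zero h1
    · exact fits_one h1
    · exact (fits_one h1).neg
  have d3 : ∀ a b, (entry X a - entry X b) = 0 ∨ (entry X a - entry X b) = 1 ∨
      (entry X a - entry X b) = -1 := by
    intro a b
    rcases hX.entry a with h | h <;> rcases hX.entry b with h' | h' <;> simp [h, h']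
  apply Runs.mono
  · apply Runs.bind (runs_lit (fits_one h1))
    refine runs_fold₂_inv (σ := .num) (τ := .num) (ρ := .num) hAB (N := 40 * M + 2)
      (fun p a b => p * (entry X a - entry X b)) hM (fun p : ℚ => p = 0 ∨ p = 1 ∨ p = -1)
      (Or.inr (Or.inl rfl)) ?_
    intro p hp a ha b hb
    constructor
    · rcases hp with h | h | h <;> rcases d3 a b with h' | h' | h' <;> rw [h, h'] <;> norm_num
    · apply Runs.mono
      · apply Runs.bind (runs_coordinate X (hA a ha) hn hL)
        apply Runs.bind (runs_coordinate X (hB b hb) hn hL)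
        apply Runs.bind (runs_minus (fe a) (fe b))
        exact runs_times (f3 hp) (f3 (d3 a b))
      · omega
  · have h2 : M ≤ M ^ 2 := Nat.le_self_pow (by omega) M
    ring_nf; omega

theorem foldl_add_eq_sum {σ : Type*} (f : σ → ℚ) (l : List σ) (s : ℚ) :
    l.foldl (fun s x => s + f x) s = s + (l.map f).sum := by
  induction l generalizing s with
  | nil => simp
  | cons a l ih => simp [ih, add_assoc]

/-- The value of `χ_B` at a list of bits. -/
def chiList (n : ℕ) (B X : List ℚ) : ℚ := ((allBelowList n B).map fun A => chiPairList X A B).sum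

/-- The value of `χ_B` is a sum of terms `0, 1, -1`, hence an integer bounded by the number of
sequences `A`. This bounds both its bit size and the range of the variables that are averaged. -/
theorem exists_int_sum {σ : Type*} {l : List σ} {g : σ → ℚ}
    (h : ∀ a ∈ l, g a = 0 ∨ g a = 1 ∨ g a = -1) :
    ∃ z : ℤ, (l.map g).sum = z ∧ z.natAbs ≤ l.length := by
  induction l with
  | nil => exact ⟨0, by simp⟩
  | cons a l ih =>
    obtain ⟨z, hz, hz'⟩ := ih fun b hb => h b (by simp [hb])
    rw [List.map_cons, List.sum_cons, hz, List.length_cons]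
    rcases h a (by simp) with h | h | h <;> rw [h]
    · exact ⟨z, by simp, by omega⟩
    · exact ⟨1 + z, by push_cast; ring, by omega⟩
    · exact ⟨-1 + z, by push_cast; ring, by omega⟩

theorem runs_evalChi {n M : ℕ} {X B : List ℚ} (hX : IsBits X) (hn1 : 1 ≤ n)
    (hB : ∀ b ∈ B, b ∈ coordList n) (hn : n + 1 ≤ M) (hM : B.length + 1 ≤ M)
    (hs : n ^ B.length + 1 ≤ M) (hL : M ≤ L) :
    Runs E L (evalChi (V := Ty.denote) (n : ℚ) B X) e c (chiList n B X) e c (400 * M ^ 4) := by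
  unfold evalChi
  have h1 : 1 ≤ L := by omega
  have hlen := length_allBelowList_le n B
  apply Runs.mono
  · apply Runs.bind (runs_lit (fits_zero h1))
    apply Runs.bind (runs_allBelow hn hn1 hB hM hs hL)
    have e1 : chiList n B X = (allBelowList n B).foldl (fun s A => s + chiPairList X A B) 0 := by
      rw [foldl_add_eq_sum, zero_add, chiList]
    rw [e1]
    refine runs_fold_inv (σ := .list .num) (ρ := .num) (N := 70 * M ^ 2 + 1)
      (fun s A => s + chiPairList X A B) (M := M) (by omega)
      (fun i s => ∃ z : ℤ, s = (z : ℚ) ∧ z.natAbs ≤ i) ⟨0, by simp⟩ ?_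
    rintro i hi s ⟨z, rfl, hz⟩
    obtain ⟨⟨a1, -, a3⟩, -⟩ := mem_allBelowList.1 (List.getElem_mem hi)
    generalize (allBelowList n B)[i] = A at a1 a3
    have fz : Fits L (z : ℚ) := fits_int (by omega) h1
    have hc := chiPairList_mem hX A B
    constructor
    · rcases hc with h | h | h <;> rw [h]
      · exact ⟨z, by simp, by omega⟩
      · exact ⟨z + 1, by push_cast; ring, by omega⟩
      · exact ⟨z - 1, by push_cast; ring, by omega⟩
    · apply Runs.mono
      · apply Runs.bind (runs_evalChiPair hX a1 a3 hB hn hM hL)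
        refine runs_plus fz ?_
        rcases hc with h | h | h <;> rw [h]
        · exact fits_zero h1
        · exact fits_one h1
        · exact (fits_one h1).neg
      · exact le_refl _
  · have h2 : M ≤ M ^ 2 := Nat.le_self_pow (by omega) M
    have h3 : M ^ 2 ≤ M ^ 3 := Nat.pow_le_pow_right (by omega) (by omega)
    have h4 : M ^ 3 ≤ M ^ 4 := Nat.pow_le_pow_right (by omega) (by omega)
    ring_nf; omega

theorem runs_reverse {σ : Ty} {l : List σ.denote} {M : ℕ} (hM : l.length + 1 ≤ M) :
    Runs E L (reverse (V := Ty.denote) (σ := σ) l) e c l.reverse e c (12 * M) := by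
  unfold reverse
  apply Runs.mono
  · apply Runs.bind runs_nil
    have key := runs_fold (E := E) (L := L) (e := e) (c := c) (N := 1) (σ := σ) (ρ := .list σ)
      (l := l) (a := []) (body := fun m x => cons x m) (fun m x => x :: m) hM
      (fun b x _ => runs_cons _ _)
    rw [List.foldl_eq_foldr_reverse, List.foldr_cons_nil] at key
    exact key
  · omega

theorem runs_complement {X : List ℚ} {M : ℕ} (hX : IsBits X) (hM : X.length + 1 ≤ M) (hL : M ≤ L) :
    Runs E L (complement (V := Ty.denote) X) e c (X.map fun u => 1 - u) e c (30 * M) := by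
  unfold complement
  have h1 : 1 ≤ L := by omega
  apply Runs.mono
  · apply Runs.bind (runs_lit (fits_one h1))
    apply Runs.bind runs_nil
    have key := runs_fold (E := E) (L := L) (e := e) (c := c) (N := 2) (σ := .num) (ρ := .list .num)
      (l := X) (a := []) (body := fun l u => do
        let u' ← minus (1 : ℚ) u
        cons u' l) (fun m u => (1 - u : ℚ) :: m) hM (by
        intro m u hu
        apply Runs.mono
        · apply Runs.bind (runs_minus (fits_one h1) (hX.fits h1 hu))
          exact runs_cons _ _
        · omega)
    apply Runs.bind key
    have e1 : X.foldl (fun m u => (1 - u) :: m) [] = (X.map fun u => 1 - u).reverse := by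
      simpa using foldl_filter_cons (fun _ => true) (fun u : ℚ => 1 - u) X []
    rw [e1]
    have h := runs_reverse (E := E) (L := L) (e := e) (c := c) (σ := .num)
      (l := (X.map fun u => 1 - u).reverse) (M := M) (by simpa using hM)
    rw [List.reverse_reverse] at h
    exact h
  · omega

/-- The value of the basis function of `B` on the slice of weight `r` at a list of bits. -/
def basisList (n r : ℕ) (B X : List ℚ) : ℚ :=
  if 2 * r ≤ n then chiList n B X else chiList n B (X.map fun u => 1 - u)

theorem exists_int_basisList {n r : ℕ} {B X : List ℚ} (hX : IsBits X) :
    ∃ z : ℤ, basisList n r B X = z ∧ z.natAbs ≤ n ^ B.length := by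
  have h : ∀ Y, IsBits Y → ∃ z : ℤ, chiList n B Y = z ∧ z.natAbs ≤ n ^ B.length := by
    intro Y hY
    obtain ⟨z, hz, hz'⟩ := exists_int_sum (l := allBelowList n B) (g := fun A => chiPairList Y A B)
      fun A _ => chiPairList_mem hY A B
    exact ⟨z, hz, hz'.trans (length_allBelowList_le n B)⟩
  unfold basisList
  split_ifs
  · exact h X hX
  · exact h _ hX.compl

theorem runs_evalBasis {n r M : ℕ} {X B : List ℚ} (hX : IsBits X) (hXn : X.length = n) (hn1 : 1 ≤ n)
    (hr : r ≤ n) (hB : ∀ b ∈ B, b ∈ coordList n) (hn : n + 1 ≤ M) (hM : B.length + 1 ≤ M)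
    (hs : n ^ B.length + 1 ≤ M) (hL : 2 * M ≤ L) :
    Runs E L (evalBasis (V := Ty.denote) (n : ℚ) (r : ℚ) B X) e c (basisList n r B X) e c
      (500 * M ^ 4) := by
  unfold evalBasis
  have h1 : 1 ≤ L := by omega
  have fr : Fits L (r : ℚ) := fits_nat (by omega) h1
  have f2 : Fits L ((r : ℚ) + r) := by
    have := fits_nat (L := L) (m := r + r) (by omega) h1
    simpa using this
  have hiff : (r : ℚ) + r ≤ n ↔ 2 * r ≤ n := by
    rw [two_mul]; exact_mod_cast Iff.rfl
  have h2 : M ≤ M ^ 2 := Nat.le_self_pow (by omega) M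
  have h3 : M ^ 2 ≤ M ^ 3 := Nat.pow_le_pow_right (by omega) (by omega)
  have h4 : M ^ 3 ≤ M ^ 4 := Nat.pow_le_pow_right (by omega) (by omega)
  apply Runs.mono
  · apply Runs.bind (runs_plus fr fr)
    refine runs_ifLe (N := 400 * M ^ 4 + 30 * M) f2 (fits_nat (by omega) h1) ?_ ?_
    · intro h
      rw [basisList, if_pos (hiff.1 h)]
      exact (runs_evalChi hX hn1 hB hn hM hs (by omega)).mono (by omega)
    · intro h
      rw [basisList, if_neg (fun h' => not_lt.2 (hiff.2 h') h)]
      apply Runs.mono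
      · apply Runs.bind (runs_complement (M := M) hX (by omega) (by omega))
        exact runs_evalChi hX.compl hn1 hB hn hM hs (by omega)
      · omega
  · omega

/-- One factor of the norm of `χ_B`. -/
def normFactor (n r : ℕ) (i b : ℚ) : ℚ :=
  (b - (i + i)) * (b - (i + i) - 1) * ((r - i) * ((n : ℚ) - r - i)) /
    ((n - (i + i)) * (n - (i + i) - 1))

/-- The closed formula for the norm of `χ_B`. -/
def normList (n r : ℕ) (B : List ℚ) : ℚ :=
  (B.foldl (fun s b => (s.1 + 1, s.2 * normFactor n r s.1 b)) ((0 : ℚ), (1 : ℚ))).2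

theorem fits_natCast_sub {L a b : ℕ} (ha : a ≤ L) (hb : b ≤ L) (hL : 1 ≤ L) :
    Fits L ((a : ℚ) - b) := by
  have := fits_int (L := L) (z := (a : ℤ) - b) (by omega) hL
  simpa using this

/-- Each of the at most `M` factors is a quotient of products of integers of size `O(M)` and has at
most `24 M + 1` bits; the bits add up to `O(M²)` in the product. -/
theorem runs_normSquare {n r M : ℕ} {B : List ℚ} (hr : r ≤ n) (hB : ∀ b ∈ B, b ∈ coordList n)
    (hn : n + 1 ≤ M) (hM : B.length + 1 ≤ M) (hL : 40 * M ^ 2 ≤ L) :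
    Runs E L (normSquare (V := Ty.denote) (n : ℚ) (r : ℚ) B) e c (normList n r B) e c (40 * M) ∧
      Fits (40 * M ^ 2) (normList n r B) := by
  have hMM : M ≤ M ^ 2 := Nat.le_self_pow (by omega) M
  have h1 : 1 ≤ L := by omega
  have fr : Fits L (r : ℚ) := fits_nat (by omega) h1
  have fn : Fits L (n : ℚ) := fits_nat (by omega) h1
  have ft : Fits (2 * M) ((n : ℚ) - r) := fits_natCast_sub (by omega) (by omega) (by omega)
  have key : ∀ i < B.length, ∀ b ∈ B,
      Fits L (b : ℚ) ∧ Fits (4 * M) (b - ((i : ℚ) + i)) ∧ Fits (4 * M) (b - ((i : ℚ) + i) - 1) ∧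
      Fits (4 * M) ((r : ℚ) - i) ∧ Fits (4 * M) ((n : ℚ) - r - i) ∧
      Fits (4 * M) ((n : ℚ) - ((i : ℚ) + i)) ∧ Fits (4 * M) ((n : ℚ) - ((i : ℚ) + i) - 1) := by
    intro i hi b hb
    have fb := fits_of_mem_coordList (L := L) (by omega) (hB b hb)
    obtain ⟨j, hj, rfl⟩ := mem_coordList.1 (hB b hb)
    refine ⟨fb, ?_, ?_, ?_, ?_, ?_, ?_⟩
    · have := fits_natCast_sub (L := 4 * M) (a := j + 1) (b := i + i) (by omega) (by omega) (by omega)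
      convert this using 1; push_cast; ring
    · have := fits_natCast_sub (L := 4 * M) (a := j) (b := i + i) (by omega) (by omega) (by omega)
      convert this using 1; push_cast; ring
    · exact fits_natCast_sub (by omega) (by omega) (by omega)
    · have := fits_natCast_sub (L := 4 * M) (a := n) (b := r + i) (by omega) (by omega) (by omega)
      convert this using 1; push_cast; ring
    · have := fits_natCast_sub (L := 4 * M) (a := n) (b := i + i) (by omega) (by omega) (by omega)
      convert this using 1; push_cast; ring
    · have := fits_natCast_sub (L := 4 * M) (a := n) (b := i + i + 1) (by omega) (by omega)
        (by omega)
      convert this using 1; push_cast; ring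
  have key2 : ∀ i < B.length, ∀ b ∈ B, Fits (24 * M + 1) (normFactor n r i b) := by
    intro i hi b hb
    obtain ⟨-, f1, f2, f3, f4, f5, f6⟩ := key i hi b hb
    exact (((f1.mul f2).mul (f3.mul f4)).div (f5.mul f6)).mono (by omega)
  -- The first component is the position `i` in `B`, which enters the factor; the second gains `24 M
  -- + 1` bits per round.
  set P : ℕ → ℚ × ℚ → Prop := fun i s => s.1 = i ∧ Fits (i * (24 * M + 1) + 1) s.2 with hP
  have hbound : ∀ i < M, i * (24 * M + 1) + 1 + (24 * M + 1) ≤ 40 * M ^ 2 := by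
    intro i hi
    have : (i + 1) * (24 * M + 1) ≤ M * (24 * M + 1) := Nat.mul_le_mul_right _ hi
    have : M * (24 * M + 1) = 24 * M ^ 2 + M := by ring
    have : (i + 1) * (24 * M + 1) = i * (24 * M + 1) + (24 * M + 1) := by ring
    omega
  have hstepP : ∀ i (hi : i < B.length) (s : ℚ × ℚ), P i s →
      P (i + 1) (s.1 + 1, s.2 * normFactor n r s.1 B[i]) := by
    rintro i hi ⟨x, p⟩ ⟨hx, hp⟩
    simp only at hx hp
    subst hx
    exact ⟨by push_cast; rfl, (hp.mul (key2 i hi _ (List.getElem_mem hi))).mono (by ring_nf; omega)⟩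
  constructor
  · unfold normSquare
    have fco : Fits L ((n : ℚ) - r) := ft.mono (by omega)
    apply Runs.mono
    · apply Runs.bind (runs_lit (fits_zero h1))
      apply Runs.bind (runs_lit (fits_one h1))
      apply Runs.bind (runs_minus fn fr)
      apply Runs.bind (runs_pair _ _)
      have hfold := runs_fold_inv (E := E) (L := L) (e := e) (c := c) (σ := .num)
        (ρ := .prod .num .num) (N := 17) (l := B) (a := ((0 : ℚ), (1 : ℚ)))
        (body := fun s b => do
          let i ← fst s
          let p ← snd s
          let i₂ ← plus i i
          let u ← minus b i₂
          let u' ← minus u (1 : ℚ)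
          let v ← minus (r : ℚ) i
          let w ← minus ((n : ℚ) - r : ℚ) i
          let m ← minus (n : ℚ) i₂
          let m' ← minus m (1 : ℚ)
          let q₁ ← times u u'
          let q₂ ← times v w
          let q₃ ← times q₁ q₂
          let q₄ ← times m m'
          let q ← divide q₃ q₄
          let p' ← times p q
          let i' ← plus i (1 : ℚ)
          pair i' p')
        (fun s b => ((s.1 + 1 : ℚ), (s.2 * normFactor n r s.1 b : ℚ))) hM P
        ⟨by simp, by simpa using fits_one (L := 1) le_rfl⟩ (by
          rintro i hi ⟨x, p⟩ hxp
          refine ⟨hstepP i hi _ hxp, ?_⟩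
          obtain ⟨hx, hp⟩ := hxp
          simp only at hx hp
          subst hx
          have hb := List.getElem_mem hi
          obtain ⟨f0, f1, f2, f3, f4, f5, f6⟩ := key i hi _ hb
          have fi : Fits L (i : ℚ) := fits_nat (by omega) h1
          have fii : Fits L ((i : ℚ) + i) := by
            have := fits_nat (L := L) (m := i + i) (by omega) h1
            simpa using this
          have fp : Fits L p := hp.mono (by have := hbound i (by omega); omega)
          apply Runs.mono
          · apply Runs.bind (runs_fst _)
            apply Runs.bind (runs_snd _)
            apply Runs.bind (runs_plus fi fi)
            apply Runs.bind (runs_minus f0 fii)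
            apply Runs.bind (runs_minus (f1.mono (by omega)) (fits_one h1))
            apply Runs.bind (runs_minus fr fi)
            apply Runs.bind (runs_minus fco fi)
            apply Runs.bind (runs_minus fn fii)
            apply Runs.bind (runs_minus (f5.mono (by omega)) (fits_one h1))
            apply Runs.bind (runs_times (f1.mono (by omega)) (f2.mono (by omega)))
            apply Runs.bind (runs_times (f3.mono (by omega)) (f4.mono (by omega)))
            apply Runs.bind (runs_times ((f1.mul f2).mono (by omega)) ((f3.mul f4).mono (by omega)))
            apply Runs.bind (runs_times (f5.mono (by omega)) (f6.mono (by omega)))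
            apply Runs.bind (runs_divide (((f1.mul f2).mul (f3.mul f4)).mono (by omega))
              ((f5.mul f6).mono (by omega)))
            apply Runs.bind (runs_times fp ((key2 i hi _ hb).mono (by omega)))
            apply Runs.bind (runs_plus fi (fits_one h1))
            exact runs_pair _ _
          · omega)
      apply Runs.bind hfold
      exact runs_snd _
    · omega
  · have hall : ∀ i, i ≤ B.length → P i ((B.take i).foldl
        (fun s b => (s.1 + 1, s.2 * normFactor n r s.1 b)) ((0 : ℚ), (1 : ℚ))) := by
      intro i
      induction i with
      | zero => intro _; exact ⟨by simp, by simpa using fits_one (L := 1) le_rfl⟩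
      | succ i ih =>
        intro hi
        rw [List.take_succ_eq_append_getElem (by omega), List.foldl_append]
        exact hstepP i (by omega) _ (ih (by omega))
    have := (hall B.length le_rfl).2
    rw [List.take_length] at this
    exact this.mono (by have := hbound B.length (by omega); omega)

theorem runs_onSlice {r : ℕ} {X : List ℚ} {M : ℕ} (hX : IsBits X) (hM : X.length + 1 ≤ M)
    (hr : r ≤ L) (hL : M ≤ L) :
    Runs E L (onSlice (V := Ty.denote) (r : ℚ) X) e c (decide (X.sum = r)) e c (20 * M) := by
  unfold onSlice
  have h1 : 1 ≤ L := by omega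
  obtain ⟨z, hz, hz'⟩ := exists_int_sum (l := X) (g := fun u => u)
    fun u hu => (hX u hu).imp id Or.inl
  rw [List.map_id'] at hz
  apply Runs.mono
  · apply Runs.bind (runs_lit (fits_zero h1))
    have key := runs_fold_inv (E := E) (L := L) (e := e) (c := c) (σ := .num) (ρ := .num)
      (N := 1) (l := X) (a := (0 : ℚ)) (body := fun s u => plus s u) (fun s u : ℚ => s + u) hM
      (fun i s => ∃ z : ℤ, s = (z : ℚ) ∧ z.natAbs ≤ i) ⟨0, by simp⟩ (by
        rintro i hi s ⟨z, rfl, hz⟩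
        have hu := List.getElem_mem hi
        constructor
        · rcases hX _ hu with h | h <;> rw [h]
          · exact ⟨z, by simp, by omega⟩
          · exact ⟨z + 1, by push_cast; ring, by omega⟩
        · exact runs_plus (fits_int (by omega) h1) (hX.fits h1 hu))
    have e1 : X.foldl (fun s u : ℚ => s + u) 0 = X.sum := by
      have := foldl_add_eq_sum (fun u : ℚ => u) X 0
      simpa using this
    rw [e1] at key
    apply Runs.bind key
    refine runs_ifEq (N := 1) (hz ▸ fits_int (by omega) h1) (fits_nat hr h1) ?_ ?_
    · intro h; simp only [h, decide_true]; exact runs_tt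
    · intro h; simp only [h, decide_false]; exact runs_ff
  · omega

/-- The value of a combination of basis functions at a list of bits. -/
def combList (n r : ℕ) (g : List (List ℚ × ℚ)) (X : List ℚ) : ℚ :=
  (g.map fun p => p.2 * basisList n r p.1 X).sum

/-- A sum of at most `M` terms of `O(M²)` bits each: adding fractions adds their bit lengths, which
gives `O(M³)` and dictates the choice `L = 200 M³`. -/
theorem runs_evalCombination {n r M : ℕ} {X : List ℚ} {g : List (List ℚ × ℚ)} (hX : IsBits X)
    (hXn : X.length = n) (hn1 : 1 ≤ n) (hr : r ≤ n) (hn : n + 1 ≤ M)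
    (hg : ∀ p ∈ g, (∀ b ∈ p.1, b ∈ coordList n) ∧ p.1.length + 1 ≤ M ∧ n ^ p.1.length + 1 ≤ M ∧
      Fits (50 * M ^ 2) p.2)
    (hgM : g.length + 1 ≤ M) (hL : 60 * M ^ 3 ≤ L) :
    Runs E L (evalCombination (V := Ty.denote) (n : ℚ) (r : ℚ) g X) e c (combList n r g X) e c
      (600 * M ^ 5) ∧ Fits (60 * M ^ 3) (combList n r g X) := by
  have h2 : M ≤ M ^ 2 := Nat.le_self_pow (by omega) M
  have h3 : M ^ 2 ≤ M ^ 3 := Nat.pow_le_pow_right (by omega) (by omega)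
  have h4 : M ^ 3 ≤ M ^ 4 := Nat.pow_le_pow_right (by omega) (by omega)
  have h5 : M ^ 4 ≤ M ^ 5 := Nat.pow_le_pow_right (by omega) (by omega)
  have h1 : 1 ≤ L := by omega
  have fv : ∀ p ∈ g, Fits M (basisList n r p.1 X) := by
    intro p hp
    obtain ⟨z, hz, hz'⟩ := exists_int_basisList (n := n) (r := r) (B := p.1) hX
    rw [hz]; exact fits_int (by have := (hg p hp).2.2.1; omega) (by omega)
  have ft : ∀ p ∈ g, Fits (51 * M ^ 2) (p.2 * basisList n r p.1 X) := fun p hp =>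
    ((hg p hp).2.2.2.mul (fv p hp)).mono (by omega)
  have hbound : ∀ i ≤ M, i * (51 * M ^ 2 + 1) + 1 ≤ 60 * M ^ 3 := by
    intro i hi
    have : i * (51 * M ^ 2 + 1) ≤ M * (51 * M ^ 2 + 1) := Nat.mul_le_mul_right _ hi
    have : M * (51 * M ^ 2 + 1) = 51 * M ^ 3 + M := by ring
    omega
  constructor
  · unfold evalCombination
    have e1 : combList n r g X = g.foldl (fun s p => s + p.2 * basisList n r p.1 X) 0 := by
      rw [foldl_add_eq_sum (fun p : List ℚ × ℚ => p.2 * basisList n r p.1 X), zero_add, combList]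
    rw [e1]
    apply Runs.mono
    · apply Runs.bind (runs_lit (fits_zero h1))
      refine runs_fold_inv (σ := .prod (.list .num) .num) (ρ := .num) (N := 500 * M ^ 4 + 4)
        (fun (s : ℚ) (p : List ℚ × ℚ) => s + p.2 * basisList n r p.1 X) hgM
        (fun i s => Fits (i * (51 * M ^ 2 + 1) + 1) s) (by simpa using fits_zero (L := 1) le_rfl) ?_
      intro i hi s hs
      have hp := List.getElem_mem hi
      refine ⟨(hs.add (ft _ hp)).mono (by ring_nf; omega), ?_⟩
      obtain ⟨g1, g2, g3, g4⟩ := hg _ hp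
      apply Runs.mono
      · apply Runs.bind (runs_fst _)
        apply Runs.bind (runs_snd _)
        apply Runs.bind (runs_evalBasis hX hXn hn1 hr g1 hn g2 g3 (by omega))
        apply Runs.bind (runs_times (g4.mono (by omega)) ((fv _ hp).mono (by omega)))
        exact runs_plus (hs.mono (by have := hbound i (by omega); omega))
          ((ft _ hp).mono (by omega))
      · omega
    · ring_nf; omega
  · exact (Fits.sum g _ ft).mono (hbound _ (by omega))

theorem runs_signum {z : ℚ} (hz : Fits L z) (hL : 1 ≤ L) :
    Runs E L (signum (V := Ty.denote) z) e c (if 0 ≤ z then (1 : ℚ) else -1) e c 4 := by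
  unfold signum
  apply Runs.mono
  · apply Runs.bind (runs_lit (fits_zero hL))
    refine runs_ifLe (N := 1) (fits_zero hL) hz ?_ ?_
    · intro h; rw [if_pos h]; exact runs_lit (fits_one hL)
    · intro h; rw [if_neg (not_le.2 h)]; exact runs_lit (fits_one hL).neg
  · omega

theorem runs_power {x k M : ℕ} (hx : 1 ≤ x) (hk : k + 1 ≤ M) (hM : x ^ k ≤ M) (hxM : x ≤ M)
    (hL : M ≤ L) :
    Runs E L (power (V := Ty.denote) (x : ℚ) (k : ℚ)) e c ((x ^ k : ℕ) : ℚ) e c (20 * M) := by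
  unfold power
  have h1 : 1 ≤ L := by omega
  apply Runs.mono
  · apply Runs.bind (runs_lit (fits_one h1))
    have key := runs_repeatTimes (E := E) (L := L) (e := e) (c := c) (ρ := .num) (m := k)
      (M := M) (N := 1) (body := fun y => times y (x : ℚ)) (fun i => ((x ^ i : ℕ) : ℚ)) hk
      (by omega) h1 (by
        intro i hi
        have := Nat.pow_le_pow_right hx hi.le
        have := runs_times (E := E) (e := e) (c := c)
          (fits_nat (L := L) (m := x ^ i) (by omega) h1) (fits_nat (L := L) (m := x) (by omega) h1)
        have e1 : ((x ^ (i + 1) : ℕ) : ℚ) = ((x ^ i : ℕ) : ℚ) * (x : ℚ) := by push_cast; ring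
        rw [e1]; exact this)
    have e0 : ((x ^ 0 : ℕ) : ℚ) = 1 := by simp
    rw [e0] at key
    exact key
  · omega

end SliceLearner


namespace SliceLearner

/-! ## Estimates from random examples -/

section Estimates

variable {L n : ℕ} {f : Cube n → ℤˣ} {ω : Tape n} {e c e₁ c₁ N N₁ N₂ : ℕ}

/-- A point as a list of numbers. -/
def pointList (x : Cube n) : List ℚ := List.ofFn fun j => if x j then (1 : ℚ) else 0

theorem isBits_pointList (x : Cube n) : IsBits (pointList x) := by
  intro u hu
  obtain ⟨j, rfl⟩ := List.mem_ofFn.1 hu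
  split_ifs <;> simp

theorem length_pointList (x : Cube n) : (pointList x).length = n := by simp [pointList]

theorem sum_pointList (x : Cube n) : (pointList x).sum = weight x := by
  simp [pointList, List.sum_ofFn, weight]

/-- The average of `v` over the first `m` points of `y` that satisfy `K`. -/
def avgOf (y : ℕ → Cube n) (K : Cube n → Bool) (v : Cube n → ℤ) (m : ℕ) : ℚ :=
  ((∑ i ∈ Finset.range m, if K (y i) then v (y i) else 0 : ℤ) : ℚ) /
    ((∑ i ∈ Finset.range m, if K (y i) then 1 else 0 : ℤ) : ℚ)

theorem natAbs_sum_le {K : Cube n → Bool} {v : Cube n → ℤ} {V : ℕ}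
    (hV : ∀ x, K x = true → (v x).natAbs ≤ V) (y : ℕ → Cube n) (m : ℕ) :
    (∑ i ∈ Finset.range m, if K (y i) then v (y i) else 0).natAbs ≤ m * V := by
  induction m with
  | zero => simp
  | succ m ih =>
    rw [Finset.sum_range_succ, add_mul, one_mul]
    refine (Int.natAbs_add_le _ _).trans (add_le_add ih ?_)
    split_ifs with h
    · exact hV _ h
    · simp

theorem fits_avgOf {K : Cube n → Bool} {v : Cube n → ℤ} {V : ℕ}
    (hV : ∀ x, K x = true → (v x).natAbs ≤ V) (y : ℕ → Cube n) (m : ℕ) :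
    Fits (m * V + m + 1) (avgOf y K v m) := by
  have h1 := natAbs_sum_le hV y m
  have h2 := natAbs_sum_le (K := K) (v := fun _ => 1) (V := 1) (by simp) y m
  unfold avgOf
  by_cases h0 : (∑ i ∈ Finset.range m, if K (y i) then (1 : ℤ) else 0) = 0
  · rw [h0]; simpa using fits_zero (by omega)
  · refine fits_div_int h0 ?_ ?_
    · refine lt_of_le_of_lt ?_ (Nat.lt_two_pow_self (n := m * V + m + 1)); omega
    · refine lt_of_le_of_lt ?_ (Nat.lt_two_pow_self (n := m * V + m + 1)); omega

/-- The running sum and the count are integers of size at most `m V` and `m`, so nothing grows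
beyond `L` bits before the single division at the end. The examples used are those numbered `e, …, e
+ m - 1`, whether kept or not. -/
theorem runs_average {m V : ℕ} {keep : List ℚ → Prog Ty.denote Bool}
    {value : List ℚ → ℚ → Prog Ty.denote ℚ} (K : Cube n → Bool) (v : Cube n → ℤ)
    (hk : ∀ x e c, Runs (env f ω) L (keep (pointList x)) e c (K x) e c N)
    (hv : ∀ x e c, K x = true →
      Runs (env f ω) L (value (pointList x) ((f x : ℤ) : ℚ)) e c (v x : ℚ) e c N)
    (hV : ∀ x, K x = true → (v x).natAbs ≤ V) (hmV : m * V ≤ L) (hm : m ≤ L) (hn : n ≤ L)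
    (hL : V + 1 ≤ L) :
    Runs (env f ω) L (average (V := Ty.denote) (m : ℚ) keep value) e c
      (avgOf (fun i => ω.1 (e + i)) K v m) (e + m) c ((m + 1) * (2 * N + 40)) := by
  unfold average
  have h1 : 1 ≤ L := by omega
  set y : ℕ → Cube n := fun i => ω.1 (e + i) with hy
  set s : ℕ → ℤ := fun i => ∑ i ∈ Finset.range i, if K (y i) then v (y i) else 0 with hs
  set q : ℕ → ℤ := fun i => ∑ i ∈ Finset.range i, if K (y i) then 1 else 0 with hq
  have fs : ∀ i ≤ m, Fits L (s i : ℚ) := fun i hi =>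
    fits_int ((natAbs_sum_le hV y i).trans ((Nat.mul_le_mul_right V hi).trans hmV)) h1
  have fq : ∀ i ≤ m, Fits L (q i : ℚ) := fun i hi =>
    fits_int ((natAbs_sum_le (K := K) (v := fun _ => 1) (V := 1) (by simp) y i).trans (by omega)) h1
  apply Runs.mono
  · apply Runs.bind (runs_lit (fits_zero h1))
    apply Runs.bind (runs_lit (fits_one h1))
    apply Runs.bind (runs_pair _ _)
    have key := runs_repeatTimes_seq (E := env f ω) (L := L) (N := 2 * N + 10) (ρ := .prod .num .num) m
      (body := fun s => do
        let e ← sample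
        let x ← fst e
        let y ← snd e
        let b ← keep x
        .branch b (do
          let v ← value x y
          let sum ← fst s
          let cnt ← snd s
          let sum' ← plus sum v
          let cnt' ← plus cnt (1 : ℚ)
          pair sum' cnt') (pure s))
      (fun i => ((s i : ℚ), (q i : ℚ))) (fun i => e + i) (fun _ => c) hm h1 (by
        intro i hi
        apply Runs.mono
        · apply Runs.bind (runs_sample (by
            change (pointList _).length ≤ L
            rw [length_pointList]; exact hn))
          apply Runs.bind (runs_fst _)
          apply Runs.bind (runs_snd _)
          apply Runs.bind (hk (y i) _ _)
          apply Runs.branch (N := N + 5)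
          have es : s (i + 1) = s i + if K (y i) then v (y i) else 0 := by
            simp only [hs]; rw [Finset.sum_range_succ]
          have eq : q (i + 1) = q i + if K (y i) then 1 else 0 := by
            simp only [hq]; rw [Finset.sum_range_succ]
          rw [es, eq]
          by_cases hK : K (y i) = true
          · simp only [hK, cond_true, if_true]
            apply Runs.mono
            · apply Runs.bind (hv (y i) _ _ hK)
              apply Runs.bind (runs_fst _)
              apply Runs.bind (runs_snd _)
              apply Runs.bind (runs_plus (fs i hi.le) (fits_int ((hV _ hK).trans (by omega)) h1))
              apply Runs.bind (runs_plus (fq i hi.le) (fits_one h1))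
              have e3 : (((s i + v (y i) : ℤ) : ℚ), ((q i + 1 : ℤ) : ℚ)) =
                  ((s i : ℚ) + v (y i), (q i : ℚ) + 1) := by push_cast; rfl
              rw [e3]
              exact runs_pair _ _
            · omega
          · simp only [hK, cond_false, Bool.false_eq_true, if_false, add_zero]
            exact (runs_pure _).mono (by omega)
        · omega)
    have e0 : ((s 0 : ℚ), (q 0 : ℚ)) = ((0 : ℚ), (0 : ℚ)) := by simp [hs, hq]
    rw [e0] at key
    apply Runs.bind key
    apply Runs.bind (runs_fst _)
    apply Runs.bind (runs_snd _)
    exact runs_divide (fs m le_rfl) (fq m le_rfl)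
  · ring_nf; omega

/-- The estimate of `⟨f, χ_B⟩` from the points `y 0, …, y (m - 1)`. -/
def innerEst (f : Cube n → ℤˣ) (r : ℕ) (B : List ℚ) (y : ℕ → Cube n) (m : ℕ) : ℚ :=
  avgOf y (fun x => decide (weight x = r))
    (fun x => (f x : ℤ) * (basisList n r B (pointList x)).num) m

/-- The value of the hypothesis `sgn (g - θ)`. -/
def signOf (r : ℕ) (g : List (List ℚ × ℚ)) (θ : ℚ) (x : Cube n) : ℤ :=
  if 0 ≤ combList n r g (pointList x) - θ then 1 else -1

/-- The estimate of the error of `sgn (g - θ)` on the slice of weight `r`. -/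
def errorEst (f : Cube n → ℤˣ) (r : ℕ) (g : List (List ℚ × ℚ)) (θ : ℚ) (y : ℕ → Cube n) (m : ℕ) :
    ℚ :=
  avgOf y (fun x => decide (weight x = r)) (fun x => if (f x : ℤ) = signOf r g θ x then 0 else 1) m

/-- The estimate of the expectation of `f` outside the slice of weight `r`. -/
def offEst (f : Cube n → ℤˣ) (r : ℕ) (y : ℕ → Cube n) (m : ℕ) : ℚ :=
  avgOf y (fun x => !decide (weight x = r)) (fun x => (f x : ℤ)) m

/-- The threshold obtained from `n` random bits. -/
def threshold (b : ℕ → Bool) (n : ℕ) : ℚ :=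
  -1 + ∑ j ∈ Finset.range n, if b j then (1 / 2 : ℚ) ^ j else 0

/-! ### Common size bounds and the cost of the estimates -/

/-- Bounds on all quantities that occur in a run of the algorithm: `n` is the dimension, `D` the
degree, `m` the number of examples of an estimate. -/
structure Bounds (n D m M L : ℕ) : Prop where
  one_le : 1 ≤ n
  hundred_le : 100 ≤ M
  n_le : n + 1 ≤ M
  D_le : D + 2 ≤ M
  pow_le : n ^ D + 1 ≤ M
  card_le : (D + 1) * n ^ D + 1 ≤ M
  m_le : m + 1 ≤ M
  L_eq : L = 200 * M ^ 3

theorem Bounds.chain {n D m M L : ℕ} (h : Bounds n D m M L) :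
    M ≤ M ^ 2 ∧ M ^ 2 ≤ M ^ 3 ∧ M ^ 3 ≤ M ^ 4 ∧ M ^ 4 ≤ M ^ 5 ∧ M ^ 5 ≤ M ^ 6 ∧ M ^ 6 ≤ M ^ 7 ∧
      M ^ 7 ≤ M ^ 8 := by
  have h1 : 0 < M := by have := h.hundred_le; omega
  refine ⟨Nat.le_self_pow (by omega) M, ?_, ?_, ?_, ?_, ?_, ?_⟩ <;>
  exact Nat.pow_le_pow_right h1 (by omega)

theorem natAbs_units (u : ℤˣ) : (u : ℤ).natAbs = 1 := by
  rcases Int.units_eq_one_or u with h | h <;> simp [h]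

theorem fits_units (u : ℤˣ) (hL : 1 ≤ L) : Fits L ((u : ℤ) : ℚ) :=
  fits_int (by rw [natAbs_units]; exact hL) hL

theorem runs_onSlice_point {D m M r : ℕ} (hp : Bounds n D m M L) (hr : r ≤ n) (x : Cube n) :
    Runs (env f ω) L (onSlice (V := Ty.denote) (r : ℚ) (pointList x)) e c (decide (weight x = r))
      e c (20 * M) := by
  have := hp.chain; have := hp.n_le; have := hp.L_eq
  have h := runs_onSlice (E := env f ω) (L := L) (e := e) (c := c) (r := r) (M := M)
    (isBits_pointList x) (by rw [length_pointList]; omega) (by omega) (by omega)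
  rw [sum_pointList] at h
  simpa using h

/-- The conditions on a sequence that occurs as a top set of length at most `D`. -/
def IsShort (n D : ℕ) (B : List ℚ) : Prop := (∀ b ∈ B, b ∈ coordList n) ∧ B.length ≤ D

theorem IsShort.pow_le {D m M : ℕ} {B : List ℚ} (h : IsShort n D B) (hp : Bounds n D m M L) :
    n ^ B.length + 1 ≤ M := by
  have := Nat.pow_le_pow_right hp.one_le h.2
  have := hp.pow_le
  omega

theorem basisList_num {r : ℕ} {B X : List ℚ} (hX : IsBits X) :
    basisList n r B X = ((basisList n r B X).num : ℚ) ∧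
      (basisList n r B X).num.natAbs ≤ n ^ B.length := by
  obtain ⟨z, hz, hz'⟩ := exists_int_basisList (n := n) (r := r) (B := B) hX
  rw [hz, Rat.num_intCast]
  exact ⟨rfl, hz'⟩

theorem natAbs_inner_le {D m M r : ℕ} {B : List ℚ} (h : IsShort n D B) (hp : Bounds n D m M L)
    (x : Cube n) : ((f x : ℤ) * (basisList n r B (pointList x)).num).natAbs ≤ M - 1 := by
  rw [Int.natAbs_mul, natAbs_units, one_mul]
  have := h.pow_le hp
  exact (basisList_num (isBits_pointList x)).2.trans (by omega)

theorem runs_estimateInner {D m M r : ℕ} {B : List ℚ} (hp : Bounds n D m M L) (hr : r ≤ n)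
    (hB : IsShort n D B) :
    Runs (env f ω) L (estimateInner (V := Ty.denote) (m : ℚ) (n : ℚ) (r : ℚ) B) e c
      (innerEst f r B (fun i => ω.1 (e + i)) m) (e + m) c (2000 * M ^ 5) ∧
    Fits (2 * M ^ 2) (innerEst f r B (fun i => ω.1 (e + i)) m) := by
  obtain ⟨h2, h3, h4, h5, -⟩ := hp.chain
  have h1 := hp.n_le; have hL := hp.L_eq; have hm := hp.m_le; have hD := hp.D_le
  have h100 := hp.hundred_le
  have hmM : m * (M - 1) ≤ M ^ 2 := by
    rw [sq]; exact Nat.mul_le_mul (by omega) (by omega)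
  constructor
  · unfold estimateInner
    refine Runs.mono (runs_average (N := 500 * M ^ 4 + 1 + 20 * M) (V := M - 1)
      (fun x => decide (weight x = r))
      (fun x => (f x : ℤ) * (basisList n r B (pointList x)).num) ?_ ?_ ?_ ?_ ?_ ?_ ?_) ?_
    · exact fun x e c => (runs_onSlice_point hp hr x).mono (by omega)
    · intro x e c _
      apply Runs.mono
      · apply Runs.bind (runs_evalBasis (M := M) (isBits_pointList x) (length_pointList x) hp.one_le
          hr hB.1 h1 (by have := hB.2; omega) (hB.pow_le hp) (by omega))
        have hn := (basisList_num (n := n) (r := r) (B := B) (isBits_pointList x)).1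
        have e1 : (((f x : ℤ) * (basisList n r B (pointList x)).num : ℤ) : ℚ) =
            ((f x : ℤ) : ℚ) * basisList n r B (pointList x) := by
          conv_rhs => rw [hn]
          push_cast; rfl
        rw [e1]
        refine runs_times (fits_units _ (by omega)) ?_
        rw [hn]
        refine fits_int ?_ (by omega)
        have := (basisList_num (n := n) (r := r) (B := B) (isBits_pointList x)).2
        have := hB.pow_le hp
        omega
      · omega
    · exact fun x _ => natAbs_inner_le hB hp x
    · omega
    · omega
    · omega
    · omega
    · have : (m + 1) * (2 * (500 * M ^ 4 + 1 + 20 * M) + 40) ≤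
        M * (2 * (500 * M ^ 4 + 1 + 20 * M) + 40) := Nat.mul_le_mul_right _ hm
      have : M * (2 * (500 * M ^ 4 + 1 + 20 * M) + 40) = 1000 * M ^ 5 + 40 * M ^ 2 + 42 * M := by ring
      omega
  · exact (fits_avgOf (V := M - 1) (fun x _ => natAbs_inner_le hB hp x) _ _).mono (by omega)

/-- The conditions on a combination of basis functions. -/
def IsGoodComb (n D M : ℕ) (g : List (List ℚ × ℚ)) : Prop :=
  g.length + 1 ≤ M ∧ ∀ p ∈ g, IsShort n D p.1 ∧ Fits (50 * M ^ 2) p.2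

theorem runs_estimateError {D m M r : ℕ} {g : List (List ℚ × ℚ)} {θ : ℚ} (hp : Bounds n D m M L)
    (hr : r ≤ n) (hg : IsGoodComb n D M g) (hθ : Fits (5 * M ^ 2) θ) :
    Runs (env f ω) L (estimateError (V := Ty.denote) (m : ℚ) (n : ℚ) (r : ℚ) g θ) e c
      (errorEst f r g θ (fun i => ω.1 (e + i)) m) (e + m) c (2000 * M ^ 6) ∧
    Fits (2 * M ^ 2) (errorEst f r g θ (fun i => ω.1 (e + i)) m) := by
  obtain ⟨h2, h3, h4, h5, h6, -⟩ := hp.chain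
  have h1 := hp.n_le; have hL := hp.L_eq; have hm := hp.m_le; have hD := hp.D_le
  have h100 := hp.hundred_le
  have hV : ∀ x : Cube n, (if (f x : ℤ) = signOf r g θ x then (0 : ℤ) else 1).natAbs ≤ 1 := by
    intro x; split_ifs <;> simp
  have hg' : ∀ p ∈ g, (∀ b ∈ p.1, b ∈ coordList n) ∧ p.1.length + 1 ≤ M ∧
      n ^ p.1.length + 1 ≤ M ∧ Fits (50 * M ^ 2) p.2 := fun p hpg =>
    ⟨(hg.2 p hpg).1.1, by have := (hg.2 p hpg).1.2; omega, (hg.2 p hpg).1.pow_le hp, (hg.2 p hpg).2⟩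
  constructor
  · unfold estimateError
    apply Runs.mono
    · apply Runs.bind (runs_lit (fits_zero (by omega)))
      apply Runs.bind (runs_lit (fits_one (by omega)))
      refine runs_average (N := 600 * M ^ 5 + 20 * M + 10) (V := 1) (fun x => decide (weight x = r))
        (fun x => if (f x : ℤ) = signOf r g θ x then 0 else 1) ?_ ?_ (fun x _ => hV x) ?_ ?_ ?_ ?_
      · exact fun x e c => (runs_onSlice_point hp hr x).mono (by omega)
      · intro x e c _
        have hc := runs_evalCombination (E := env f ω) (L := L) (e := e) (c := c) (r := r)
          (isBits_pointList x) (length_pointList x) hp.one_le hr h1 hg' hg.1 (by omega)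
        have fd := (hc.2.sub hθ).mono (show 60 * M ^ 3 + 5 * M ^ 2 + 1 ≤ L by omega)
        apply Runs.mono
        · apply Runs.bind hc.1
          apply Runs.bind (runs_minus (hc.2.mono (by omega)) (hθ.mono (by omega)))
          apply Runs.bind (runs_signum fd (by omega))
          have hs : (if 0 ≤ combList n r g (pointList x) - θ then (1 : ℚ) else -1) =
              ((signOf r g θ x : ℤ) : ℚ) := by
            unfold signOf; split_ifs <;> simp
          rw [hs]
          refine runs_ifEq (N := 0) (fits_units _ (by omega)) ?_ ?_ ?_
          · rw [← hs]
            split_ifs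
            · exact fits_one (by omega)
            · exact (fits_one (by omega)).neg
          · intro h
            rw [if_pos (by exact_mod_cast h)]
            simpa using runs_pure (0 : ℚ)
          · intro h
            rw [if_neg (by exact_mod_cast h)]
            simpa using runs_pure (1 : ℚ)
        · omega
      · omega
      · omega
      · omega
      · omega
    · have : (m + 1) * (2 * (600 * M ^ 5 + 20 * M + 10) + 40) ≤
        M * (2 * (600 * M ^ 5 + 20 * M + 10) + 40) := Nat.mul_le_mul_right _ hm
      have : M * (2 * (600 * M ^ 5 + 20 * M + 10) + 40) = 1200 * M ^ 6 + 40 * M ^ 2 + 60 * M := by ring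
      omega
  · exact (fits_avgOf (V := 1) (fun x _ => hV x) _ _).mono (by omega)

theorem runs_estimateOff {D m M r : ℕ} (hp : Bounds n D m M L) (hr : r ≤ n) :
    Runs (env f ω) L (estimateOff (V := Ty.denote) (m : ℚ) (r : ℚ)) e c
      (offEst f r (fun i => ω.1 (e + i)) m) (e + m) c (200 * M ^ 2) ∧
    Fits (2 * M ^ 2) (offEst f r (fun i => ω.1 (e + i)) m) := by
  obtain ⟨h2, h3, h4, h5, h6, -⟩ := hp.chain
  have h1 := hp.n_le; have hL := hp.L_eq; have hm := hp.m_le; have hD := hp.D_le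
  have h100 := hp.hundred_le
  constructor
  · unfold estimateOff
    refine Runs.mono (runs_average (N := 20 * M + 2) (V := 1) (fun x => !decide (weight x = r))
      (fun x => (f x : ℤ)) ?_ ?_ ?_ ?_ ?_ ?_ ?_) ?_
    · intro x e c
      apply Runs.mono
      · apply Runs.bind (runs_onSlice_point hp hr x)
        apply Runs.branch (N := 1)
        by_cases h : weight x = r
        · simp only [h, decide_true, cond_true, Bool.not_true]; exact runs_ff
        · simp only [h, decide_false, cond_false, Bool.not_false]; exact runs_tt
      · omega
    · exact fun x e c _ => (runs_pure _).mono (by omega)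
    · exact fun x _ => (natAbs_units _).le
    · omega
    · omega
    · omega
    · omega
    · have : (m + 1) * (2 * (20 * M + 2) + 40) ≤ M * (2 * (20 * M + 2) + 40) :=
        Nat.mul_le_mul_right _ hm
      have : M * (2 * (20 * M + 2) + 40) = 40 * M ^ 2 + 44 * M := by ring
      omega
  · exact (fits_avgOf (V := 1) (fun x _ => (natAbs_units _).le) _ _).mono (by omega)

theorem fits_half_pow (j : ℕ) : Fits (j + 1) ((1 / 2 : ℚ) ^ j) := by
  have h : (1 / 2 : ℚ) ^ j = ((1 : ℤ) : ℚ) / ((2 ^ j : ℤ) : ℚ) := by push_cast; rw [one_div_pow]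
  rw [h]
  refine fits_div_int (by positivity) ?_ ?_
  · simp
  · rw [Int.natAbs_pow]; exact Nat.pow_lt_pow_right (by norm_num) (by simp)

/-- Each of the at most `n` additions adds at most `M + 1` bits by the general rule for sums. -/
theorem fits_threshold (b : ℕ → Bool) {n M : ℕ} (hn : n + 1 ≤ M) (k : ℕ) (hk : k ≤ n) :
    Fits (5 * M ^ 2) (threshold b k) := by
  have h : Fits (k * (M + 1) + 2) (threshold b k) := by
    induction k with
    | zero => simpa [threshold] using ((fits_one (L := 1) le_rfl).neg).mono (by omega)
    | succ k ih =>
      have e1 : threshold b (k + 1) = threshold b k + if b k then (1 / 2 : ℚ) ^ k else 0 := by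
        rw [threshold, Finset.sum_range_succ, ← add_assoc]; rfl
      rw [e1]
      have h1 : Fits (k + 1) (if b k then (1 / 2 : ℚ) ^ k else 0) := by
        split_ifs
        · exact fits_half_pow k
        · exact fits_zero (by omega)
      exact ((ih (by omega)).add h1).mono (by ring_nf; omega)
  refine h.mono ?_
  have : k * (M + 1) ≤ M * (M + 1) := Nat.mul_le_mul_right _ (by omega)
  have : M * (M + 1) = M ^ 2 + M := by ring
  have : M ≤ M ^ 2 := Nat.le_self_pow (by omega) M
  omega

end Estimates

end SliceLearner


namespace SliceLearner

/-! ## A run of the learner -/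

section Learner

variable {L n : ℕ} {f : Cube n → ℤˣ} {ω : Tape n} {e c e₁ c₁ N N₁ N₂ : ℕ}

theorem runs_randomThreshold {E : Env} {M : ℕ} (hn : n + 1 ≤ M) (hL : 200 * M ^ 3 ≤ L) :
    Runs E L (randomThreshold (V := Ty.denote) (n : ℚ)) e c
      (threshold (fun j => E.coin (c + j)) n) e (c + n) (30 * M) := by
  have h2 : M ≤ M ^ 2 := Nat.le_self_pow (by omega) M
  have h3 : M ^ 2 ≤ M ^ 3 := Nat.pow_le_pow_right (by omega) (by omega)
  have h1 : 1 ≤ L := by omega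
  have f2 : Fits L 2 := by simpa using fits_nat (L := L) (m := 2) (by omega) h1
  unfold randomThreshold
  apply Runs.mono
  · apply Runs.bind (runs_lit (fits_one h1))
    apply Runs.bind (runs_lit f2)
    apply Runs.bind (runs_lit (fits_one h1).neg)
    apply Runs.bind (runs_pair _ _)
    have key := runs_repeatTimes_seq (E := E) (L := L) (N := 7) (ρ := .prod .num .num) n
      (body := fun s => do
        let w ← fst s
        let θ ← snd s
        let w' ← divide w (2 : ℚ)
        let b ← flip
        .branch b (do
          let θ' ← plus θ w
          pair w' θ') (pair w' θ))
      (fun i => ((1 / 2 : ℚ) ^ i, threshold (fun j => E.coin (c + j)) i))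
      (fun _ => e) (fun i => c + i) (by omega) h1 (by
        intro i hi
        have fw := (fits_half_pow i).mono (show i + 1 ≤ L by omega)
        have fθ := (fits_threshold (fun j => E.coin (c + j)) hn i hi.le).mono
          (show 5 * M ^ 2 ≤ L by omega)
        apply Runs.mono
        · apply Runs.bind (runs_fst _)
          apply Runs.bind (runs_snd _)
          apply Runs.bind (runs_divide fw f2)
          apply Runs.bind runs_flip
          apply Runs.branch (N := 2)
          have e1 : threshold (fun j => E.coin (c + j)) (i + 1) =
              threshold (fun j => E.coin (c + j)) i +
                if E.coin (c + i) then (1 / 2 : ℚ) ^ i else 0 := by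
            rw [threshold, Finset.sum_range_succ, ← add_assoc]; rfl
          have e2 : (1 / 2 : ℚ) ^ (i + 1) = (1 / 2 : ℚ) ^ i / 2 := by rw [pow_succ]; ring
          rw [e1, e2]
          cases E.coin (c + i)
          · simp only [cond_false, Bool.false_eq_true, if_false, add_zero]
            exact (runs_pair _ _).mono (by omega)
          · simp only [cond_true, if_true]
            apply Runs.bind (N₁ := 1) (N₂ := 1) (runs_plus fθ fw)
            exact runs_pair _ _
        · omega)
    have e0 : ((1 / 2 : ℚ) ^ 0, threshold (fun j => E.coin (c + j)) 0) = ((1 : ℚ), (-1 : ℚ)) := by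
      simp [threshold]
    rw [e0] at key
    apply Runs.bind key
    exact runs_snd _
  · have : (n + 1) * (7 + 12) ≤ M * 19 := Nat.mul_le_mul_right _ hn
    omega

/-- The threshold of round `l`, if the search starts after the use of `c` bits. -/
def roundThreshold (ω : Tape n) (c l : ℕ) : ℚ := threshold (fun j => ω.2 (c + l * n + j)) n

/-- The estimate of the error in round `l`. -/
def roundError (f : Cube n → ℤˣ) (ω : Tape n) (r : ℕ) (g : List (List ℚ × ℚ)) (m e c l : ℕ) : ℚ :=
  errorEst f r g (roundThreshold ω c l) (fun i => ω.1 (e + l * m + i)) m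

/-- The stopping rule `p ≤ √3 / 4` is tested as `16 p² ≤ 3`. Round `l` uses its own block of `m`
examples and `n` bits; `k` is the first round whose estimate passes. -/
theorem runs_findThreshold {D m M r k : ℕ} {g : List (List ℚ × ℚ)} (hp : Bounds n D m M L)
    (hr : r ≤ n) (hg : IsGoodComb n D M g) (hk : k + 2 ≤ M)
    (hlt : ∀ l < k, 3 < 16 * (roundError f ω r g m e c l * roundError f ω r g m e c l))
    (hle : 16 * (roundError f ω r g m e c k * roundError f ω r g m e c k) ≤ 3) :
    Runs (env f ω) L (findThreshold (V := Ty.denote) (m : ℚ) (n : ℚ) (r : ℚ) g) e c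
      (roundThreshold ω c k) (e + (k + 1) * m) (c + (k + 1) * n) (3000 * M ^ 7) ∧
    Fits (5 * M ^ 2) (roundThreshold ω c k) := by
  obtain ⟨h2, h3, h4, h5, h6, h7, -⟩ := hp.chain
  have hn := hp.n_le; have hL := hp.L_eq; have hm := hp.m_le; have hD := hp.D_le
  have h100 := hp.hundred_le
  have h1 : 1 ≤ L := by omega
  have f3 : Fits L 3 := by simpa using fits_nat (L := L) (m := 3) (by omega) h1
  have f16 : Fits L 16 := by simpa using fits_nat (L := L) (m := 16) (by omega) h1
  have fθ : ∀ l, Fits (5 * M ^ 2) (roundThreshold ω c l) := fun l =>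
    fits_threshold _ hn n le_rfl
  have ferr : ∀ l, Fits (2 * M ^ 2) (roundError f ω r g m e c l) := fun l =>
    (runs_estimateError (f := f) (ω := ω) (e := e + l * m) (c := 0) hp hr hg (fθ l)).2
  refine ⟨?_, fθ k⟩
  unfold findThreshold
  -- State `0` is the initial pair with `p = 1`, which never passes the test; state `l + 1` is the
  -- outcome of round `l`. Hence there are `k + 1` rounds before the exit.
  set st : ℕ → ℚ × ℚ := fun l => Nat.casesOn l (1, 1)
    (fun l => (roundError f ω r g m e c l, roundThreshold ω c l)) with hst
  have fst' : ∀ l, Fits (2 * M ^ 2) (st l).1 := by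
    intro l
    cases l with
    | zero => exact fits_one (by omega)
    | succ l => exact ferr l
  have f16' : ∀ l, Fits L (16 * ((st l).1 * (st l).1)) := fun l => by
    have f16' : Fits M (16 : ℚ) := by
      simpa using fits_nat (L := M) (m := 16) (by omega) (by omega)
    exact (f16'.mul ((fst' l).mul (fst' l))).mono (by omega)
  apply Runs.mono
  · apply Runs.bind (runs_lit (fits_one h1))
    apply Runs.bind (runs_lit f3)
    apply Runs.bind (runs_lit f16)
    apply Runs.bind (runs_pair _ _)
    refine Runs.iter_seq_of_eq (N := 2000 * M ^ 6 + 30 * M + 7) (k + 1) st (fun l => e + l * m)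
      (fun l => c + l * n) rfl (by simp) (by simp) ?_ ?_ (runs_ret _)
    · intro l hl
      have hgt : 3 < 16 * ((st l).1 * (st l).1) := by
        cases l with
        | zero => norm_num [hst]
        | succ l => exact hlt l (by omega)
      apply Runs.mono
      · apply Runs.bind (runs_fst _)
        apply Runs.bind (runs_snd _)
        apply Runs.bind (runs_times ((fst' l).mono (by omega)) ((fst' l).mono (by omega)))
        apply Runs.bind (runs_times f16 (((fst' l).mul (fst' l)).mono (by omega)))
        refine runs_ifLe (N := 2000 * M ^ 6 + 30 * M + 1) (f16' l) f3
          (fun h => absurd h (not_le.2 hgt)) ?_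
        intro _
        apply Runs.mono
        · apply Runs.bind (runs_randomThreshold (M := M) hn (by omega))
          have hθ : threshold (fun j => (env f ω).coin (c + l * n + j)) n = roundThreshold ω c l := rfl
          rw [hθ]
          apply Runs.bind (runs_estimateError hp hr hg (fθ l)).1
          have he : errorEst f r g (roundThreshold ω c l) (fun i => ω.1 (e + l * m + i)) m =
            roundError f ω r g m e c l := rfl
          rw [he]
          apply Runs.bind (runs_pair _ _)
          have e1 : e + (l + 1) * m = e + l * m + m := by ring
          have e2 : c + (l + 1) * n = c + l * n + n := by ring
          rw [e1, e2]
          exact runs_pure _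
        · omega
      · omega
    · apply Runs.mono
      · apply Runs.bind (runs_fst _)
        apply Runs.bind (runs_snd _)
        apply Runs.bind (runs_times ((fst' (k + 1)).mono (by omega))
          ((fst' (k + 1)).mono (by omega)))
        apply Runs.bind (runs_times f16 (((fst' (k + 1)).mul (fst' (k + 1))).mono (by omega)))
        refine runs_ifLe (N := 0) (f16' (k + 1)) f3 (fun _ => runs_pure _) ?_
        intro h
        exact absurd hle (not_le.2 h)
      · omega
  · have : (k + 2) * (2000 * M ^ 6 + 30 * M + 8) ≤ M * (2000 * M ^ 6 + 30 * M + 8) :=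
      Nat.mul_le_mul_right _ hk
    have : M * (2000 * M ^ 6 + 30 * M + 8) = 2000 * M ^ 7 + 30 * M ^ 2 + 8 * M := by ring
    ring_nf at *; omega

/-! ### The estimated expansion on one slice -/

/-- The estimate of the inner product with the `i`-th top set. -/
def innerAt (f : Cube n → ℤˣ) (ω : Tape n) (D m r e i : ℕ) : ℚ :=
  innerEst f r ((topSeqs n (D + 1)).getD i []) (fun t => ω.1 (e + i * m + t)) m

/-- The estimate of the coefficient of the `i`-th top set. -/
def coefAt (f : Cube n → ℤˣ) (ω : Tape n) (D m r e i : ℕ) : ℚ :=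
  innerAt f ω D m r e i / normList n r ((topSeqs n (D + 1)).getD i [])

/-- The estimated combination of basis functions on the slice of weight `r`. -/
def combAt (f : Cube n → ℤˣ) (ω : Tape n) (D m r e : ℕ) : List (List ℚ × ℚ) :=
  ((List.range (topSeqs n (D + 1)).length).map fun i =>
    ((topSeqs n (D + 1)).getD i [], coefAt f ω D m r e i)).reverse

/-- The estimated weight up to level `D` on the slice of weight `r`. -/
def weightAt (f : Cube n → ℤˣ) (ω : Tape n) (D m r e : ℕ) : ℚ :=
  ∑ i ∈ Finset.range (topSeqs n (D + 1)).length, innerAt f ω D m r e i * coefAt f ω D m r e i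

theorem isShort_of_mem {D : ℕ} {B : List ℚ} (h : B ∈ topSeqs n (D + 1)) : IsShort n D B := by
  obtain ⟨h1, -, h3, -⟩ := mem_topSeqs.1 h
  exact ⟨h3, by omega⟩

theorem getD_mem_topSeqs {D i : ℕ} (hi : i < (topSeqs n (D + 1)).length) :
    (topSeqs n (D + 1)).getD i [] ∈ topSeqs n (D + 1) := by
  rw [List.getD_eq_getElem _ _ hi]; exact List.getElem_mem hi

theorem length_topSeqs_lt {D m M : ℕ} (hp : Bounds n D m M L) :
    (topSeqs n (D + 1)).length + 1 ≤ M := by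
  have := length_topSeqs_le (D := D) hp.one_le (D + 1) le_rfl
  have := hp.card_le
  omega

theorem fits_innerAt {D m M r : ℕ} (hp : Bounds n D m M L) (hr : r ≤ n) {i : ℕ}
    (hi : i < (topSeqs n (D + 1)).length) : Fits (2 * M ^ 2) (innerAt f ω D m r e i) :=
  (runs_estimateInner (f := f) (ω := ω) (e := e + i * m) (c := 0) hp hr
    (isShort_of_mem (getD_mem_topSeqs hi))).2

theorem fits_normList {D m M r : ℕ} (hp : Bounds n D m M L) (hr : r ≤ n) {i : ℕ}
    (hi : i < (topSeqs n (D + 1)).length) :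
    Fits (40 * M ^ 2) (normList n r ((topSeqs n (D + 1)).getD i [])) := by
  have hs := isShort_of_mem (getD_mem_topSeqs hi)
  have := hp.D_le; have := hs.2
  exact (runs_normSquare (E := ⟨fun _ => ([], 0), fun _ => true⟩) (L := 40 * M ^ 2) (e := 0) (c := 0)
    hr hs.1 hp.n_le (by omega) le_rfl).2

theorem fits_coefAt {D m M r : ℕ} (hp : Bounds n D m M L) (hr : r ≤ n) {i : ℕ}
    (hi : i < (topSeqs n (D + 1)).length) : Fits (50 * M ^ 2) (coefAt f ω D m r e i) := by
  have := hp.chain.1; have := hp.hundred_le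
  exact ((fits_innerAt hp hr hi).div (fits_normList hp hr hi)).mono (by omega)

theorem isGoodComb_combAt {D m M r : ℕ} (hp : Bounds n D m M L) (hr : r ≤ n) :
    IsGoodComb n D M (combAt f ω D m r e) := by
  constructor
  · simpa [combAt] using length_topSeqs_lt hp
  · intro p hpm
    simp only [combAt, List.mem_reverse, List.mem_map, List.mem_range] at hpm
    obtain ⟨i, hi, rfl⟩ := hpm
    exact ⟨isShort_of_mem (getD_mem_topSeqs hi), fits_coefAt hp hr hi⟩

theorem runs_weight {D m M r : ℕ} (hp : Bounds n D m M L) (hr : r ≤ n) :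
    Runs (env f ω) L (fold (V := Ty.denote) (σ := .list .num)
      (ρ := .prod .num (.list (.prod (.list .num) .num))) (topSeqs n (D + 1)) ((0 : ℚ), [])
      fun s B => do
        let S ← fst s
        let g ← snd s
        let q ← normSquare (n : ℚ) (r : ℚ) B
        let e ← estimateInner (m : ℚ) (n : ℚ) (r : ℚ) B
        let c ← divide e q
        let w ← times e c
        let S' ← plus S w
        let p ← pair B c
        let g' ← cons p g
        pair S' g') e c (weightAt f ω D m r e, combAt f ω D m r e)
      (e + (topSeqs n (D + 1)).length * m) c (3000 * M ^ 6) ∧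
    Fits (100 * M ^ 3) (weightAt f ω D m r e) := by
  obtain ⟨h2, h3, h4, h5, h6, h7, -⟩ := hp.chain
  have hn := hp.n_le; have hL := hp.L_eq; have hm := hp.m_le; have hD := hp.D_le
  have h100 := hp.hundred_le
  have h1 : 1 ≤ L := by omega
  have hT := length_topSeqs_lt hp
  set T := (topSeqs n (D + 1)).length with hTdef
  set S : ℕ → ℚ := fun i => ∑ j ∈ Finset.range i, innerAt f ω D m r e j * coefAt f ω D m r e j with hS
  set G : ℕ → List (List ℚ × ℚ) := fun i => ((List.range i).map fun i =>
    ((topSeqs n (D + 1)).getD i [], coefAt f ω D m r e i)).reverse with hG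
  have fterm : ∀ i < T, Fits (60 * M ^ 2) (innerAt f ω D m r e i * coefAt f ω D m r e i) :=
    fun i hi => ((fits_innerAt hp hr hi).mul (fits_coefAt hp hr hi)).mono (by omega)
  have hSsucc : ∀ i, S (i + 1) = S i + innerAt f ω D m r e i * coefAt f ω D m r e i := fun i => by
    simp only [hS]; rw [Finset.sum_range_succ]
  have fS' : ∀ i ≤ T, Fits (i * (60 * M ^ 2 + 1) + 1) (S i) := by
    intro i
    induction i with
    | zero => intro _; simpa [hS] using fits_zero (L := 1) le_rfl
    | succ i ih =>
      intro hi
      rw [hSsucc]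
      exact ((ih (by omega)).add (fterm i (by omega))).mono (by ring_nf; omega)
  have fS : ∀ i ≤ T, Fits (100 * M ^ 3) (S i) := by
    intro i hi
    refine (fS' i hi).mono ?_
    have : i * (60 * M ^ 2 + 1) ≤ M * (60 * M ^ 2 + 1) := Nat.mul_le_mul_right _ (by omega)
    have : M * (60 * M ^ 2 + 1) = 60 * M ^ 3 + M := by ring
    omega
  refine ⟨?_, fS T le_rfl⟩
  apply Runs.mono
  · have key := runs_fold_seq (E := env f ω) (L := L) (N := 2000 * M ^ 5 + 40 * M + 8)
      (σ := .list .num) (ρ := .prod .num (.list (.prod (.list .num) .num)))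
      (body := fun s B => do
        let S ← fst s
        let g ← snd s
        let q ← normSquare (n : ℚ) (r : ℚ) B
        let e ← estimateInner (m : ℚ) (n : ℚ) (r : ℚ) B
        let c ← divide e q
        let w ← times e c
        let S' ← plus S w
        let p ← pair B c
        let g' ← cons p g
        pair S' g') (topSeqs n (D + 1)) (fun i => (S i, G i)) (fun i => e + i * m) (fun _ => c) (by
        intro i hi
        have hgetD : (topSeqs n (D + 1))[i] = (topSeqs n (D + 1)).getD i [] :=
          (List.getD_eq_getElem _ _ hi).symm
        rw [hgetD]
        have hs := isShort_of_mem (getD_mem_topSeqs hi)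
        apply Runs.mono
        · apply Runs.bind (runs_fst _)
          apply Runs.bind (runs_snd _)
          apply Runs.bind (runs_normSquare (M := M) hr hs.1 hn (by have := hs.2; omega)
            (by omega)).1
          apply Runs.bind (runs_estimateInner hp hr hs).1
          have he : innerEst f r ((topSeqs n (D + 1)).getD i []) (fun t => ω.1 (e + i * m + t)) m =
            innerAt f ω D m r e i := rfl
          rw [he]
          apply Runs.bind (runs_divide ((fits_innerAt hp hr hi).mono (by omega))
            ((fits_normList hp hr hi).mono (by omega)))
          have hc : innerAt f ω D m r e i / normList n r ((topSeqs n (D + 1)).getD i []) =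
            coefAt f ω D m r e i := rfl
          rw [hc]
          apply Runs.bind (runs_times ((fits_innerAt hp hr hi).mono (by omega))
            ((fits_coefAt hp hr hi).mono (by omega)))
          apply Runs.bind (runs_plus ((fS i hi.le).mono (by omega)) ((fterm i hi).mono (by omega)))
          apply Runs.bind (runs_pair _ _)
          apply Runs.bind (runs_cons _ _)
          have e1 : e + (i + 1) * m = e + i * m + m := by ring
          have e2 : G (i + 1) = ((topSeqs n (D + 1)).getD i [], coefAt f ω D m r e i) :: G i := by
            simp only [hG]; rw [List.range_succ, List.map_append, List.reverse_append]; rfl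
          rw [e1, hSsucc, e2]
          exact runs_pair _ _
        · omega)
    have e0 : (S 0, G 0) = ((0 : ℚ), ([] : List (List ℚ × ℚ))) := by simp [hS, hG]
    rw [e0, zero_mul, add_zero, ← hTdef] at key
    exact key
  · have : (T + 1) * (2000 * M ^ 5 + 40 * M + 8 + 10) ≤ M * (2000 * M ^ 5 + 40 * M + 8 + 10) :=
      Nat.mul_le_mul_right _ hT
    have : M * (2000 * M ^ 5 + 40 * M + 8 + 10) = 2000 * M ^ 6 + 40 * M ^ 2 + 18 * M := by ring
    omega

/-! ### The loop over the slices -/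

/-- Whether the slice of weight `r` is inspected for the parameter `τ`. -/
def IsInspected (n τ r : ℕ) : Prop := 2 * r ≤ n + τ ∧ n ≤ 2 * r + τ

instance (n τ r : ℕ) : Decidable (IsInspected n τ r) := by unfold IsInspected; infer_instance

/-- The number of slices inspected before that of weight `r`. -/
def inspectedBefore (n τ r : ℕ) : ℕ := ((Finset.range r).filter (IsInspected n τ)).card

theorem inspectedBefore_succ (n τ r : ℕ) : inspectedBefore n τ (r + 1) =
    inspectedBefore n τ r + if IsInspected n τ r then 1 else 0 := by
  unfold inspectedBefore
  rw [Finset.range_add_one, Finset.filter_insert]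
  split_ifs
  · rw [Finset.card_insert_of_notMem (by simp)]
  · rfl

/-- The number of examples used before the slice of weight `r`. -/
def startAt (n τ D m r : ℕ) : ℕ := inspectedBefore n τ r * ((topSeqs n (D + 1)).length * m)

/-- A deterministic description of the run: `r` is the first inspected slice whose estimated weight
reaches `3 / 8`, and `k` the first successful round there. Slices outside the range use no examples,
which makes `startAt` the number of examples consumed so far. No bits are used before the search, so
the thresholds start at bit `0`. -/
theorem runs_learner {C τ D m M r k : ℕ} (hp : Bounds n D m M L) (hm : m = n ^ (3 * C * D))
    (hCD : 3 * C * D + 1 ≤ M) (hD1 : 1 ≤ D) (hτ : τ ≤ M) (hr : r ≤ n) (hins : IsInspected n τ r)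
    (hS : 3 / 8 ≤ weightAt f ω D m r (startAt n τ D m r))
    (hlt : ∀ r' < r, IsInspected n τ r' → weightAt f ω D m r' (startAt n τ D m r') < 3 / 8)
    (hk : k + 2 ≤ M) {e₀ : ℕ} (he₀ : e₀ = startAt n τ D m r + (topSeqs n (D + 1)).length * m)
    {g : List (List ℚ × ℚ)} (hg : g = combAt f ω D m r (startAt n τ D m r))
    (hklt : ∀ l < k, 3 < 16 * (roundError f ω r g m e₀ 0 l * roundError f ω r g m e₀ 0 l))
    (hkle : 16 * (roundError f ω r g m e₀ 0 k * roundError f ω r g m e₀ 0 k) ≤ 3) :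
    ∃ e₁ c₁, Runs (env f ω) L (learner (V := Ty.denote) (C : ℚ) (n : ℚ) (τ : ℚ) (D : ℚ)) 0 0
      (some ⟨(r : ℚ), g, roundThreshold ω 0 k,
        if 0 ≤ offEst f r (fun i => ω.1 (e₀ + (k + 1) * m + i)) m then (1 : ℚ) else -1⟩)
      e₁ c₁ (20000 * M ^ 8) := by
  obtain ⟨h2, h3, h4, h5, h6, h7, h8⟩ := hp.chain
  have hn := hp.n_le; have hL := hp.L_eq; have hm' := hp.m_le; have hD := hp.D_le
  have h100 := hp.hundred_le
  have h1 : 1 ≤ L := by omega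
  have hCM : 3 * C ≤ M := by
    have : 3 * C * 1 ≤ 3 * C * D := Nat.mul_le_mul_left _ hD1
    omega
  have f3 : Fits L 3 := by simpa using fits_nat (L := L) (m := 3) (by omega) h1
  have f38 : Fits L (3 / 8) := by
    have := fits_div_int (L := L) (a := 3) (b := 8) (by norm_num)
      (lt_of_lt_of_le (b := 2 ^ 100) (by norm_num) (Nat.pow_le_pow_right (by norm_num) (by omega)))
      (lt_of_lt_of_le (b := 2 ^ 100) (by norm_num) (Nat.pow_le_pow_right (by norm_num) (by omega)))
    simpa using this
  set T := (topSeqs n (D + 1)).length with hT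
  refine ⟨e₀ + (k + 1) * m + m, 0 + (k + 1) * n, ?_⟩
  unfold learner
  apply Runs.mono
  · apply Runs.bind (runs_lit (fits_zero h1))
    apply Runs.bind (runs_lit (fits_one h1))
    apply Runs.bind (runs_lit f3)
    apply Runs.bind (runs_lit f38)
    have t1 := runs_times (E := env f ω) (e := 0) (c := 0) f3 (fits_nat (L := L) (m := C) (by omega) h1)
    have e1 : (3 : ℚ) * C = ((3 * C : ℕ) : ℚ) := by push_cast; rfl
    rw [e1] at t1
    apply Runs.bind t1
    have t2 := runs_times (E := env f ω) (e := 0) (c := 0)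
      (fits_nat (L := L) (m := 3 * C) (by omega) h1) (fits_nat (L := L) (m := D) (by omega) h1)
    have e2 : ((3 * C : ℕ) : ℚ) * D = ((3 * C * D : ℕ) : ℚ) := by push_cast; rfl
    rw [e2] at t2
    apply Runs.bind t2
    apply Runs.bind (runs_power (M := M) hp.one_le hCD (by rw [← hm]; omega) (by omega) (by omega))
    rw [← hm]
    apply Runs.bind (runs_allTopSets (M := M) hp.one_le hn hD hp.pow_le (by omega))
    refine Runs.iter_seq_of_eq (N := 10000 * M ^ 7) r (fun r => (r : ℚ))
      (fun r => startAt n τ D m r) (fun _ => 0) (by simp) (by simp [startAt, inspectedBefore]) rfl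
      ?_ ?_ (runs_ret _)
    all_goals
      have fq : ∀ r' ≤ n, Fits L (r' : ℚ) ∧ Fits L ((r' : ℚ) + r') ∧ Fits L ((r' : ℚ) + r' - n) ∧
          Fits L ((n : ℚ) - (r' + r')) := by
        intro r' hr'
        refine ⟨fits_nat (by omega) h1, ?_, ?_, ?_⟩
        · simpa using fits_nat (L := L) (m := r' + r') (by omega) h1
        · simpa using fits_natCast_sub (L := L) (a := r' + r') (b := n) (by omega) (by omega) h1
        · simpa using fits_natCast_sub (L := L) (a := n) (b := r' + r') (by omega) (by omega) h1
      have hu : ∀ r' : ℕ, ((τ : ℚ) < (r' : ℚ) + r' - n ↔ n + τ < 2 * r') ∧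
          ((τ : ℚ) < (n : ℚ) - (r' + r') ↔ 2 * r' + τ < n) := by
        intro r'
        constructor
        · rw [lt_sub_iff_add_lt, two_mul, add_comm n τ]; exact_mod_cast Iff.rfl
        · rw [lt_sub_iff_add_lt, two_mul, add_comm (r' + r') τ]; exact_mod_cast Iff.rfl
    · intro r' hr'
      obtain ⟨q1, q2, q3, q4⟩ := fq r' (by omega)
      have hnext : (((r' + 1 : ℕ) : ℚ)) = (r' : ℚ) + 1 := by push_cast; rfl
      apply Runs.mono
      · apply Runs.bind (runs_plus q1 (fits_one h1))
        refine runs_ifLt (N := 5000 * M ^ 6) (fits_nat (by omega) h1) q1 ?_ ?_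
        · intro h
          have : n < r' := by exact_mod_cast h
          omega
        · intro _
          apply Runs.mono
          · apply Runs.bind (runs_plus q1 q1)
            apply Runs.bind (runs_minus q2 (fits_nat (by omega) h1))
            apply Runs.bind (runs_minus (fits_nat (by omega) h1) q2)
            rw [hnext]
            refine runs_ifLt (N := 4000 * M ^ 6 + 2) (fits_nat (by omega) h1) q3 ?_ ?_
            · intro h
              have h' := (hu r').1.1 h
              have hni : ¬ IsInspected n τ r' := fun hi => by have := hi.1; omega
              rw [startAt, startAt, inspectedBefore_succ, if_neg hni, add_zero]
              exact (runs_pure _).mono (by omega)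
            · intro hA
              refine runs_ifLt (N := 4000 * M ^ 6) (fits_nat (by omega) h1) q4 ?_ ?_
              · intro h
                have h' := (hu r').2.1 h
                have hni : ¬ IsInspected n τ r' := fun hi => by have := hi.2; omega
                rw [startAt, startAt, inspectedBefore_succ, if_neg hni, add_zero]
                exact (runs_pure _).mono (by omega)
              · intro hB
                have hi : IsInspected n τ r' :=
                  ⟨not_lt.1 fun h => not_lt.2 hA ((hu r').1.2 h),
                    not_lt.1 fun h => not_lt.2 hB ((hu r').2.2 h)⟩
                obtain ⟨w1, w2⟩ := runs_weight (f := f) (ω := ω) (e := startAt n τ D m r') (c := 0)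
                  hp (show r' ≤ n by omega)
                apply Runs.mono
                · apply Runs.bind runs_nil
                  apply Runs.bind (runs_pair _ _)
                  apply Runs.bind w1
                  apply Runs.bind (runs_fst _)
                  apply Runs.bind (runs_snd _)
                  have hst : startAt n τ D m (r' + 1) = startAt n τ D m r' + T * m := by
                    rw [startAt, startAt, inspectedBefore_succ, if_pos hi]; ring
                  rw [hst]
                  refine runs_ifLe (N := 0) f38 (w2.mono (by omega)) ?_ (fun _ => runs_pure _)
                  intro h
                  exact absurd h (not_le.2 (hlt r' hr' hi))
                · omega
          · omega
      · omega
    · obtain ⟨q1, q2, q3, q4⟩ := fq r hr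
      apply Runs.mono
      · apply Runs.bind (runs_plus q1 (fits_one h1))
        refine runs_ifLt (N := 9000 * M ^ 7) (fits_nat (by omega) h1) q1 ?_ ?_
        · intro h
          have : n < r := by exact_mod_cast h
          omega
        · intro _
          apply Runs.mono
          · apply Runs.bind (runs_plus q1 q1)
            apply Runs.bind (runs_minus q2 (fits_nat (by omega) h1))
            apply Runs.bind (runs_minus (fits_nat (by omega) h1) q2)
            refine runs_ifLt (N := 8000 * M ^ 7 + 2) (fits_nat (by omega) h1) q3 ?_ ?_
            · intro h
              have h' := (hu r).1.1 h
              have := hins.1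
              omega
            · intro _
              refine runs_ifLt (N := 8000 * M ^ 7) (fits_nat (by omega) h1) q4 ?_ ?_
              · intro h
                have h' := (hu r).2.1 h
                have := hins.2
                omega
              · intro _
                obtain ⟨w1, w2⟩ := runs_weight (f := f) (ω := ω) (e := startAt n τ D m r) (c := 0)
                  hp hr
                apply Runs.mono
                · apply Runs.bind runs_nil
                  apply Runs.bind (runs_pair _ _)
                  apply Runs.bind w1
                  apply Runs.bind (runs_fst _)
                  apply Runs.bind (runs_snd _)
                  refine runs_ifLe (N := 4000 * M ^ 7) f38 (w2.mono (by omega)) ?_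
                    (fun h => absurd hS (not_le.2 h))
                  intro _
                  rw [← he₀, ← hg]
                  obtain ⟨o1, o2⟩ := runs_estimateOff (f := f) (ω := ω) (e := e₀ + (k + 1) * m)
                    (c := 0 + (k + 1) * n) hp hr
                  apply Runs.mono
                  · apply Runs.bind (runs_findThreshold hp hr
                      (hg ▸ isGoodComb_combAt hp hr) hk hklt hkle).1
                    apply Runs.bind o1
                    apply Runs.bind (runs_signum (o2.mono (by omega)) h1)
                    exact runs_pure _
                  · omega
                · omega
          · omega
      · omega
  · have : (r + 1) * (10000 * M ^ 7 + 1) ≤ M * (10000 * M ^ 7 + 1) :=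
      Nat.mul_le_mul_right _ (by omega)
    have : M * (10000 * M ^ 7 + 1) = 10000 * M ^ 8 + M := by ring
    omega

end Learner

end SliceLearner


namespace SliceLearner

/-! ## The lists of the algorithm and the functions they stand for -/

section Correspondence

variable {n k : ℕ}

theorem length_encode (B : Fin k → Fin n) : (encode B).length = k := by simp [encode]

theorem encode_mem_coordList (B : Fin k → Fin n) : ∀ b ∈ encode B, b ∈ coordList n := by
  intro b hb
  obtain ⟨i, rfl⟩ := List.mem_ofFn.1 hb
  exact mem_coordList.2 ⟨B i, (B i).2, rfl⟩

theorem encode_injective : Function.Injective (encode : (Fin k → Fin n) → List ℚ) := by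
  intro B B' h
  have := List.ofFn_injective h
  funext i
  have h' := congrFun this i
  simp only [add_left_inj, Nat.cast_inj] at h'
  exact Fin.ext h'

theorem exists_encode_eq {s : List ℚ} (hs : ∀ j ∈ s, j ∈ coordList n) (hk : s.length = k) :
    ∃ A : Fin k → Fin n, s = encode A := by
  subst hk
  have h : ∀ i : Fin s.length, ∃ j : Fin n, s[i] = ((j : ℕ) : ℚ) + 1 := by
    intro i
    obtain ⟨j, hj, h⟩ := mem_coordList.1 (hs _ (List.getElem_mem i.2))
    exact ⟨⟨j, hj⟩, h⟩
  choose A hA using h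
  refine ⟨A, ?_⟩
  refine List.ext_getElem (by rw [length_encode]) fun i h1 h2 => ?_
  simp only [encode, List.getElem_ofFn]
  exact hA ⟨i, h1⟩

theorem zip_ofFn {α β : Type*} (a : Fin k → α) (b : Fin k → β) :
    (List.ofFn a).zip (List.ofFn b) = List.ofFn fun i => (a i, b i) :=
  List.ext_getElem (by simp) fun i h1 h2 => by simp

theorem nodup_encode_iff {A : Fin k → Fin n} : (encode A).Nodup ↔ Function.Injective A := by
  rw [encode, List.nodup_ofFn]
  constructor
  · intro h i j hij
    exact h (by simp [hij])
  · intro h i j hij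
    simp only [add_left_inj, Nat.cast_inj] at hij
    exact h (Fin.ext hij)

theorem belowList_encode_iff {A B : Fin k → Fin n} :
    (encode A).Nodup ∧ belowList (encode A) (encode B) = true ↔ IsBelow A B := by
  rw [nodup_encode_iff, belowList_iff, encode, encode, zip_ofFn, List.forall_mem_ofFn_iff]
  simp only [List.mem_ofFn, not_exists, add_lt_add_iff_right, Nat.cast_lt, Fin.val_fin_lt,
    add_left_inj, Nat.cast_inj]
  unfold IsBelow
  constructor
  · rintro ⟨h1, h2⟩
    exact ⟨h1, fun i j h => (h2 i).1 j (by rw [h]), fun i => (h2 i).2⟩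
  · rintro ⟨h1, h2, h3⟩
    exact ⟨h1, fun i => ⟨fun j h => h2 i j (Fin.ext h.symm), h3 i⟩⟩

theorem mem_allBelowList_encode {s : List ℚ} {B : Fin k → Fin n} :
    s ∈ allBelowList n (encode B) ↔ ∃ A : Fin k → Fin n, IsBelow A B ∧ s = encode A := by
  rw [mem_allBelowList, length_encode]
  constructor
  · rintro ⟨⟨h1, h2, h3⟩, h4⟩
    obtain ⟨A, rfl⟩ := exists_encode_eq h3 h1
    exact ⟨A, belowList_encode_iff.1 ⟨h2, h4⟩, rfl⟩
  · rintro ⟨A, hA, rfl⟩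
    have := belowList_encode_iff.2 hA
    exact ⟨⟨length_encode A, this.1, encode_mem_coordList A⟩, this.2⟩

theorem entry_pointList (x : Cube n) (i : Fin n) :
    ((entry (pointList x) (((i : ℕ) : ℚ) + 1) : ℚ) : ℝ) = bit x i := by
  rw [entry_succ, List.headD_eq_head?_getD, List.head?_drop, pointList, List.getElem?_ofFn]
  simp only [bit, Fin.is_lt, dif_pos, Fin.eta, Option.getD_some]
  split_ifs <;> simp

theorem chiPairList_encode (x : Cube n) (A B : Fin k → Fin n) :
    ((chiPairList (pointList x) (encode A) (encode B) : ℚ) : ℝ) = chiPair A B x := by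
  rw [chiPairList_eq, encode, encode, zip_ofFn, List.map_ofFn, List.prod_ofFn, chiPair]
  push_cast
  refine Finset.prod_congr rfl fun i _ => ?_
  simp only [Function.comp]
  push_cast
  rw [entry_pointList, entry_pointList]

theorem chiList_encode (x : Cube n) (B : Fin k → Fin n) :
    ((chiList n (encode B) (pointList x) : ℚ) : ℝ) = chi B x := by
  classical
  rw [chiList, ← List.sum_toFinset _ (nodup_allBelowList _ _), chi]
  push_cast
  symm
  refine Finset.sum_nbij encode ?_ (fun _ _ _ _ h => encode_injective h) ?_ ?_
  · intro A hA
    rw [List.mem_toFinset, mem_allBelowList_encode]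
    exact ⟨A, (Finset.mem_filter.1 hA).2, rfl⟩
  · intro s hs
    rw [Finset.mem_coe, List.mem_toFinset, mem_allBelowList_encode] at hs
    obtain ⟨A, hA, rfl⟩ := hs
    exact ⟨A, by simpa using hA, rfl⟩
  · intro A _
    rw [chiPairList_encode]

theorem basisList_encode (r : ℕ) (x : Cube n) (B : Fin k → Fin n) :
    ((basisList n r (encode B) (pointList x) : ℚ) : ℝ) = basis r B x := by
  unfold basisList basis
  split_ifs
  · exact chiList_encode x B
  · rw [← chiList_encode]
    congr 2
    simp only [pointList, List.map_ofFn]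
    congr 1
    funext j
    by_cases h : x j = true <;> simp [h]

theorem isTopSeq_encode {B : Fin k → Fin n} : isTopSeq n (encode B) = true ↔ IsTopSet B := by
  unfold isTopSeq IsTopSet
  rw [Bool.and_eq_true, increasingList_iff]
  have h1 : List.IsChain (· < ·) (0 :: encode B) ↔ StrictMono B := by
    rw [List.isChain_iff_pairwise, List.pairwise_cons, encode, List.pairwise_ofFn]
    constructor
    · rintro ⟨-, h⟩ i j hij
      have := h hij
      simpa using this
    · intro h
      refine ⟨?_, fun i j hij => by simpa using h hij⟩
      intro b hb
      obtain ⟨i, rfl⟩ := List.mem_ofFn.1 hb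
      positivity
  have h2 : (!(allBelowList n (encode B)).isEmpty) = true ↔ ∃ A, IsBelow A B := by
    rw [Bool.not_eq_true', List.isEmpty_eq_false_iff_exists_mem]
    constructor
    · rintro ⟨s, hs⟩
      obtain ⟨A, hA, -⟩ := mem_allBelowList_encode.1 hs
      exact ⟨A, hA⟩
    · rintro ⟨A, hA⟩
      exact ⟨_, mem_allBelowList_encode.2 ⟨A, hA, rfl⟩⟩
  rw [h1, h2]

/-- The list of numbers by which the algorithm represents a decreasing list of coordinates. -/
def encodeDesc (L : List ℕ) : List ℚ := L.reverse.map fun b : ℕ => (b : ℚ) + 1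

theorem encode_eq (B : Fin k → Fin n) : encode B = encodeDesc (toDesc B) := by
  rw [encodeDesc, toDesc, List.reverse_reverse, List.map_ofFn]; rfl

theorem encodeDesc_injective : Function.Injective encodeDesc := by
  intro L L' h
  have : Function.Injective fun b : ℕ => (b : ℚ) + 1 := fun a b h => by simpa using h
  exact List.reverse_injective (List.map_injective_iff.2 this h)

theorem length_encodeDesc (L : List ℕ) : (encodeDesc L).length = L.length := by simp [encodeDesc]

/-- Links the enumeration of the program, by increasing lists of numbers from `1`, with the
recursive family of decreasing lists from `0`. -/
theorem mem_topSeqs_iff {D : ℕ} {s : List ℚ} :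
    s ∈ topSeqs n (D + 1) ↔ ∃ L ∈ (topLists n).filter (fun L => L.length ≤ D), s = encodeDesc L := by
  rw [mem_topSeqs]
  constructor
  · rintro ⟨h1, h2, h3, h4⟩
    obtain ⟨k, hk⟩ : ∃ k, s.length = k := ⟨_, rfl⟩
    obtain ⟨B, rfl⟩ := exists_encode_eq h3 hk
    rw [length_encode] at h1
    refine ⟨toDesc B, ?_, encode_eq B⟩
    rw [Finset.mem_filter, toDesc_mem_topLists, length_toDesc]
    exact ⟨isTopSeq_encode.1 h4, by omega⟩
  · rintro ⟨L, hL, rfl⟩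
    rw [Finset.mem_filter] at hL
    obtain ⟨B, hB⟩ := exists_toDesc_eq (lt_of_mem_topLists hL.1)
    have hB' : IsTopSet B := by rw [← toDesc_mem_topLists, hB]; exact hL.1
    rw [← hB, ← encode_eq]
    refine ⟨by rw [length_encode]; omega, nodup_encode_iff.2 hB'.1.injective,
      encode_mem_coordList B, isTopSeq_encode.2 hB'⟩

theorem basisList_encodeDesc {L : List ℕ} (hL : L ∈ topLists n) (r : ℕ) (x : Cube n) :
    ((basisList n r (encodeDesc L) (pointList x) : ℚ) : ℝ) = listBasis r L x := by
  obtain ⟨B, hB⟩ := exists_toDesc_eq (lt_of_mem_topLists hL)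
  have hB' : IsTopSet B := by rw [← toDesc_mem_topLists, hB]; exact hL
  have h := basisList_encode r x B
  rw [encode_eq, basis_eq hB'.1, hB] at h
  exact h

/-! ### Norms -/

theorem foldl_normFactor_fst (n r : ℕ) (B : List ℚ) (s : ℚ × ℚ) :
    (B.foldl (fun s b => (s.1 + 1, s.2 * normFactor n r s.1 b)) s).1 = s.1 + B.length := by
  induction B generalizing s with
  | nil => simp
  | cons b B ih => rw [List.foldl_cons, ih]; push_cast [List.length_cons]; ring

theorem normList_append (n r : ℕ) (B : List ℚ) (b : ℚ) :
    normList n r (B ++ [b]) = normList n r B * normFactor n r B.length b := by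
  unfold normList
  rw [List.foldl_append, List.foldl_cons, List.foldl_nil, foldl_normFactor_fst, zero_add]

theorem intChoose_two (N : ℕ) (s : ℤ) : ((N : ℝ) + 2) * ((N : ℝ) + 1) * intChoose N (s - 1) =
    s * ((N : ℝ) + 2 - s) * intChoose (N + 2) s := by
  have h1 := succ_mul_intChoose N s
  have h2 := mul_intChoose (N + 1) s
  have h3 := intChoose_succ (N + 1) s
  rw [show N + 2 = N + 1 + 1 from rfl, h3]
  push_cast at h2
  linear_combination ((N : ℝ) + 2) * h1 + (s : ℝ) * h2

/-- The ratio of consecutive norms, obtained from `C(N, s-1) / C(N+2, s)`. It is exactly the factor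
that the program multiplies in, since its entries are larger by `1` than those of `L`. -/
theorem basisNorm_cons {r b : ℕ} {L : List ℕ} (h : b :: L ∈ topLists n) :
    basisNorm n r (b :: L) = basisNorm n r L *
      (((b : ℝ) + 1 - 2 * L.length) * ((b : ℝ) - 2 * L.length) *
        (((r : ℝ) - L.length) * ((n : ℝ) - r - L.length)) /
        (((n : ℝ) - 2 * L.length) * ((n : ℝ) - 2 * L.length - 1))) := by
  have hlen := length_of_mem_topLists h
  rw [List.length_cons] at hlen
  obtain ⟨N, hN⟩ : ∃ N, n = N + 2 + 2 * L.length := ⟨n - 2 - 2 * L.length, by omega⟩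
  have hnr : (n : ℝ) = N + 2 + 2 * L.length := by exact_mod_cast hN
  unfold basisNorm
  rw [List.length_cons, show n - 2 * (L.length + 1) = N by omega, show n - 2 * L.length = N + 2 by omega,
    show (r : ℤ) - ((L.length + 1 : ℕ) : ℤ) = (r : ℤ) - L.length - 1 by push_cast; ring, normConst]
  have key := intChoose_two N ((r : ℤ) - L.length)
  push_cast at key
  have e1 : (n : ℝ) - 2 * L.length = N + 2 := by rw [hnr]; ring
  have e2 : (n : ℝ) - r - L.length = (N : ℝ) + 2 - (r - L.length) := by rw [hnr]; ring
  rw [e1, e2]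
  have h1 : (N : ℝ) + 2 ≠ 0 := by positivity
  have h2 : (N : ℝ) + 2 - 1 ≠ 0 := by
    have : (N : ℝ) + 2 - 1 = N + 1 := by ring
    rw [this]; positivity
  have h3 : intChoose N ((r : ℤ) - L.length - 1) =
      ((r : ℝ) - L.length) * ((N : ℝ) + 2 - (r - L.length)) *
        intChoose (N + 2) ((r : ℤ) - L.length) / (((N : ℝ) + 2) * ((N : ℝ) + 2 - 1)) := by
    rw [eq_div_iff (mul_ne_zero h1 h2), ← key]; ring
  rw [h3]; ring

theorem basisNorm_nil {r : ℕ} (hr : r ≤ n) : basisNorm n r [] = 1 := by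
  unfold basisNorm
  have : (n.choose r : ℝ) ≠ 0 := by exact_mod_cast (Nat.choose_pos hr).ne'
  simp [normConst, intChoose_nat, this]

theorem tail_mem_topLists {b : ℕ} {L : List ℕ} (h : b :: L ∈ topLists n) : L ∈ topLists n := by
  rw [mem_topLists_iff] at h ⊢
  exact ⟨h.1.1, fun a ha => h.2 a (by simp [ha])⟩

theorem normList_encodeDesc {r : ℕ} (hr : r ≤ n) {L : List ℕ} (hL : L ∈ topLists n) :
    ((normList n r (encodeDesc L) : ℚ) : ℝ) = basisNorm n r L := by
  induction L with
  | nil => simp [encodeDesc, normList, basisNorm_nil hr]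
  | cons b L ih =>
    have e : encodeDesc (b :: L) = encodeDesc L ++ [(b : ℚ) + 1] := by simp [encodeDesc]
    rw [e, normList_append, basisNorm_cons hL]
    push_cast
    rw [ih (tail_mem_topLists hL)]
    congr 1
    unfold normFactor
    rw [length_encodeDesc]
    push_cast
    congr 1 <;> ring

/-- In each factor of the norm the numerator is a product of numbers at least `1` (by the top set
condition and the bound on the level) and the denominator is at most `n²`. Dividing by norms thus
amplifies errors by at most `n ^ (2 D)`. -/
theorem le_basisNorm {r : ℕ} (hr : r ≤ n) {L : List ℕ} (hL : L ∈ topLists n)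
    (h : L.length ≤ min r (n - r)) : 1 / (n : ℝ) ^ (2 * L.length) ≤ basisNorm n r L := by
  induction L with
  | nil => simp [basisNorm_nil hr]
  | cons b L ih =>
    have hb := (mem_topLists_iff.1 hL).1.2.2
    have hlen := length_of_mem_topLists hL
    rw [List.length_cons] at hlen h
    have hih := ih (tail_mem_topLists hL) (by omega)
    rw [basisNorm_cons hL, List.length_cons, mul_add, pow_add,
      ← one_div_mul_one_div]
    have hn0 : 0 < n := by omega
    have hb' : (1 : ℝ) ≤ (b : ℝ) - 2 * L.length := by
      have : ((2 * L.length + 1 : ℕ) : ℝ) ≤ b := by exact_mod_cast hb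
      push_cast at this; linarith
    have hr' : (1 : ℝ) ≤ (r : ℝ) - L.length := by
      have : ((L.length + 1 : ℕ) : ℝ) ≤ r := by exact_mod_cast (by omega : L.length + 1 ≤ r)
      push_cast at this; linarith
    have hnr : (1 : ℝ) ≤ (n : ℝ) - r - L.length := by
      have : ((L.length + 1 + r : ℕ) : ℝ) ≤ n := by exact_mod_cast (by omega : L.length + 1 + r ≤ n)
      push_cast at this; linarith
    have hn2 : (2 : ℝ) ≤ (n : ℝ) - 2 * L.length := by
      have : ((2 * (L.length + 1) : ℕ) : ℝ) ≤ n := by exact_mod_cast hlen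
      push_cast at this; linarith
    have hlpos : (0 : ℝ) ≤ L.length := by positivity
    refine mul_le_mul hih ?_ (by positivity) (basisNorm_nonneg (tail_mem_topLists hL))
    refine div_le_div₀ (mul_nonneg (mul_nonneg (by linarith) (by linarith))
      (mul_nonneg (by linarith) (by linarith))) ?_ (mul_pos (by linarith) (by linarith)) ?_
    · have h1 : (1 : ℝ) ≤ ((b : ℝ) + 1 - 2 * L.length) * ((b : ℝ) - 2 * L.length) :=
        one_le_mul_of_one_le_of_one_le (by linarith) hb'
      exact one_le_mul_of_one_le_of_one_le h1 (one_le_mul_of_one_le_of_one_le hr' hnr)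
    · rw [mul_one, sq]
      exact mul_le_mul (by linarith) (by linarith) (by linarith) (by positivity)

end Correspondence

end SliceLearner


namespace SliceLearner

/-! ## The combination found by the algorithm -/

section Combination

variable {n D m r e : ℕ} {f : Cube n → ℤˣ} {ω : Tape n}

theorem coefficient_cons {k : ℕ} (p : List ℚ × ℚ) (g : List (List ℚ × ℚ)) (B : Fin k → Fin n) :
    coefficient (p :: g) B = (if p.1 = encode B then (p.2 : ℝ) else 0) + coefficient g B := by
  unfold coefficient
  rw [List.filter_cons]
  split_ifs with h1 h2 h2
  · rw [List.map_cons, List.sum_cons]; push_cast; rfl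
  · simp [h2] at h1
  · simp [h2] at h1
  · rw [zero_add]

/-- Each entry of the list is the code of exactly one top set and contributes to its coefficient
only; repeated entries would add up on both sides. -/
theorem polyValue_eq {g : List (List ℚ × ℚ)} (hg : ∀ p ∈ g, p.1 ∈ topSeqs n (D + 1)) (x : Cube n) :
    polyValue r g x = ((combList n r g (pointList x) : ℚ) : ℝ) := by
  induction g with
  | nil => simp [polyValue, combList, coefficient]
  | cons p g ih =>
    have ih := ih fun q hq => hg q (by simp [hq])
    obtain ⟨L₀, hL₀, h₀⟩ := mem_topSeqs_iff.1 (hg p (by simp))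
    have hL₀' := (Finset.mem_filter.1 hL₀).1
    have key := sum_topSets_filter (n := n) le_rfl (fun _ => True)
      (fun L => if L₀ = L then (p.2 : ℝ) * listBasis r L x else 0)
    rw [Finset.filter_true, Finset.filter_true, Finset.sum_ite_eq, if_pos hL₀',
      ← basisList_encodeDesc hL₀', ← h₀] at key
    unfold polyValue at ih ⊢
    have e : combList n r (p :: g) (pointList x) =
        p.2 * basisList n r p.1 (pointList x) + combList n r g (pointList x) := by
      simp [combList]
    rw [e]
    push_cast
    rw [← ih, ← key, ← Finset.sum_add_distrib]
    refine Finset.sum_congr rfl fun k _ => ?_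
    rw [← Finset.sum_add_distrib]
    refine Finset.sum_congr rfl fun B hB => ?_
    rw [coefficient_cons, add_mul, basis_eq (mem_topSets.1 hB).1, h₀, encode_eq]
    congr 1
    simp only [encodeDesc_injective.eq_iff, ite_mul, zero_mul]

theorem mem_combAt {p : List ℚ × ℚ} (hp : p ∈ combAt f ω D m r e) : p.1 ∈ topSeqs n (D + 1) := by
  simp only [combAt, List.mem_reverse, List.mem_map, List.mem_range] at hp
  obtain ⟨i, hi, rfl⟩ := hp
  exact getD_mem_topSeqs hi

/-- The decreasing lists of top sets of length at most `D`. -/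
noncomputable def lowLists (n D : ℕ) : Finset (List ℕ) :=
  (topLists n).filter fun L => L.length ≤ D

/-- The position of a top set in the list of the algorithm. -/
def listIndex (n D : ℕ) (L : List ℕ) : ℕ := (topSeqs n (D + 1)).idxOf (encodeDesc L)

theorem encodeDesc_mem {L : List ℕ} (hL : L ∈ lowLists n D) : encodeDesc L ∈ topSeqs n (D + 1) :=
  mem_topSeqs_iff.2 ⟨L, hL, rfl⟩

theorem listIndex_lt {L : List ℕ} (hL : L ∈ lowLists n D) :
    listIndex n D L < (topSeqs n (D + 1)).length :=
  List.idxOf_lt_length_of_mem (encodeDesc_mem hL)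

theorem getD_listIndex {L : List ℕ} (hL : L ∈ lowLists n D) :
    (topSeqs n (D + 1)).getD (listIndex n D L) [] = encodeDesc L := by
  rw [List.getD_eq_getElem _ _ (listIndex_lt hL)]
  exact List.getElem_idxOf _

theorem sum_range_topSeqs (H : ℕ → ℝ) :
    ∑ i ∈ Finset.range (topSeqs n (D + 1)).length, H i = ∑ L ∈ lowLists n D, H (listIndex n D L) := by
  symm
  refine Finset.sum_nbij (listIndex n D) (fun L hL => Finset.mem_range.2 (listIndex_lt hL)) ?_ ?_
    (fun _ _ => rfl)
  · intro L hL L' hL' h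
    have h1 := getD_listIndex hL
    rw [h, getD_listIndex hL'] at h1
    exact (encodeDesc_injective h1).symm
  · intro i hi
    have hi' := Finset.mem_range.1 (Finset.mem_coe.1 hi)
    obtain ⟨L, hL, h⟩ := mem_topSeqs_iff.1 (getD_mem_topSeqs hi')
    refine ⟨L, hL, ?_⟩
    rw [listIndex, ← h, List.getD_eq_getElem _ _ hi']
    exact (nodup_topSeqs n (D + 1)).idxOf_getElem i hi'

theorem card_lowLists (n D : ℕ) : (lowLists n D).card = (topSeqs n (D + 1)).length := by
  have := sum_range_topSeqs (n := n) (D := D) (fun _ => 1)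
  simp only [Finset.sum_const, Finset.card_range, nsmul_eq_mul, mul_one] at this
  exact_mod_cast this.symm

theorem combList_combAt (x : Cube n) :
    ((combList n r (combAt f ω D m r e) (pointList x) : ℚ) : ℝ) =
      ∑ L ∈ lowLists n D, (coefAt f ω D m r e (listIndex n D L) : ℝ) * listBasis r L x := by
  have h : combList n r (combAt f ω D m r e) (pointList x) =
      ∑ i ∈ Finset.range (topSeqs n (D + 1)).length, coefAt f ω D m r e i *
        basisList n r ((topSeqs n (D + 1)).getD i []) (pointList x) := by
    rw [combList, combAt, List.map_reverse, List.sum_reverse, List.map_map]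
    simp only [Finset.sum, Finset.range, Multiset.range, Multiset.map_coe, Multiset.sum_coe]
    rfl
  rw [h]
  push_cast
  rw [sum_range_topSeqs (fun i => (coefAt f ω D m r e i : ℝ) *
    (basisList n r ((topSeqs n (D + 1)).getD i []) (pointList x) : ℚ))]
  refine Finset.sum_congr rfl fun L hL => ?_
  rw [getD_listIndex hL, basisList_encodeDesc (Finset.mem_filter.1 hL).1]

/-! ### Conditional means and the effect of accurate estimates -/

/-- The average of `v` over the points that satisfy `K`. -/
noncomputable def condMean (K : Cube n → Bool) (v : Cube n → ℤ) : ℝ :=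
  (∑ x ∈ Finset.univ.filter (fun x => K x = true), (v x : ℝ)) /
    (Finset.univ.filter fun x => K x = true).card

theorem condMean_slice (r : ℕ) (v : Cube n → ℤ) :
    condMean (fun x => decide (weight x = r)) v =
      (∑ x ∈ slice n r, (v x : ℝ)) / (slice n r).card := by
  simp only [condMean, decide_eq_true_eq]; rfl

theorem condMean_inner {L : List ℕ} (hL : L ∈ topLists n) :
    condMean (fun x => decide (weight x = r))
      (fun x => (f x : ℤ) * (basisList n r (encodeDesc L) (pointList x)).num) =
    sliceInner r (toReal f) (listBasis r L) := by
  rw [condMean_slice, sliceInner]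
  congr 1
  refine Finset.sum_congr rfl fun x _ => ?_
  rw [← basisList_encodeDesc hL, (basisList_num (isBits_pointList x)).1, Rat.num_intCast]
  push_cast
  rfl

theorem sliceInner_toReal_self (hr : r ≤ n) : sliceInner r (toReal f) (toReal f) = 1 := by
  unfold sliceInner
  have : ∀ x, toReal f x * toReal f x = 1 := by
    intro x
    unfold toReal
    rcases Int.units_eq_one_or (f x) with h | h <;> simp [h]
  simp only [this, Finset.sum_const, nsmul_eq_mul, mul_one]
  refine div_self ?_
  rw [card_slice]
  exact_mod_cast (Nat.choose_pos hr).ne'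

theorem abs_sliceInner_le (hr : r ≤ n) {L : List ℕ} (hL : L ∈ topLists n) :
    |sliceInner r (toReal f) (listBasis r L)| ≤ (n : ℝ) ^ L.length := by
  unfold sliceInner
  have hc : (0 : ℝ) < (slice n r).card := by rw [card_slice]; exact_mod_cast Nat.choose_pos hr
  rw [abs_div, abs_of_pos hc, div_le_iff₀ hc]
  refine (Finset.abs_sum_le_sum_abs _ _).trans ?_
  rw [mul_comm, ← nsmul_eq_mul]
  refine Finset.sum_le_card_nsmul _ _ _ fun x _ => ?_
  have h1 : |toReal f x| = 1 := by
    unfold toReal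
    rcases Int.units_eq_one_or (f x) with h | h <;> simp [h]
  rw [abs_mul, h1, one_mul, ← basisList_encodeDesc hL]
  obtain ⟨h2, h3⟩ := basisList_num (n := n) (r := r) (B := encodeDesc L) (isBits_pointList x)
  rw [h2, Rat.cast_intCast, ← Int.cast_abs, Int.abs_eq_natAbs, ← length_encodeDesc L]
  exact_mod_cast h3

/-- All inner products are estimated up to an error of `ε`. -/
def InnerAccurate (f : Cube n → ℤˣ) (ω : Tape n) (D m r e : ℕ) (ε : ℝ) : Prop := ∀ i < (topSeqs n (D + 1)).length,
  |(innerAt f ω D m r e i : ℝ) - condMean (fun x => decide (weight x = r)) (fun x => (f x : ℤ) *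
    (basisList n r ((topSeqs n (D + 1)).getD i []) (pointList x)).num)| ≤ ε

theorem InnerAccurate.abs_sub_le {ε : ℝ} (h : InnerAccurate f ω D m r e ε) {L : List ℕ}
    (hL : L ∈ lowLists n D) : |(innerAt f ω D m r e (listIndex n D L) : ℝ) -
      sliceInner r (toReal f) (listBasis r L)| ≤ ε := by
  have := h _ (listIndex_lt hL)
  rwa [getD_listIndex hL, condMean_inner (Finset.mem_filter.1 hL).1] at this

theorem coefAt_listIndex (hr : r ≤ n) {L : List ℕ} (hL : L ∈ lowLists n D) :
    (coefAt f ω D m r e (listIndex n D L) : ℝ) =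
      innerAt f ω D m r e (listIndex n D L) / basisNorm n r L := by
  rw [coefAt, getD_listIndex hL, Rat.cast_div, normList_encodeDesc hr (Finset.mem_filter.1 hL).1]

/-- There are at most `(D + 1) n ^ D ≤ n ^ (2 D)` top sets of length at most `D`, and each inverse
norm is at most `n ^ (2 D)`. -/
theorem sum_inv_basisNorm_le (hr : r ≤ n) (hn : 2 ≤ n) (hD : D ≤ min r (n - r)) :
    (∀ L ∈ lowLists n D, 0 < basisNorm n r L ∧ 1 / basisNorm n r L ≤ (n : ℝ) ^ (2 * D)) ∧
    ∑ L ∈ lowLists n D, 1 / basisNorm n r L ≤ (n : ℝ) ^ (4 * D) := by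
  have hn1 : (1 : ℝ) ≤ n := by exact_mod_cast (by omega : 1 ≤ n)
  have h : ∀ L ∈ lowLists n D, 0 < basisNorm n r L ∧ 1 / basisNorm n r L ≤ (n : ℝ) ^ (2 * D) := by
    intro L hL
    obtain ⟨h1, h2⟩ := Finset.mem_filter.1 hL
    have h3 := le_basisNorm hr h1 (by omega)
    have h4 : (0 : ℝ) < 1 / (n : ℝ) ^ (2 * L.length) := by positivity
    refine ⟨h4.trans_le h3, ?_⟩
    rw [one_div_le (h4.trans_le h3) (by positivity)]
    refine le_trans ?_ h3
    exact one_div_le_one_div_of_le (by positivity) (pow_le_pow_right₀ hn1 (by omega))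
  refine ⟨h, (Finset.sum_le_card_nsmul _ _ _ fun L hL => (h L hL).2).trans ?_⟩
  have h5 : (lowLists n D).card ≤ n ^ (2 * D) := by
    rw [card_lowLists]
    refine (length_topSeqs_le (D := D) (by omega) (D + 1) le_rfl).trans ?_
    have : D + 1 ≤ n ^ D := (Nat.lt_pow_self (show 1 < n by omega))
    calc (D + 1) * n ^ D ≤ n ^ D * n ^ D := Nat.mul_le_mul_right _ this
      _ = n ^ (2 * D) := by rw [← pow_add]; congr 1; ring
  rw [nsmul_eq_mul, show 4 * D = 2 * D + 2 * D by ring, pow_add]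
  have : ((lowLists n D).card : ℝ) ≤ (n : ℝ) ^ (2 * D) := by exact_mod_cast h5
  gcongr

theorem weightAt_eq (hr : r ≤ n) : (weightAt f ω D m r e : ℝ) = ∑ L ∈ lowLists n D,
    (innerAt f ω D m r e (listIndex n D L) : ℝ) ^ 2 / basisNorm n r L := by
  unfold weightAt
  push_cast
  rw [sum_range_topSeqs (fun i => (innerAt f ω D m r e i : ℝ) * coefAt f ω D m r e i)]
  refine Finset.sum_congr rfl fun L hL => ?_
  rw [coefAt_listIndex hr hL]; ring

/-- With estimate `z` of `a`, where `|a| ≤ n ^ D` and `|z - a| ≤ n ^ (-6 D)`, one has `|z² - a²| ≤ 3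
n ^ D n ^ (-6 D)`. Summed against the inverse norms this gives `3 n ^ (D + 4 D - 6 D) = 3 n ^ (-D)`.
-/
theorem abs_weightAt_sub_le (hr : r ≤ n) (hn : 2 ≤ n) (hD1 : 1 ≤ D) (hD : D ≤ min r (n - r))
    (h : InnerAccurate f ω D m r e (1 / (n : ℝ) ^ (6 * D))) :
    |(weightAt f ω D m r e : ℝ) - ∑ L ∈ lowLists n D, listWeight r (toReal f) L| ≤ 3 / n := by
  have hn1 : (1 : ℝ) ≤ n := by exact_mod_cast (by omega : 1 ≤ n)
  obtain ⟨h1, h2⟩ := sum_inv_basisNorm_le hr hn hD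
  rw [weightAt_eq hr, ← Finset.sum_sub_distrib]
  refine (Finset.abs_sum_le_sum_abs _ _).trans ?_
  have key : ∀ L ∈ lowLists n D, |(innerAt f ω D m r e (listIndex n D L) : ℝ) ^ 2 / basisNorm n r L -
      listWeight r (toReal f) L| ≤ (3 * (n : ℝ) ^ D / (n : ℝ) ^ (6 * D)) * (1 / basisNorm n r L) := by
    intro L hL
    obtain ⟨hL1, hL2⟩ := Finset.mem_filter.1 hL
    have hq := (h1 L hL).1
    have ha := abs_sliceInner_le (f := f) hr hL1
    have ha' : |sliceInner r (toReal f) (listBasis r L)| ≤ (n : ℝ) ^ D :=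
      ha.trans (pow_le_pow_right₀ hn1 hL2)
    have he := h.abs_sub_le hL
    set a := sliceInner r (toReal f) (listBasis r L)
    set z := (innerAt f ω D m r e (listIndex n D L) : ℝ)
    have e1 : z ^ 2 / basisNorm n r L - listWeight r (toReal f) L =
        ((z - a) * ((z - a) + 2 * a)) * (1 / basisNorm n r L) := by
      rw [listWeight]; ring
    rw [e1, abs_mul, abs_of_pos (one_div_pos.2 hq), abs_mul]
    refine mul_le_mul_of_nonneg_right ?_ (one_div_pos.2 hq).le
    have h3 : |z - a + 2 * a| ≤ 3 * (n : ℝ) ^ D := by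
      refine (abs_add_le _ _).trans ?_
      rw [abs_mul, abs_of_pos (by norm_num : (0 : ℝ) < 2)]
      have : |z - a| ≤ (n : ℝ) ^ D := he.trans <| by
        have h4 : 1 / (n : ℝ) ^ (6 * D) ≤ 1 := by
          rw [div_le_one (by positivity)]; exact one_le_pow₀ hn1
        exact h4.trans (one_le_pow₀ hn1)
      linarith
    calc |z - a| * |z - a + 2 * a| ≤ 1 / (n : ℝ) ^ (6 * D) * (3 * (n : ℝ) ^ D) :=
          mul_le_mul he h3 (abs_nonneg _) (by positivity)
      _ = _ := by ring
  refine (Finset.sum_le_sum key).trans ?_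
  rw [← Finset.mul_sum]
  calc 3 * (n : ℝ) ^ D / (n : ℝ) ^ (6 * D) * ∑ L ∈ lowLists n D, 1 / basisNorm n r L
      ≤ 3 * (n : ℝ) ^ D / (n : ℝ) ^ (6 * D) * (n : ℝ) ^ (4 * D) := by gcongr
    _ = 3 / (n : ℝ) ^ D := by
        rw [show 6 * D = 4 * D + D + D by ring, pow_add, pow_add]
        field_simp
    _ ≤ 3 / n := by
        have : (n : ℝ) ≤ (n : ℝ) ^ D := le_self_pow₀ hn1 (by omega)
        gcongr

/-- By Pythagoras the squared distance is `1` minus the true low-level weight plus the squared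
errors of the coefficients. The former differs from the estimated weight by `3 / n`, the latter sum
to at most `1 / n`. -/
theorem sliceInner_sub_combAt_le (hr : r ≤ n) (hn : 2 ≤ n) (hD1 : 1 ≤ D) (hD : D ≤ min r (n - r))
    (h : InnerAccurate f ω D m r e (1 / (n : ℝ) ^ (6 * D))) :
    sliceInner r (fun x => toReal f x - (combList n r (combAt f ω D m r e) (pointList x) : ℚ))
      (fun x => toReal f x - (combList n r (combAt f ω D m r e) (pointList x) : ℚ)) ≤
    1 - weightAt f ω D m r e + 4 / n := by
  have hn1 : (1 : ℝ) ≤ n := by exact_mod_cast (by omega : 1 ≤ n)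
  obtain ⟨h1, h2⟩ := sum_inv_basisNorm_le hr hn hD
  have hw := (abs_le.1 (abs_weightAt_sub_le hr hn hD1 hD h)).2
  simp only [combList_combAt]
  rw [sliceInner_sub_combination (T := lowLists n D) (toReal f) (Finset.filter_subset _ _)
    (fun L => (coefAt f ω D m r e (listIndex n D L) : ℝ)), sliceInner_toReal_self hr]
  -- Completing the square: for a coefficient `κ = z / q` one has `κ² q = 2 κ a - a² / q + (z - a)²
  -- / q`.
  have e1 : ∑ L ∈ lowLists n D, (coefAt f ω D m r e (listIndex n D L) : ℝ) ^ 2 * basisNorm n r L =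
      2 * ∑ L ∈ lowLists n D, (coefAt f ω D m r e (listIndex n D L) : ℝ) *
        sliceInner r (toReal f) (listBasis r L) - ∑ L ∈ lowLists n D, listWeight r (toReal f) L +
      ∑ L ∈ lowLists n D, ((innerAt f ω D m r e (listIndex n D L) : ℝ) -
        sliceInner r (toReal f) (listBasis r L)) ^ 2 * (1 / basisNorm n r L) := by
    rw [Finset.mul_sum, ← Finset.sum_sub_distrib, ← Finset.sum_add_distrib]
    refine Finset.sum_congr rfl fun L hL => ?_
    have hq := (h1 L hL).1.ne'
    rw [coefAt_listIndex hr hL, listWeight]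
    field_simp
    ring
  have e2 : ∑ L ∈ lowLists n D, ((innerAt f ω D m r e (listIndex n D L) : ℝ) -
        sliceInner r (toReal f) (listBasis r L)) ^ 2 * (1 / basisNorm n r L) ≤ (1 : ℝ) / n := by
    calc _ ≤ ∑ L ∈ lowLists n D, (1 / (n : ℝ) ^ (6 * D)) ^ 2 * (1 / basisNorm n r L) := by
          refine Finset.sum_le_sum fun L hL => ?_
          refine mul_le_mul_of_nonneg_right ?_ (one_div_pos.2 (h1 L hL).1).le
          rw [← sq_abs]
          exact pow_le_pow_left₀ (abs_nonneg _) (h.abs_sub_le hL) 2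
      _ ≤ (1 / (n : ℝ) ^ (6 * D)) ^ 2 * (n : ℝ) ^ (4 * D) := by
          rw [← Finset.mul_sum]; gcongr
      _ = 1 / (n : ℝ) ^ (8 * D) := by
          rw [div_pow, one_pow, ← pow_mul, show 6 * D * 2 = 8 * D + 4 * D by ring, pow_add]
          field_simp
      _ ≤ 1 / n := by
          have : (n : ℝ) ≤ (n : ℝ) ^ (8 * D) := le_self_pow₀ hn1 (by omega)
          gcongr
  rw [e1]
  have e3 : (4 : ℝ) / n = 3 / n + 1 / n := by ring
  rw [e3]
  linarith

end Combination

end SliceLearner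


namespace SliceLearner

open MeasureTheory ProbabilityTheory

/-! ## Sequences of independent uniform draws -/

section Draws

variable {α : Type} [Nonempty α]

open Classical in
/-- Some sequence with given entries at the places of `S`. -/
noncomputable def extend (S : Finset ℕ) (u : S → α) (i : ℕ) : α :=
  if h : i ∈ S then u ⟨i, h⟩ else Classical.arbitrary α

theorem extend_apply {S : Finset ℕ} (ω : ℕ → α) {i : ℕ} (h : i ∈ S) :
    extend S (fun i : S => ω i) i = ω i := by simp [extend, h]

variable [Fintype α] [MeasurableSpace α]

variable (α) in
/-- The law of a sequence of independent uniformly random elements of `α`. -/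
noncomputable def seqMeasure : Measure (ℕ → α) :=
  Measure.infinitePi fun _ : ℕ => (PMF.uniformOfFintype α).toMeasure

instance : IsProbabilityMeasure (seqMeasure α) := by unfold seqMeasure; infer_instance

theorem iIndepFun_seqMeasure : iIndepFun (fun (i : ℕ) (ω : ℕ → α) => ω i) (seqMeasure α) := by
  have := iIndepFun_infinitePi (P := fun _ : ℕ => (PMF.uniformOfFintype α).toMeasure)
    (X := fun _ => id) (fun _ => measurable_id)
  exact this

theorem seqMeasure_map_eval (i : ℕ) :
    (seqMeasure α).map (fun ω => ω i) = (PMF.uniformOfFintype α).toMeasure :=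
  Measure.infinitePi_map_eval _ i

theorem indepFun_seqMeasure {S T : Finset ℕ} (h : Disjoint S T) :
    IndepFun (fun (ω : ℕ → α) (i : S) => ω i) (fun (ω : ℕ → α) (i : T) => ω i) (seqMeasure α) :=
  iIndepFun_seqMeasure.indepFun_finset S T h fun i => measurable_pi_apply i

variable [MeasurableSingletonClass α]

/-- The parameter `G` is determined by draws before `e`, the event `A g` by draws from `e` to `N -
1`. By independence and Fubini the parameter may be frozen, so a bound for each of its values holds
for the random one. -/
theorem seqMeasure_adaptive_le {γ : Type} {e N : ℕ} {G : (ℕ → α) → γ} {A : γ → Set (ℕ → α)}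
    {β : ENNReal} (hG : ∀ ω ω' : ℕ → α, (∀ i < e, ω i = ω' i) → G ω = G ω')
    (hA : ∀ g (ω ω' : ℕ → α), (∀ i, e ≤ i → i < N → ω i = ω' i) → ω ∈ A g → ω' ∈ A g)
    (h : ∀ ω, seqMeasure α (A (G ω)) ≤ β) : seqMeasure α {ω | ω ∈ A (G ω)} ≤ β := by
  classical
  set S := Finset.range e with hS
  set T := Finset.Ico e N with hT
  have hST : Disjoint S T := by
    rw [Finset.disjoint_left]
    intro i h1 h2
    simp only [hS, hT, Finset.mem_range, Finset.mem_Ico] at h1 h2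
    omega
  set X : (ℕ → α) → (S → α) := fun ω i => ω i with hX
  set Y : (ℕ → α) → (T → α) := fun ω i => ω i with hY
  have mX : Measurable X := measurable_pi_lambda _ fun i => measurable_pi_apply _
  have mY : Measurable Y := measurable_pi_lambda _ fun i => measurable_pi_apply _
  have hmem : ∀ g ω, ω ∈ A g ↔ extend T (Y ω) ∈ A g := by
    intro g ω
    have h' : ∀ i, e ≤ i → i < N → extend T (Y ω) i = ω i :=
      fun i h1 h2 => extend_apply ω (Finset.mem_Ico.2 ⟨h1, h2⟩)
    exact ⟨hA g _ _ fun i h1 h2 => (h' i h1 h2).symm, hA g _ _ h'⟩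
  have hGe : ∀ ω, G (extend S (X ω)) = G ω := fun ω =>
    hG _ _ fun i hi => extend_apply ω (Finset.mem_range.2 hi)
  -- Both blocks of draws range over finite sets, so measurability is automatic and need not be
  -- assumed of `G` or `A`.
  set B : Set ((S → α) × (T → α)) := {p | extend T p.2 ∈ A (G (extend S p.1))} with hB
  have hBm : MeasurableSet B := (Set.toFinite B).measurableSet
  have e1 : {ω | ω ∈ A (G ω)} = (fun ω => (X ω, Y ω)) ⁻¹' B := by
    ext ω
    simp only [Set.mem_ofPred_eq, Set.mem_preimage, hB]
    rw [hGe, ← hmem]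
  have hind := (indepFun_iff_map_prod_eq_prod_map_map mX.aemeasurable mY.aemeasurable).1
    (indepFun_seqMeasure (α := α) hST)
  have : IsProbabilityMeasure ((seqMeasure α).map X) := Measure.isProbabilityMeasure_map mX.aemeasurable
  rw [e1, ← Measure.map_apply (mX.prodMk mY) hBm, hind, Measure.prod_apply hBm]
  have h2 : ∀ u : S → α, (seqMeasure α).map Y (Prod.mk u ⁻¹' B) ≤ β := by
    intro u
    rw [Measure.map_apply mY (Set.toFinite _).measurableSet]
    have : Y ⁻¹' (Prod.mk u ⁻¹' B) = A (G (extend S u)) := by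
      ext ω
      simp only [Set.mem_preimage, hB, Set.mem_ofPred_eq]
      exact (hmem _ ω).symm
    rw [this]
    exact h _
  calc _ ≤ ∫⁻ _, β ∂((seqMeasure α).map X) := lintegral_mono h2
    _ = β := by simp

theorem integral_uniform (h : α → ℝ) :
    ∫ x, h x ∂(PMF.uniformOfFintype α).toMeasure = (∑ x, h x) / Fintype.card α := by
  rw [PMF.integral_eq_sum, Finset.sum_div]
  refine Finset.sum_congr rfl fun x _ => ?_
  simp [PMF.uniformOfFintype_apply, div_eq_inv_mul]

/-- Chebyshev's inequality for a sum of `m` independent centred variables of variance at most `s`.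
-/
theorem seqMeasure_sum_ge_le {h : α → ℝ} {s δ : ℝ} (h0 : ∑ x, h x = 0)
    (hs : (∑ x, h x ^ 2) / Fintype.card α ≤ s) (hδ : 0 < δ) (e m : ℕ) :
    seqMeasure α {ω | δ ≤ |∑ i ∈ Finset.range m, h (ω (e + i))|} ≤
      ENNReal.ofReal (m * s / δ ^ 2) := by
  have hm : Measurable h := measurable_of_finite h
  set X : ℕ → (ℕ → α) → ℝ := fun i ω => h (ω (e + i)) with hX
  have mX : ∀ i, Measurable (X i) := fun i => hm.comp (measurable_pi_apply _)
  obtain ⟨b, hb⟩ : ∃ b, ∀ x, |h x| ≤ b := by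
    refine ⟨∑ x, |h x|, fun x => ?_⟩
    exact Finset.single_le_sum (f := fun x => |h x|) (fun _ _ => abs_nonneg _) (Finset.mem_univ x)
  have hL : ∀ i, MemLp (X i) 2 (seqMeasure α) := fun i =>
    MemLp.of_bound (mX i).aestronglyMeasurable b (Filter.Eventually.of_forall fun ω => hb _)
  have hint : ∀ i (k : α → ℝ), ∫ ω, k (ω (e + i)) ∂(seqMeasure α) = (∑ x, k x) / Fintype.card α := by
    intro i k
    rw [← integral_uniform, ← seqMeasure_map_eval (α := α) (e + i),
      integral_map (measurable_pi_apply _).aemeasurable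
        (measurable_of_finite k).aestronglyMeasurable]
  have hmean : ∀ i, ∫ ω, X i ω ∂(seqMeasure α) = 0 := by
    intro i
    rw [hX, hint i h, h0, zero_div]
  have hvar : ∀ i, variance (X i) (seqMeasure α) ≤ s := by
    intro i
    refine (variance_le_expectation_sq (mX i).aestronglyMeasurable).trans ?_
    have := hint i (fun x => h x ^ 2)
    simp only [Pi.pow_apply, hX]
    rw [this]
    exact hs
  have hindep : Set.Pairwise (↑(Finset.range m)) fun i j => IndepFun (X i) (X j) (seqMeasure α) := by
    intro i _ j _ hij
    have := (iIndepFun_seqMeasure (α := α)).indepFun (show e + i ≠ e + j by omega)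
    exact this.comp hm hm
  have hvs := IndepFun.variance_sum (fun i _ => hL i) hindep
  have hLs : MemLp (∑ i ∈ Finset.range m, X i) 2 (seqMeasure α) :=
    memLp_finsetSum' _ fun i _ => hL i
  have key := meas_ge_le_variance_div_sq hLs hδ
  have hms : ∫ ω, (∑ i ∈ Finset.range m, X i) ω ∂(seqMeasure α) = 0 := by
    simp only [Finset.sum_apply]
    rw [integral_finsetSum _ fun i _ => (hL i).integrable (by norm_num)]
    simp [hmean]
  rw [hms] at key
  simp only [Finset.sum_apply, sub_zero] at key
  refine key.trans (ENNReal.ofReal_le_ofReal ?_)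
  rw [hvs]
  gcongr
  refine (Finset.sum_le_card_nsmul _ _ _ fun i _ => hvar i).trans ?_
  simp

end Draws

section Averages

variable {n : ℕ}

/-- An average over the examples that happen to satisfy `K` is a ratio of two random sums. If the
centred numerator is below `ε m κ' / 2` and the count exceeds half of its mean `m κ'`, the ratio is
within `ε` of the conditional mean; Chebyshev bounds the two exceptions by `16 V² / (ε² m κ')` and
`4 / (m κ')`. -/
theorem seqMeasure_avgOf_le {K : Cube n → Bool} {v : Cube n → ℤ} {V ε κ : ℝ} (hκ : 0 < κ)
    (hK : κ * 2 ^ n ≤ (Finset.univ.filter fun x => K x = true).card)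
    (hV : ∀ x, K x = true → |(v x : ℝ)| ≤ V) (hε : 0 < ε) (e : ℕ) {m : ℕ} (hm : 0 < m) :
    seqMeasure (Cube n) {ω | ε < |(avgOf (fun i => ω (e + i)) K v m : ℝ) - condMean K v|} ≤
      ENNReal.ofReal ((16 * V ^ 2 / ε ^ 2 + 4) / (m * κ)) := by
  set c : ℝ := ((Finset.univ.filter fun x => K x = true).card : ℝ) with hc
  set κ' : ℝ := c / 2 ^ n with hκ'
  have hκκ : κ ≤ κ' := by rw [hκ', le_div_iff₀ (by positivity)]; exact hK
  have hκ'0 : 0 < κ' := hκ.trans_le hκκ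
  have hc0 : 0 < c := lt_of_lt_of_le (by positivity) hK
  have hcard : (Fintype.card (Cube n) : ℝ) = 2 ^ n := by simp
  set μ := condMean K v with hμ
  have hμV : |μ| ≤ V := by
    rw [hμ, condMean, abs_div, Nat.abs_cast, div_le_iff₀ hc0]
    refine (Finset.abs_sum_le_sum_abs _ _).trans ?_
    rw [mul_comm, ← nsmul_eq_mul]
    exact Finset.sum_le_card_nsmul _ _ _ fun x hx => hV x (Finset.mem_filter.1 hx).2
  have hV0 : 0 ≤ V := (abs_nonneg _).trans hμV
  -- The value centred at the conditional mean and cut off to `K`: its mean over the cube is zero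
  -- and its second moment at most `(2 V)² κ'`. The variable `w` is the centred indicator of `K`,
  -- with second moment at most `κ'`.
  set z : Cube n → ℝ := fun x => if K x then (v x : ℝ) - μ else 0 with hz
  set w : Cube n → ℝ := fun x => (if K x then 1 else 0) - κ' with hw
  have hz0 : ∑ x, z x = 0 := by
    rw [hz, ← Finset.sum_filter, Finset.sum_sub_distrib, Finset.sum_const, nsmul_eq_mul, hμ, condMean,
      mul_div_cancel₀ _ hc0.ne', sub_self]
  have hzs : (∑ x, z x ^ 2) / Fintype.card (Cube n) ≤ 4 * V ^ 2 * κ' := by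
    rw [hcard, div_le_iff₀ (by positivity), hκ', mul_assoc, div_mul_cancel₀ _ (by positivity)]
    have : ∀ x, z x ^ 2 = if K x then ((v x : ℝ) - μ) ^ 2 else 0 := by
      intro x; simp only [hz]; split_ifs <;> simp
    simp only [this]
    rw [← Finset.sum_filter, mul_comm, hc, ← nsmul_eq_mul]
    refine Finset.sum_le_card_nsmul _ _ _ fun x hx => ?_
    have h1 := hV x (Finset.mem_filter.1 hx).2
    have h2 : |(v x : ℝ) - μ| ≤ 2 * V := (abs_sub _ _).trans (by linarith)
    rw [← sq_abs]
    nlinarith [abs_nonneg ((v x : ℝ) - μ)]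
  have hK1 : ∑ x : Cube n, (if K x then (1 : ℝ) else 0) = c := by
    rw [Finset.sum_boole]
  have hcn : κ' * 2 ^ n = c := by rw [hκ', div_mul_cancel₀ _ (by positivity)]
  have hw0 : ∑ x, w x = 0 := by
    rw [hw, Finset.sum_sub_distrib, hK1, Finset.sum_const, nsmul_eq_mul, Finset.card_univ, hcard,
      mul_comm, hcn, sub_self]
  have hws : (∑ x, w x ^ 2) / Fintype.card (Cube n) ≤ κ' := by
    rw [hcard, div_le_iff₀ (by positivity), hcn]
    have : ∀ x, w x ^ 2 = (1 - 2 * κ') * (if K x then 1 else 0) + κ' ^ 2 := by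
      intro x; simp only [hw]; split_ifs <;> ring
    simp only [this]
    rw [Finset.sum_add_distrib, ← Finset.mul_sum, hK1, Finset.sum_const, nsmul_eq_mul, Finset.card_univ,
      hcard]
    have : (2 : ℝ) ^ n * κ' ^ 2 = κ' * c := by rw [← hcn]; ring
    rw [this]
    nlinarith
  have hm' : (0 : ℝ) < m := by exact_mod_cast hm
  have b1 := seqMeasure_sum_ge_le hz0 hzs (show 0 < ε * (m * κ') / 2 by positivity) e m
  have b2 := seqMeasure_sum_ge_le hw0 hws (show 0 < m * κ' / 2 by positivity) e m
  -- Outside the two exceptional events the count is positive, so the default value of an average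
  -- over no examples plays no role.
  have hsub : {ω : ℕ → Cube n | ε < |(avgOf (fun i => ω (e + i)) K v m : ℝ) - μ|} ⊆
      {ω | ε * (m * κ') / 2 ≤ |∑ i ∈ Finset.range m, z (ω (e + i))|} ∪
      {ω | m * κ' / 2 ≤ |∑ i ∈ Finset.range m, w (ω (e + i))|} := by
    intro ω hω
    by_contra hcon
    simp only [Set.mem_union, Set.mem_ofPred_eq, not_or, not_le] at hcon hω
    obtain ⟨h1, h2⟩ := hcon
    set N : ℝ := ∑ i ∈ Finset.range m, if K (ω (e + i)) then (1 : ℝ) else 0 with hN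
    have e1 : ∑ i ∈ Finset.range m, w (ω (e + i)) = N - m * κ' := by
      rw [hw, Finset.sum_sub_distrib]; simp [hN]
    rw [e1] at h2
    have hNlow : m * κ' / 2 < N := by have := (abs_lt.1 h2).1; linarith
    have hN0 : 0 < N := lt_trans (by positivity) hNlow
    have e2 : ∑ i ∈ Finset.range m, z (ω (e + i)) =
        (∑ i ∈ Finset.range m, if K (ω (e + i)) then (v (ω (e + i)) : ℝ) else 0) - μ * N := by
      rw [hN, Finset.mul_sum, ← Finset.sum_sub_distrib]
      refine Finset.sum_congr rfl fun i _ => ?_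
      simp only [hz]; split_ifs <;> simp
    have e3 : (avgOf (fun i => ω (e + i)) K v m : ℝ) =
        (∑ i ∈ Finset.range m, if K (ω (e + i)) then (v (ω (e + i)) : ℝ) else 0) / N := by
      unfold avgOf
      push_cast
      rw [hN]
      congr 1 <;> exact Finset.sum_congr rfl fun i _ => by split_ifs <;> simp
    have e4 : (avgOf (fun i => ω (e + i)) K v m : ℝ) - μ =
        (∑ i ∈ Finset.range m, z (ω (e + i))) / N := by
      rw [e3, e2]; field_simp
    rw [e4, abs_div, abs_of_pos hN0, lt_div_iff₀ hN0] at hω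
    nlinarith
  calc _ ≤ _ := measure_mono hsub
    _ ≤ _ := measure_union_le _ _
    _ ≤ _ := add_le_add b1 b2
    _ = ENNReal.ofReal ((16 * V ^ 2 / ε ^ 2 + 4) / (m * κ')) := by
        rw [← ENNReal.ofReal_add (by positivity) (by positivity)]
        congr 1
        field_simp
        ring
    _ ≤ _ := by
        apply ENNReal.ofReal_le_ofReal
        gcongr

end Averages

end SliceLearner


namespace SliceLearner

open MeasureTheory ProbabilityTheory

/-! ## Random thresholds -/

section Coins

variable {n : ℕ}

/-- The number with the first `n` of the given binary digits. -/
def bitCode (b : ℕ → Bool) : ℕ → ℕ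
  | 0 => 0
  | n + 1 => 2 * bitCode b n + if b n then 1 else 0

theorem bitCode_lt (b : ℕ → Bool) (n : ℕ) : bitCode b n < 2 ^ n := by
  induction n with
  | zero => simp [bitCode]
  | succ n ih => rw [bitCode, pow_succ]; split_ifs <;> omega

theorem bitCode_inj {b b' : ℕ → Bool} (h : bitCode b n = bitCode b' n) : ∀ j < n, b j = b' j := by
  induction n with
  | zero => simp
  | succ n ih =>
    simp only [bitCode] at h
    have h1 : bitCode b n = bitCode b' n := by split_ifs at h <;> omega
    have h2 : b n = b' n := by
      cases h3 : b n <;> cases h4 : b' n <;> simp [h3, h4] at h ⊢ <;> omega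
    intro j hj
    rcases Nat.lt_succ_iff_lt_or_eq.1 hj with h | rfl
    · exact ih h1 j h
    · exact h2

/-- The random bits are the binary digits, most significant first, of the index `j` of the grid
point `-1 + 2 j / 2 ^ n`. -/
theorem threshold_eq (b : ℕ → Bool) (n : ℕ) : threshold b n = -1 + 2 * bitCode b n / 2 ^ n := by
  induction n with
  | zero => simp [threshold, bitCode]
  | succ n ih =>
    unfold threshold at ih ⊢
    rw [Finset.sum_range_succ, ← add_assoc, ih, bitCode]
    split_ifs
    · push_cast; rw [div_pow, one_pow]; field_simp; ring
    · push_cast; field_simp; ring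

/-- A sequence of bits that starts with the given ones. -/
def bitSeq (b : Fin n → Bool) (j : ℕ) : Bool := if h : j < n then b ⟨j, h⟩ else false

theorem threshold_congr {b b' : ℕ → Bool} (h : ∀ j < n, b j = b' j) :
    threshold b n = threshold b' n := by
  unfold threshold
  congr 1
  exact Finset.sum_congr rfl fun j hj => by rw [h j (Finset.mem_range.1 hj)]

theorem card_threshold_le (P : ℚ → Prop) [DecidablePred P] :
    (Finset.univ.filter fun b : Fin n → Bool => P (threshold (bitSeq b) n)).card ≤
      ((Finset.range (2 ^ n)).filter fun j : ℕ => P (-1 + 2 * j / 2 ^ n)).card := by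
  refine Finset.card_le_card_of_injOn (fun b => bitCode (bitSeq b) n) ?_ ?_
  · intro b hb
    have := (Finset.mem_filter.1 hb).2
    rw [threshold_eq] at this
    exact Finset.mem_filter.2 ⟨Finset.mem_range.2 (bitCode_lt _ _), this⟩
  · intro b _ b' _ h
    funext j
    have := bitCode_inj h j j.2
    simpa [bitSeq] using this

/-- Grid points above `y` have index `j` with `(1 + y) 2 ^ n / 2 < j < 2 ^ n`. No rounding term
appears since the right end `1` is not on the grid. -/
theorem card_threshold_gt_le (y : ℝ) :
    ((Finset.univ.filter fun b : Fin n → Bool => y < (threshold (bitSeq b) n : ℝ)).card : ℝ) ≤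
      2 ^ n * (|1 - y| / 2) := by
  classical
  have h1 := card_threshold_le (n := n) (fun q => y < (q : ℝ))
  have hN : (0 : ℝ) < 2 ^ n := by positivity
  set Y : ℝ := (1 + y) / 2 * 2 ^ n with hY
  have h2 : ((Finset.range (2 ^ n)).filter fun j : ℕ => y < (((-1 + 2 * j / 2 ^ n : ℚ)) : ℝ)) ⊆
      Finset.Ico (⌊Y⌋₊ + if 0 ≤ Y then 1 else 0) (2 ^ n) := by
    intro j hj
    obtain ⟨h3, h4⟩ := Finset.mem_filter.1 hj
    push_cast at h4
    have h5 : Y < j := by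
      have : (1 + y) / 2 < j / 2 ^ n := by
        have : (2 * (j : ℝ) / 2 ^ n) = 2 * (j / 2 ^ n) := by ring
        linarith
      rwa [lt_div_iff₀ hN] at this
    rw [Finset.mem_Ico]
    refine ⟨?_, Finset.mem_range.1 h3⟩
    split_ifs with h0
    · exact (Nat.floor_lt h0).2 h5
    · rw [Nat.floor_of_nonpos (not_le.1 h0).le]; omega
  have h3 := h1.trans (Finset.card_le_card h2)
  rw [Nat.card_Ico] at h3
  have h4 : 2 ^ n * ((1 - y) / 2) = 2 ^ n - Y := by rw [hY]; ring
  have h5 : 2 ^ n - Y ≤ 2 ^ n * (|1 - y| / 2) := by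
    rw [← h4]; gcongr; exact le_abs_self _
  have h6 : (0 : ℝ) ≤ 2 ^ n * (|1 - y| / 2) := by positivity
  have h7 := (Nat.cast_le (α := ℝ)).2 h3
  rcases le_total (⌊Y⌋₊ + if 0 ≤ Y then 1 else 0) (2 ^ n) with h | h
  · rw [Nat.cast_sub h] at h7
    push_cast at h7
    split_ifs at h7 with h0
    · have := Nat.lt_floor_add_one Y
      linarith
    · rw [Nat.floor_of_nonpos (not_le.1 h0).le] at h7
      push_cast at h7
      linarith [not_le.1 h0]
  · rw [Nat.sub_eq_zero_of_le h] at h7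
    push_cast at h7
    linarith

/-- Here the additional `1` is needed: the left end `-1` belongs to the grid, so one point remains
even for `y = -1`. -/
theorem card_threshold_le_le (y : ℝ) :
    ((Finset.univ.filter fun b : Fin n → Bool => (threshold (bitSeq b) n : ℝ) ≤ y).card : ℝ) ≤
      2 ^ n * (|-1 - y| / 2) + 1 := by
  classical
  have h1 := card_threshold_le (n := n) (fun q => (q : ℝ) ≤ y)
  have hN : (0 : ℝ) < 2 ^ n := by positivity
  set Y : ℝ := (1 + y) / 2 * 2 ^ n with hY
  have h2 : ((Finset.range (2 ^ n)).filter fun j : ℕ => (((-1 + 2 * j / 2 ^ n : ℚ)) : ℝ) ≤ y) ⊆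
      Finset.range (⌊Y⌋₊ + 1) := by
    intro j hj
    obtain ⟨h3, h4⟩ := Finset.mem_filter.1 hj
    push_cast at h4
    have h5 : j ≤ Y := by
      have : j / 2 ^ n ≤ (1 + y) / 2 := by
        have : (2 * (j : ℝ) / 2 ^ n) = 2 * (j / 2 ^ n) := by ring
        linarith
      rwa [div_le_iff₀ hN] at this
    rw [Finset.mem_range]
    have := Nat.le_floor h5
    omega
  have h3 := h1.trans (Finset.card_le_card h2)
  rw [Finset.card_range] at h3
  have h7 := (Nat.cast_le (α := ℝ)).2 h3
  push_cast at h7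
  have h8 : 2 ^ n * (|-1 - y| / 2) = |Y| := by
    rw [hY, abs_mul, abs_of_pos hN, abs_div, abs_of_pos (by norm_num : (0 : ℝ) < 2),
      show -1 - y = -(1 + y) by ring, abs_neg, mul_comm]
  rw [h8]
  have h9 : (⌊Y⌋₊ : ℝ) ≤ |Y| := by
    rcases le_total 0 Y with h | h
    · exact (Nat.floor_le h).trans (le_abs_self _)
    · rw [Nat.floor_of_nonpos h]; simp
  linarith

/-! ### The error of a random threshold -/

/-- The error of `sgn (g - θ)` on the slice of weight `r`. -/
noncomputable def sliceError (f : Cube n → ℤˣ) (r : ℕ) (g : List (List ℚ × ℚ)) (θ : ℚ) : ℝ :=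
  condMean (fun x => decide (weight x = r)) (fun x => if (f x : ℤ) = signOf r g θ x then 0 else 1)

/-- For `f(x) = 1` the sign is wrong when `g(x) < θ`, for `f(x) = -1` when `θ ≤ g(x)`. Both sets of
thresholds have relative length at most `|f(x) - g(x)| / 2`, also when `g(x)` lies outside `[-1,
1]`. -/
theorem sum_sign_ne_le (f : Cube n → ℤˣ) (r : ℕ) (g : List (List ℚ × ℚ)) (x : Cube n) :
    ∑ b : Fin n → Bool,
      (((if (f x : ℤ) = signOf r g (threshold (bitSeq b) n) x then 0 else 1 : ℤ)) : ℝ) ≤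
      2 ^ n * (|toReal f x - (combList n r g (pointList x) : ℚ)| / 2) + 1 := by
  have e : ∀ b : Fin n → Bool,
      (((if (f x : ℤ) = signOf r g (threshold (bitSeq b) n) x then 0 else 1 : ℤ)) : ℝ) =
      if (f x : ℤ) ≠ signOf r g (threshold (bitSeq b) n) x then 1 else 0 := by
    intro b; split_ifs <;> simp_all
  simp only [e]
  rw [Finset.sum_boole]
  set y : ℚ := combList n r g (pointList x) with hy
  have hs : ∀ θ : ℚ, (0 ≤ y - θ) ↔ ((θ : ℝ) ≤ (y : ℝ)) := by
    intro θ; rw [sub_nonneg]; norm_cast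
  rcases Int.units_eq_one_or (f x) with h | h
  · have h1 := card_threshold_gt_le (n := n) (y : ℝ)
    have h2 : toReal f x = 1 := by simp [toReal, h]
    rw [h2]
    refine le_trans (le_of_eq ?_) (h1.trans (by linarith))
    congr 2
    ext b
    simp only [signOf, h, ← hy, hs, Finset.mem_filter, Finset.mem_univ, true_and, ← not_le]
    split_ifs with h3 <;> simp [h3]
  · have h1 := card_threshold_le_le (n := n) (y : ℝ)
    have h2 : toReal f x = -1 := by simp [toReal, h]
    rw [h2]
    refine le_trans (le_of_eq ?_) h1
    congr 2
    ext b
    simp only [signOf, h, ← hy, hs, Finset.mem_filter, Finset.mem_univ, true_and]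
    split_ifs with h3 <;> simp [h3]

/-- Averaging over the slice, with `|u| / 2 ≤ 5 u² / 16 + 1 / 5` in place of Cauchy-Schwarz: `63 /
100 · 5 / 16 + 1 / 5 + 1 / 512 < 2 / 5`, where `n ≥ 9` pays for the rounding of the grid. -/
theorem sum_sliceError_le {f : Cube n → ℤˣ} {r : ℕ} (hr : r ≤ n) {g : List (List ℚ × ℚ)} (hn : 9 ≤ n)
    (h : sliceInner r (fun x => toReal f x - (combList n r g (pointList x) : ℚ))
      (fun x => toReal f x - (combList n r g (pointList x) : ℚ)) ≤ 63 / 100) :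
    ∑ b : Fin n → Bool, sliceError f r g (threshold (bitSeq b) n) ≤ 2 / 5 * 2 ^ n := by
  have hc : (0 : ℝ) < (slice n r).card := by rw [card_slice]; exact_mod_cast Nat.choose_pos hr
  have hN : (512 : ℝ) ≤ 2 ^ n := by
    calc (512 : ℝ) = 2 ^ 9 := by norm_num
      _ ≤ 2 ^ n := pow_le_pow_right₀ (by norm_num) hn
  unfold sliceError
  simp only [condMean_slice]
  rw [← Finset.sum_div, Finset.sum_comm, div_le_iff₀ hc]
  unfold sliceInner at h
  rw [div_le_iff₀ hc] at h
  have key : ∀ x ∈ slice n r, ∑ b : Fin n → Bool,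
      (((if (f x : ℤ) = signOf r g (threshold (bitSeq b) n) x then 0 else 1 : ℤ)) : ℝ) ≤
      2 ^ n * ((toReal f x - (combList n r g (pointList x) : ℚ)) *
        (toReal f x - (combList n r g (pointList x) : ℚ)) * (5 / 16) + 1 / 5) + 1 := by
    intro x _
    refine (sum_sign_ne_le f r g x).trans ?_
    set u := toReal f x - (combList n r g (pointList x) : ℚ)
    gcongr
    rw [← abs_mul_abs_self u]
    -- The tangent at `|u| = 4 / 5`, close to the root of `63 / 100`, where it loses almost nothing.
    nlinarith [sq_nonneg (|u| - 4 / 5)]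
  refine (Finset.sum_le_sum key).trans ?_
  rw [Finset.sum_add_distrib, ← Finset.mul_sum, Finset.sum_add_distrib, ← Finset.sum_mul]
  simp only [Finset.sum_const, nsmul_eq_mul]
  set A := ∑ x ∈ slice n r, (toReal f x - (combList n r g (pointList x) : ℚ)) *
        (toReal f x - (combList n r g (pointList x) : ℚ))
  have h1 : (2 : ℝ) ^ n * A ≤ 2 ^ n * (63 / 100 * (slice n r).card) := by gcongr
  have h2 : (512 : ℝ) * (slice n r).card ≤ 2 ^ n * (slice n r).card := by gcongr
  nlinarith

/-- Markov's inequality: `(2 / 5) / (43 / 100) < 47 / 50`. The value `43 / 100` is just below `√3 /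
4`, which leaves room for the error of estimation. -/
theorem card_sliceError_gt_le {f : Cube n → ℤˣ} {r : ℕ} (hr : r ≤ n) {g : List (List ℚ × ℚ)}
    (hn : 9 ≤ n)
    (h : sliceInner r (fun x => toReal f x - (combList n r g (pointList x) : ℚ))
      (fun x => toReal f x - (combList n r g (pointList x) : ℚ)) ≤ 63 / 100) :
    ((Finset.univ.filter fun b : Fin n → Bool =>
      43 / 100 < sliceError f r g (threshold (bitSeq b) n)).card : ℝ) ≤ 47 / 50 * 2 ^ n := by
  have h1 := sum_sliceError_le hr hn h
  have h0 : ∀ θ, 0 ≤ sliceError f r g θ := by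
    intro θ
    unfold sliceError condMean
    refine div_nonneg (Finset.sum_nonneg fun x _ => ?_) (by positivity)
    dsimp only
    split_ifs <;> simp
  have h2 : ((Finset.univ.filter fun b : Fin n → Bool =>
      43 / 100 < sliceError f r g (threshold (bitSeq b) n)).card : ℝ) * (43 / 100) ≤
      ∑ b : Fin n → Bool, sliceError f r g (threshold (bitSeq b) n) := by
    rw [← nsmul_eq_mul]
    refine (Finset.card_nsmul_le_sum _ _ _ fun b hb => (Finset.mem_filter.1 hb).2.le).trans ?_
    exact Finset.sum_le_sum_of_subset_of_nonneg (Finset.filter_subset _ _) fun b _ _ => h0 _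
  have : (0 : ℝ) < 2 ^ n := by positivity
  linarith

/-! ### Independent blocks of random bits -/

theorem seqMeasure_block_le (S : Finset (Fin n → Bool)) (e : ℕ) :
    seqMeasure Bool {c | (fun j : Fin n => c (e + j)) ∈ S} ≤ ENNReal.ofReal (S.card / 2 ^ n) := by
  have hsub : {c : ℕ → Bool | (fun j : Fin n => c (e + j)) ∈ S} ⊆
      ⋃ b ∈ S, Set.pi (Finset.Ico e (e + n) : Finset ℕ) fun i => {bitSeq b (i - e)} := by
    intro c hc
    refine Set.mem_iUnion₂.2 ⟨_, hc, ?_⟩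
    intro i hi
    have hi' := Finset.mem_Ico.1 (Finset.mem_coe.1 hi)
    simp only [Set.mem_singleton_iff, bitSeq, show i - e < n by omega, dif_pos]
    congr 1; omega
  refine (measure_mono hsub).trans ((measure_biUnion_finset_le _ _).trans ?_)
  have : ∀ b ∈ S, seqMeasure Bool
      (Set.pi (Finset.Ico e (e + n) : Finset ℕ) fun i => {bitSeq b (i - e)}) = (2 ^ n)⁻¹ := by
    intro b _
    unfold seqMeasure
    rw [Measure.infinitePi_pi _ (fun i _ => measurableSet_singleton _)]
    simp only [PMF.toMeasure_apply_singleton _ _ (measurableSet_singleton _),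
      PMF.uniformOfFintype_apply, Fintype.card_bool, Finset.prod_const, Nat.card_Ico]
    rw [Nat.add_sub_cancel_left, ENNReal.inv_pow]; rfl
  rw [Finset.sum_congr rfl this, Finset.sum_const, nsmul_eq_mul, ENNReal.ofReal_div_of_pos (by positivity),
    ENNReal.ofReal_natCast, ENNReal.ofReal_pow (by norm_num), div_eq_mul_inv]
  simp

/-- Events that depend on disjoint finite ranges of bits are independent; depending on finitely many
bits also makes them measurable. -/
theorem seqMeasure_inter_eq {A B : Set (ℕ → Bool)} {e N : ℕ}
    (hA : ∀ ω ω' : ℕ → Bool, (∀ i < e, ω i = ω' i) → ω ∈ A → ω' ∈ A)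
    (hB : ∀ ω ω' : ℕ → Bool, (∀ i, e ≤ i → i < N → ω i = ω' i) → ω ∈ B → ω' ∈ B) :
    seqMeasure Bool (A ∩ B) = seqMeasure Bool A * seqMeasure Bool B := by
  classical
  have hST : Disjoint (Finset.range e) (Finset.Ico e N) := by
    rw [Finset.disjoint_left]
    intro i h1 h2
    simp only [Finset.mem_range, Finset.mem_Ico] at h1 h2
    omega
  have e1 : A = (fun (ω : ℕ → Bool) (i : Finset.range e) => ω i) ⁻¹' {u | extend _ u ∈ A} := by
    ext ω
    have h : ∀ i < e, extend (Finset.range e) (fun i : Finset.range e => ω i) i = ω i :=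
      fun i hi => extend_apply ω (Finset.mem_range.2 hi)
    exact ⟨hA _ _ fun i hi => (h i hi).symm, hA _ _ h⟩
  have e2 : B = (fun (ω : ℕ → Bool) (i : Finset.Ico e N) => ω i) ⁻¹' {u | extend _ u ∈ B} := by
    ext ω
    have h : ∀ i, e ≤ i → i < N → extend (Finset.Ico e N) (fun i : Finset.Ico e N => ω i) i = ω i :=
      fun i h1 h2 => extend_apply ω (Finset.mem_Ico.2 ⟨h1, h2⟩)
    exact ⟨hB _ _ fun i h1 h2 => (h i h1 h2).symm, hB _ _ h⟩
  rw [e1, e2]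
  exact (indepFun_seqMeasure (α := Bool) hST).measure_inter_preimage_eq_mul _ _
    (Set.toFinite _).measurableSet (Set.toFinite _).measurableSet

/-- The rounds read consecutive blocks of `n` bits, so the probability that all of them fail is
multiplicative. -/
theorem seqMeasure_forall_block_le {β : ENNReal} (P : ℚ → Prop)
    (h : ∀ e, seqMeasure Bool {c | P (threshold (fun j => c (e + j)) n)} ≤ β) (k : ℕ) :
    seqMeasure Bool {c | ∀ l < k, P (threshold (fun j => c (l * n + j)) n)} ≤ β ^ k := by
  induction k with
  | zero => simp
  | succ k ih =>
    have e1 : {c : ℕ → Bool | ∀ l < k + 1, P (threshold (fun j => c (l * n + j)) n)} =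
        {c | ∀ l < k, P (threshold (fun j => c (l * n + j)) n)} ∩
          {c | P (threshold (fun j => c (k * n + j)) n)} := by
      ext c
      simp only [Set.mem_inter_iff, Set.mem_ofPred_eq, Nat.lt_succ_iff_lt_or_eq, or_imp, forall_and,
        forall_eq]
    rw [e1, seqMeasure_inter_eq (e := k * n) (N := k * n + n), pow_succ]
    · exact mul_le_mul' ih (h _)
    · intro c c' hc hmem l hl
      have := hmem l hl
      rwa [threshold_congr (b' := fun j => c' (l * n + j))] at this
      intro j hj
      refine hc _ ?_
      have : (l + 1) * n ≤ k * n := Nat.mul_le_mul_right _ hl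
      rw [Nat.add_mul, one_mul] at this
      omega
    · intro c c' hc hmem
      rw [Set.mem_ofPred_eq] at hmem ⊢
      rwa [threshold_congr (b' := fun j => c' (k * n + j))] at hmem
      intro j hj
      exact hc _ (by omega) (by omega)

/-- For a fixed combination `g` close to `f` each round misses with probability at most `47 / 50`.
-/
theorem seqMeasure_no_good_threshold_le {f : Cube n → ℤˣ} {r : ℕ} (hr : r ≤ n)
    {g : List (List ℚ × ℚ)} (hn : 9 ≤ n)
    (h : sliceInner r (fun x => toReal f x - (combList n r g (pointList x) : ℚ))
      (fun x => toReal f x - (combList n r g (pointList x) : ℚ)) ≤ 63 / 100) (k : ℕ) :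
    seqMeasure Bool {c | ∀ l < k, 43 / 100 < sliceError f r g (threshold (fun j => c (l * n + j)) n)} ≤
      ENNReal.ofReal ((47 / 50) ^ k) := by
  rw [ENNReal.ofReal_pow (by norm_num)]
  refine seqMeasure_forall_block_le (fun θ => 43 / 100 < sliceError f r g θ) (fun e => ?_) k
  have h1 := seqMeasure_block_le (Finset.univ.filter fun b : Fin n → Bool =>
      43 / 100 < sliceError f r g (threshold (bitSeq b) n)) e
  refine le_trans (measure_mono ?_) (h1.trans (ENNReal.ofReal_le_ofReal ?_))
  · intro c hc
    rw [Set.mem_ofPred_eq] at hc ⊢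
    rw [Finset.mem_filter]
    refine ⟨Finset.mem_univ _, ?_⟩
    rwa [threshold_congr (b' := fun j => c (e + j))]
    intro j hj
    simp [bitSeq, hj]
  · rw [div_le_iff₀ (by positivity)]
    exact card_sliceError_gt_le hr hn h

end Coins

/-! ## The random choices of the learner -/

section Tapes

variable {n : ℕ}

theorem tapeMeasure_eq : tapeMeasure n = (seqMeasure (Cube n)).prod (seqMeasure Bool) := rfl

/-- An event that depends on finitely many draws is the preimage of a subset of a finite set. This
justifies the use of Fubini for the events below. -/
theorem measurableSet_tape {A : Set (Tape n)} (N : ℕ) (hA : ∀ ω ω' : Tape n,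
    (∀ i < N, ω.1 i = ω'.1 i) → (∀ i < N, ω.2 i = ω'.2 i) → ω ∈ A → ω' ∈ A) : MeasurableSet A := by
  classical
  have e : A = (fun ω : Tape n => ((fun i : Finset.range N => ω.1 i), fun i : Finset.range N => ω.2 i)) ⁻¹'
      {u | (extend _ u.1, extend _ u.2) ∈ A} := by
    ext ω
    have h1 : ∀ i < N, extend (Finset.range N) (fun i : Finset.range N => ω.1 i) i = ω.1 i :=
      fun i hi => extend_apply ω.1 (Finset.mem_range.2 hi)
    have h2 : ∀ i < N, extend (Finset.range N) (fun i : Finset.range N => ω.2 i) i = ω.2 i :=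
      fun i hi => extend_apply ω.2 (Finset.mem_range.2 hi)
    exact ⟨hA _ _ (fun i hi => (h1 i hi).symm) (fun i hi => (h2 i hi).symm), hA _ _ h1 h2⟩
  rw [e]
  refine measurableSet_preimage (Measurable.prodMk ?_ ?_) (Set.toFinite _).measurableSet
  · exact measurable_pi_lambda _ fun i => (measurable_pi_apply _).comp measurable_fst
  · exact measurable_pi_lambda _ fun i => (measurable_pi_apply _).comp measurable_snd

theorem tapeMeasure_le_of_examples {A : Set (Tape n)} (hA : MeasurableSet A) {β : ENNReal}
    (h : ∀ c, seqMeasure (Cube n) {y | (y, c) ∈ A} ≤ β) : tapeMeasure n A ≤ β := by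
  rw [tapeMeasure_eq, Measure.prod_apply_symm hA]
  calc _ ≤ ∫⁻ _, β ∂(seqMeasure Bool) := lintegral_mono h
    _ = β := by simp

theorem tapeMeasure_le_of_coins {A : Set (Tape n)} (hA : MeasurableSet A) {β : ENNReal}
    (h : ∀ y, seqMeasure Bool {c | (y, c) ∈ A} ≤ β) : tapeMeasure n A ≤ β := by
  rw [tapeMeasure_eq, Measure.prod_apply hA]
  calc _ ≤ ∫⁻ _, β ∂(seqMeasure (Cube n)) := lintegral_mono h
    _ = β := by simp

end Tapes

end SliceLearner


namespace SliceLearner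

open MeasureTheory ProbabilityTheory

/-! ## The estimates are accurate with high probability -/

section Accuracy

variable {n D m r s : ℕ} {f : Cube n → ℤˣ}

theorem avgOf_congr {y y' : ℕ → Cube n} (h : ∀ i < m, y i = y' i) (K : Cube n → Bool)
    (v : Cube n → ℤ) : avgOf y K v m = avgOf y' K v m := by
  unfold avgOf
  congr 2 <;> exact Finset.sum_congr rfl fun i hi => by rw [h i (Finset.mem_range.1 hi)]

theorem innerAt_congr {ω ω' : Tape n} {i : ℕ} (h : ∀ j < s + i * m + m, ω.1 j = ω'.1 j) :
    innerAt f ω D m r s i = innerAt f ω' D m r s i := by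
  unfold innerAt innerEst
  exact avgOf_congr (fun j hj => h _ (by omega)) _ _

theorem combAt_congr {ω ω' : Tape n}
    (h : ∀ j < s + (topSeqs n (D + 1)).length * m, ω.1 j = ω'.1 j) :
    combAt f ω D m r s = combAt f ω' D m r s := by
  unfold combAt
  congr 1
  refine List.map_congr_left fun i hi => ?_
  have hi' := List.mem_range.1 hi
  have : (i + 1) * m ≤ (topSeqs n (D + 1)).length * m := Nat.mul_le_mul_right _ hi'
  rw [Nat.add_mul, one_mul] at this
  rw [coefAt, coefAt, innerAt_congr (ω' := ω') fun j hj => h j (by omega)]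

theorem roundThreshold_congr {ω ω' : Tape n} {c l : ℕ} (h : ∀ j < c + l * n + n, ω.2 j = ω'.2 j) :
    roundThreshold ω c l = roundThreshold ω' c l :=
  threshold_congr fun j hj => h _ (by omega)

theorem card_filter_weight (r : ℕ) :
    (Finset.univ.filter fun x : Cube n => decide (weight x = r) = true).card = n.choose r := by
  rw [← card_slice]; simp [slice]

theorem card_filter_weight_ne (r : ℕ) :
    ((Finset.univ.filter fun x : Cube n => (!decide (weight x = r)) = true).card : ℝ) =
      2 ^ n - n.choose r := by
  have h := Finset.card_filter_add_card_filter_not (s := (Finset.univ : Finset (Cube n)))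
    (fun x => decide (weight x = r) = true)
  rw [card_filter_weight] at h
  have h2 : (Finset.univ : Finset (Cube n)).card = 2 ^ n := by simp
  rw [h2] at h
  have h3 : ((n.choose r : ℕ) : ℝ) + ((Finset.univ.filter fun x : Cube n =>
      ¬ decide (weight x = r) = true).card : ℝ) = 2 ^ n := by exact_mod_cast h
  rw [← h3]
  simp

theorem tapeMeasure_inner_le {κ ε : ℝ} (hκ : 0 < κ) (hκr : κ * 2 ^ n ≤ n.choose r) (hε : 0 < ε)
    (hm : 0 < m) (hn : 1 ≤ n) {i : ℕ} (hi : i < (topSeqs n (D + 1)).length) :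
    tapeMeasure n {ω | ε < |(innerAt f ω D m r s i : ℝ) -
      condMean (fun x => decide (weight x = r)) (fun x => (f x : ℤ) *
        (basisList n r ((topSeqs n (D + 1)).getD i []) (pointList x)).num)|} ≤
      ENNReal.ofReal ((16 * ((n : ℝ) ^ D) ^ 2 / ε ^ 2 + 4) / (m * κ)) := by
  refine tapeMeasure_le_of_examples (measurableSet_tape (s + i * m + m) ?_) fun c => ?_
  · intro ω ω' h _ hmem
    rw [Set.mem_ofPred_eq] at hmem ⊢
    rwa [← innerAt_congr h]
  · simp only [innerAt, innerEst, Set.mem_ofPred_eq]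
    refine seqMeasure_avgOf_le hκ (by rw [card_filter_weight]; exact hκr) (fun x _ => ?_) hε (s + i * m) hm
    have h1 := (basisList_num (n := n) (r := r) (B := (topSeqs n (D + 1)).getD i [])
      (isBits_pointList x)).2
    have h2 := (isShort_of_mem (getD_mem_topSeqs hi)).2
    have h3 := h1.trans (Nat.pow_le_pow_right hn h2)
    have h4 : ((f x : ℤ) * (basisList n r ((topSeqs n (D + 1)).getD i []) (pointList x)).num).natAbs ≤
        n ^ D := by
      rw [Int.natAbs_mul, natAbs_units, one_mul]; exact h3
    rw [← Int.cast_abs, Int.abs_eq_natAbs]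
    exact_mod_cast h4

/-- With the bits frozen, the threshold is fixed and `g` depends only on examples before the block
of round `l`; `seqMeasure_adaptive_le` then allows `g` to be treated as fixed. -/
theorem tapeMeasure_round_le {κ ε : ℝ} (hκ : 0 < κ) (hκr : κ * 2 ^ n ≤ n.choose r) (hε : 0 < ε)
    (hm : 0 < m) {e : ℕ} (he : s + (topSeqs n (D + 1)).length * m = e) (l : ℕ) :
    tapeMeasure n {ω | ε < |(roundError f ω r (combAt f ω D m r s) m e 0 l : ℝ) -
      sliceError f r (combAt f ω D m r s) (roundThreshold ω 0 l)|} ≤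
      ENNReal.ofReal ((16 * 1 ^ 2 / ε ^ 2 + 4) / (m * κ)) := by
  refine tapeMeasure_le_of_examples (measurableSet_tape (e + l * m + m + (0 + l * n + n)) ?_) fun c => ?_
  · intro ω ω' h1 h2 hmem
    rw [Set.mem_ofPred_eq] at hmem ⊢
    rw [roundError] at hmem ⊢
    rw [← combAt_congr (ω := ω) fun j hj => h1 j (by omega),
      ← roundThreshold_congr (ω := ω) fun j hj => h2 j (by omega)]
    unfold errorEst at hmem ⊢
    rwa [← avgOf_congr (y := fun i => ω.1 (e + l * m + i)) fun j hj => h1 _ (by omega)]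
  · set θ := threshold (fun j => c (0 + l * n + j)) n
    have hmeas := seqMeasure_adaptive_le (α := Cube n) (e := e + l * m) (N := e + l * m + m)
      (G := fun y => combAt f ((y, c) : Tape n) D m r s)
      (A := fun g => {y | ε < |(errorEst f r g θ (fun i => y (e + l * m + i)) m : ℝ) -
        sliceError f r g θ|})
      (β := ENNReal.ofReal ((16 * 1 ^ 2 / ε ^ 2 + 4) / (m * κ))) ?_ ?_ ?_
    · exact hmeas
    · intro y y' h
      exact combAt_congr fun j hj => h j (by omega)
    · intro g y y' h hmem
      rw [Set.mem_ofPred_eq] at hmem ⊢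
      unfold errorEst at hmem ⊢
      rwa [← avgOf_congr (y := fun i => y (e + l * m + i)) fun j hj => h _ (by omega) (by omega)]
    · intro y
      refine seqMeasure_avgOf_le hκ (by rw [card_filter_weight]; exact hκr) (fun x _ => ?_) hε _ hm
      split_ifs <;> simp

theorem tapeMeasure_off_le {κ ε : ℝ} (hκ : 0 < κ) (hκr : κ * 2 ^ n ≤ 2 ^ n - n.choose r)
    (hε : 0 < ε) (hm : 0 < m) (e : ℕ) :
    tapeMeasure n {ω | ε < |(offEst f r (fun i => ω.1 (e + i)) m : ℝ) -
      condMean (fun x => !decide (weight x = r)) (fun x => (f x : ℤ))|} ≤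
      ENNReal.ofReal ((16 * 1 ^ 2 / ε ^ 2 + 4) / (m * κ)) := by
  refine tapeMeasure_le_of_examples (measurableSet_tape (e + m) ?_) fun c => ?_
  · intro ω ω' h1 _ hmem
    rw [Set.mem_ofPred_eq] at hmem ⊢
    unfold offEst at hmem ⊢
    rwa [← avgOf_congr (y := fun i => ω.1 (e + i)) fun j hj => h1 _ (by omega)]
  · refine seqMeasure_avgOf_le hκ (by rw [card_filter_weight_ne r]; exact hκr) (fun x _ => ?_) hε e hm
    rcases Int.units_eq_one_or (f x) with h | h <;> simp [h]

/-- Examples and bits are independent, and `g` depends on the examples only. With the examples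
frozen this is the bound for a fixed `g`. -/
theorem tapeMeasure_threshold_le (hr : r ≤ n) (hn : 9 ≤ n) :
    tapeMeasure n {ω |
      sliceInner r (fun x => toReal f x - (combList n r (combAt f ω D m r s) (pointList x) : ℚ))
        (fun x => toReal f x - (combList n r (combAt f ω D m r s) (pointList x) : ℚ)) ≤ 63 / 100 ∧
      ∀ l < n, 43 / 100 < sliceError f r (combAt f ω D m r s) (roundThreshold ω 0 l)} ≤
      ENNReal.ofReal ((47 / 50) ^ n) := by
  refine tapeMeasure_le_of_coins (measurableSet_tape
    (s + (topSeqs n (D + 1)).length * m + (n * n)) ?_) fun y => ?_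
  · intro ω ω' h1 h2 hmem
    rw [Set.mem_ofPred_eq] at hmem ⊢
    rw [← combAt_congr (ω := ω) fun j hj => h1 j (by omega)]
    refine ⟨hmem.1, fun l hl => ?_⟩
    rw [← roundThreshold_congr (ω := ω)]
    · exact hmem.2 l hl
    · intro j hj
      have : (l + 1) * n ≤ n * n := Nat.mul_le_mul_right _ hl
      rw [Nat.add_mul, one_mul] at this
      exact h2 j (by omega)
  · by_cases h : sliceInner r
        (fun x => toReal f x - (combList n r (combAt f ((y, fun _ => true) : Tape n) D m r s)
          (pointList x) : ℚ))
        (fun x => toReal f x - (combList n r (combAt f ((y, fun _ => true) : Tape n) D m r s)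
          (pointList x) : ℚ)) ≤ 63 / 100
    · refine le_trans (measure_mono ?_) (seqMeasure_no_good_threshold_le hr hn h n)
      rintro c ⟨-, hc⟩ l hl
      have := hc l hl
      simp only [roundThreshold, zero_add] at this
      exact this
    · have : {c | (y, c) ∈ {ω : Tape n |
        sliceInner r (fun x => toReal f x - (combList n r (combAt f ω D m r s) (pointList x) : ℚ))
        (fun x => toReal f x - (combList n r (combAt f ω D m r s) (pointList x) : ℚ)) ≤ 63 / 100 ∧
        ∀ l < n, 43 / 100 < sliceError f r (combAt f ω D m r s) (roundThreshold ω 0 l)}} = ∅ := by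
        ext c
        simp only [Set.mem_empty_iff_false, iff_false]
        exact fun hc => h hc.1
      rw [this]; simp

/-- All estimates on the slice of weight `r` are accurate, and a good threshold turns up. -/
structure IsGoodOn (f : Cube n → ℤˣ) (ω : Tape n) (D m s r : ℕ) : Prop where
  inner : InnerAccurate f ω D m r s (1 / (n : ℝ) ^ (6 * D))
  found :
    sliceInner r (fun x => toReal f x - (combList n r (combAt f ω D m r s) (pointList x) : ℚ))
      (fun x => toReal f x - (combList n r (combAt f ω D m r s) (pointList x) : ℚ)) ≤ 63 / 100 →
    ∃ l < n, sliceError f r (combAt f ω D m r s) (roundThreshold ω 0 l) ≤ 43 / 100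
  round : ∀ l < n, |(roundError f ω r (combAt f ω D m r s) m (s + (topSeqs n (D + 1)).length * m) 0 l : ℝ) -
      sliceError f r (combAt f ω D m r s) (roundThreshold ω 0 l)| ≤ 1 / 1000
  off : ∀ k < n, |(offEst f r (fun i => ω.1 (s + (topSeqs n (D + 1)).length * m + (k + 1) * m + i)) m : ℝ) -
      condMean (fun x => !decide (weight x = r)) (fun x => (f x : ℤ))| ≤ n.choose r / 2 ^ n / 10

/-- A union bound over the inner products, the search, the errors of the first `n` rounds and the
estimates off the slice. The power `14 D` is `V² / ε²` for `V = n ^ D` and `ε = n ^ (-6 D)`. The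
last kind is needed for every `k < n`, since the examples used for it depend on the round in which
the search stops. -/
theorem tapeMeasure_not_isGoodOn_le {κ : ℝ} (hκ : 0 < κ) (hr : r ≤ n) (hκr : κ * 2 ^ n ≤ n.choose r)
    (hκr' : κ * 2 ^ n ≤ 2 ^ n - n.choose r) (hm : 0 < m) (hn : 9 ≤ n) :
    tapeMeasure n {ω | ¬ IsGoodOn f ω D m s r} ≤ ENNReal.ofReal
      ((topSeqs n (D + 1)).length * ((16 * (n : ℝ) ^ (14 * D) + 4) / (m * κ)) + (47 / 50) ^ n +
        n * (16000004 / (m * κ)) + n * ((1600 / κ ^ 2 + 4) / (m * κ))) := by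
  set T := (topSeqs n (D + 1)).length with hT
  have hn0 : (0 : ℝ) < n := by exact_mod_cast (by omega : 0 < n)
  have hm0 : (0 : ℝ) < m := by exact_mod_cast hm
  have hw : κ ≤ n.choose r / 2 ^ n := by rw [le_div_iff₀ (by positivity)]; exact hκr
  set B1 : ℕ → Set (Tape n) := fun i => {ω | 1 / (n : ℝ) ^ (6 * D) < |(innerAt f ω D m r s i : ℝ) -
      condMean (fun x => decide (weight x = r)) (fun x => (f x : ℤ) *
        (basisList n r ((topSeqs n (D + 1)).getD i []) (pointList x)).num)|} with hB1
  set B2 : Set (Tape n) := {ω |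
      sliceInner r (fun x => toReal f x - (combList n r (combAt f ω D m r s) (pointList x) : ℚ))
        (fun x => toReal f x - (combList n r (combAt f ω D m r s) (pointList x) : ℚ)) ≤ 63 / 100 ∧
      ∀ l < n, 43 / 100 < sliceError f r (combAt f ω D m r s) (roundThreshold ω 0 l)} with hB2
  set B3 : ℕ → Set (Tape n) := fun l => {ω | 1 / 1000 <
      |(roundError f ω r (combAt f ω D m r s) m (s + T * m) 0 l : ℝ) -
      sliceError f r (combAt f ω D m r s) (roundThreshold ω 0 l)|} with hB3
  set B4 : ℕ → Set (Tape n) := fun k => {ω | n.choose r / 2 ^ n / 10 <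
      |(offEst f r (fun i => ω.1 (s + T * m + (k + 1) * m + i)) m : ℝ) -
      condMean (fun x => !decide (weight x = r)) (fun x => (f x : ℤ))|} with hB4
  have hsub : {ω | ¬ IsGoodOn f ω D m s r} ⊆ (⋃ i ∈ Finset.range T, B1 i) ∪ B2 ∪
      (⋃ l ∈ Finset.range n, B3 l) ∪ (⋃ k ∈ Finset.range n, B4 k) := by
    intro ω hω
    by_contra hcon
    simp only [Set.mem_union, Set.mem_iUnion, not_or, not_exists, Finset.mem_range] at hcon
    obtain ⟨⟨⟨h1, h2⟩, h3⟩, h4⟩ := hcon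
    refine hω ⟨fun i hi => not_lt.1 (h1 i hi), fun h => ?_, fun l hl => not_lt.1 (h3 l hl),
      fun k hk => not_lt.1 (h4 k hk)⟩
    by_contra hc
    push Not at hc
    exact h2 ⟨h, hc⟩
  have b1 : ∀ i ∈ Finset.range T, tapeMeasure n (B1 i) ≤
      ENNReal.ofReal ((16 * (n : ℝ) ^ (14 * D) + 4) / (m * κ)) := by
    intro i hi
    have := tapeMeasure_inner_le (f := f) (s := s) hκ hκr (show 0 < 1 / (n : ℝ) ^ (6 * D) by positivity)
      hm (by omega) (Finset.mem_range.1 hi)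
    refine this.trans (le_of_eq ?_)
    have h14 : ((n : ℝ) ^ D) ^ 2 / (1 / (n : ℝ) ^ (6 * D)) ^ 2 = (n : ℝ) ^ (14 * D) := by
      rw [← div_pow, div_div_eq_mul_div, div_one, ← pow_add, ← pow_mul]
      congr 1; ring
    rw [mul_div_assoc, h14]
  have b3 : ∀ l ∈ Finset.range n, tapeMeasure n (B3 l) ≤ ENNReal.ofReal (16000004 / (m * κ)) := by
    intro l _
    have := tapeMeasure_round_le (f := f) (s := s) (D := D) hκ hκr
      (show (0 : ℝ) < 1 / 1000 by norm_num) hm rfl l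
    refine this.trans (le_of_eq ?_)
    norm_num
  have b4 : ∀ k ∈ Finset.range n, tapeMeasure n (B4 k) ≤
      ENNReal.ofReal ((1600 / κ ^ 2 + 4) / (m * κ)) := by
    intro k _
    have := tapeMeasure_off_le (f := f) hκ hκr'
      (show 0 < (n.choose r : ℝ) / 2 ^ n / 10 by linarith) hm (s + T * m + (k + 1) * m)
    refine this.trans (ENNReal.ofReal_le_ofReal ?_)
    have h2 : κ ^ 2 ≤ ((n.choose r : ℝ) / 2 ^ n) ^ 2 := by gcongr
    have h3 : 16 * 1 ^ 2 / ((n.choose r : ℝ) / 2 ^ n / 10) ^ 2 ≤ 1600 / κ ^ 2 := by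
      rw [div_pow _ (10 : ℝ), div_div_eq_mul_div, show (16 : ℝ) * 1 ^ 2 * 10 ^ 2 = 1600 by norm_num]
      exact div_le_div_of_nonneg_left (by norm_num) (by positivity) h2
    exact div_le_div_of_nonneg_right (by linarith) (by positivity)
  have c1 : tapeMeasure n (⋃ i ∈ Finset.range T, B1 i) ≤
      ENNReal.ofReal (T * ((16 * (n : ℝ) ^ (14 * D) + 4) / (m * κ))) := by
    refine (measure_biUnion_finset_le _ _).trans ((Finset.sum_le_card_nsmul _ _ _ b1).trans ?_)
    rw [Finset.card_range, ENNReal.ofReal_mul (by positivity), ENNReal.ofReal_natCast, nsmul_eq_mul]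
  have c3 : tapeMeasure n (⋃ l ∈ Finset.range n, B3 l) ≤ ENNReal.ofReal (n * (16000004 / (m * κ))) := by
    refine (measure_biUnion_finset_le _ _).trans ((Finset.sum_le_card_nsmul _ _ _ b3).trans ?_)
    rw [Finset.card_range, ENNReal.ofReal_mul (by positivity), ENNReal.ofReal_natCast, nsmul_eq_mul]
  have c4 : tapeMeasure n (⋃ k ∈ Finset.range n, B4 k) ≤
      ENNReal.ofReal (n * ((1600 / κ ^ 2 + 4) / (m * κ))) := by
    refine (measure_biUnion_finset_le _ _).trans ((Finset.sum_le_card_nsmul _ _ _ b4).trans ?_)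
    rw [Finset.card_range, ENNReal.ofReal_mul (by positivity), ENNReal.ofReal_natCast, nsmul_eq_mul]
  have c2 : tapeMeasure n B2 ≤ ENNReal.ofReal ((47 / 50) ^ n) := tapeMeasure_threshold_le hr hn
  rw [ENNReal.ofReal_add (by positivity) (by positivity), ENNReal.ofReal_add (by positivity) (by positivity),
    ENNReal.ofReal_add (by positivity) (by positivity)]
  refine (measure_mono hsub).trans ((measure_union_le _ _).trans (add_le_add ?_ c4))
  refine (measure_union_le _ _).trans (add_le_add ?_ c3)
  exact (measure_union_le _ _).trans (add_le_add c1 c2)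

end Accuracy

end SliceLearner


namespace SliceLearner

/-! ## The hypothesis of a good run -/

section Outcome

variable {n D m r s : ℕ} {f : Cube n → ℤˣ} {ω : Tape n}

theorem hypothesisValue_on {θ z : ℚ} {x : Cube n} (hx : weight x = r) :
    hypothesisValue (some ⟨(r : ℚ), combAt f ω D m r s, θ, z⟩) x =
      (signOf r (combAt f ω D m r s) θ x : ℝ) := by
  unfold hypothesisValue signOf
  dsimp only
  rw [hx, if_pos rfl, polyValue_eq fun p hp => mem_combAt hp]
  simp only [Rat.cast_le, sub_nonneg]
  split_ifs <;> simp

theorem hypothesisValue_off {g : List (List ℚ × ℚ)} {θ z : ℚ} {x : Cube n} (hx : weight x ≠ r) :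
    hypothesisValue (some ⟨(r : ℚ), g, θ, z⟩) x = (z : ℝ) := by
  unfold hypothesisValue
  dsimp only
  rw [if_neg]
  exact_mod_cast hx

/-- The error splits into the part on the slice and the part off it; a constant sign `z` disagrees
with `f` with probability `(1 - z E f) / 2`. -/
theorem errorProb_eq {θ z : ℚ} (hr : r ≤ n) (hz : z = 1 ∨ z = -1) (hne : (n.choose r : ℝ) < 2 ^ n) :
    errorProb f (hypothesisValue (some ⟨(r : ℚ), combAt f ω D m r s, θ, z⟩)) =
      n.choose r / 2 ^ n * sliceError f r (combAt f ω D m r s) θ +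
      (1 - n.choose r / 2 ^ n) *
        ((1 - z * condMean (fun x => !decide (weight x = r)) (fun x => (f x : ℤ))) / 2) := by
  classical
  set g := combAt f ω D m r s with hg
  have hc : (0 : ℝ) < n.choose r := by exact_mod_cast Nat.choose_pos hr
  have hN : (0 : ℝ) < 2 ^ n := by positivity
  unfold errorProb
  rw [← Finset.sum_boole]
  have hsplit : ∑ x : Cube n, (if toReal f x ≠ hypothesisValue (some ⟨(r : ℚ), g, θ, z⟩) x then (1 : ℝ)
      else 0) = (∑ x ∈ slice n r, (((if (f x : ℤ) = signOf r g θ x then 0 else 1 : ℤ)) : ℝ)) +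
      ∑ x ∈ Finset.univ.filter (fun x : Cube n => (!decide (weight x = r)) = true),
        (1 - (z : ℝ) * ((f x : ℤ) : ℝ)) / 2 := by
    rw [← Finset.sum_filter_add_sum_filter_not _ (fun x : Cube n => weight x = r)]
    congr 1
    · refine Finset.sum_congr rfl fun x hx => ?_
      rw [hg, hypothesisValue_on (Finset.mem_filter.1 hx).2, ← hg, toReal]
      simp only [ne_eq, Int.cast_inj]
      split_ifs <;> simp
    · refine Finset.sum_congr (by simp) fun x hx => ?_
      have hx' : weight x ≠ r := by simpa using (Finset.mem_filter.1 hx).2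
      rw [hypothesisValue_off hx', toReal]
      rcases Int.units_eq_one_or (f x) with h | h <;> rcases hz with h' | h' <;>
        simp only [h, h'] <;> norm_num
  rw [hsplit, sliceError, condMean_slice, card_slice, condMean, card_filter_weight_ne]
  have hoff : (2 : ℝ) ^ n - n.choose r ≠ 0 := by linarith
  rw [← Finset.sum_div, Finset.sum_sub_distrib, ← Finset.mul_sum, Finset.sum_const, nsmul_eq_mul, mul_one,
    card_filter_weight_ne]
  field_simp

/-- By Pascal's rule `C(n + 1, r)` is the sum of two different terms of the `n`-th row, whose total
is `2 ^ n`. Thus at least half of the cube is off the slice, which makes the estimate there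
reliable. -/
theorem choose_le_half {r : ℕ} (hn : 1 ≤ n) : (n.choose r : ℝ) ≤ 2 ^ n / 2 := by
  obtain ⟨n, rfl⟩ : ∃ k, n = k + 1 := ⟨n - 1, by omega⟩
  have h : (n + 1).choose r ≤ 2 ^ n := by
    cases r with
    | zero => simpa using Nat.one_le_two_pow
    | succ r =>
      rw [Nat.choose_succ_succ, ← Nat.sum_range_choose n]
      rcases lt_or_ge n (r + 1) with h | h
      · rw [Nat.choose_eq_zero_of_lt h, add_zero]
        rcases lt_or_ge n r with h' | h'
        · rw [Nat.choose_eq_zero_of_lt h']; omega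
        · exact Finset.single_le_sum (f := fun i => n.choose i) (fun _ _ => Nat.zero_le _)
            (Finset.mem_range.2 (by omega))
      · have hsub : ({r, r + 1} : Finset ℕ) ⊆ Finset.range (n + 1) := by
          intro i hi
          simp only [Finset.mem_insert, Finset.mem_singleton] at hi
          rw [Finset.mem_range]; omega
        rw [← Finset.sum_pair (f := fun i => n.choose i) (show r ≠ r + 1 by omega)]
        exact Finset.sum_le_sum_of_subset hsub
  have : ((n + 1).choose r : ℝ) ≤ 2 ^ n := by exact_mod_cast h
  rw [pow_succ]; linarith

/-- A rational bound slightly above `√3 / 4 ≈ 0.43301`. -/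
theorem cast_le_of_sq_le {p : ℚ} (h : 16 * (p * p) ≤ 3) : (p : ℝ) ≤ 434 / 1000 := by
  have : 16 * ((p : ℝ) * p) ≤ 3 := by exact_mod_cast h
  nlinarith

/-- On good random choices the learner halts with a hypothesis of small error. -/
theorem exists_runs_learner {C τ M L : ℕ} {κ : ℝ} (hp : Bounds n D m M L) (hm : m = n ^ (3 * C * D))
    (hCD : 3 * C * D + 1 ≤ M) (hD1 : 1 ≤ D) (hτ : τ ≤ M) (hn : 800 ≤ n) {r₀ : ℕ} (hr₀ : r₀ ≤ n)
    (hi₀ : IsInspected n τ r₀)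
    (hw₀ : 1 / 2 < ∑ L ∈ lowLists n D, listWeight r₀ (toReal f) L)
    (hmin : ∀ r ≤ n, IsInspected n τ r → D ≤ min r (n - r) ∧ κ * 2 ^ n ≤ n.choose r)
    (hgood : ∀ r ≤ n, IsInspected n τ r → IsGoodOn f ω D m (startAt n τ D m r) r) :
    ∃ H e₁ c₁, Runs (env f ω) L (learner (V := Ty.denote) (C : ℚ) (n : ℚ) (τ : ℚ) (D : ℚ)) 0 0 H
      e₁ c₁ (20000 * M ^ 8) ∧
      errorProb f (hypothesisValue H) ≤ 1 / 2 - 15 / 1000 * κ := by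
  classical
  have hn0 : (800 : ℝ) ≤ n := by exact_mod_cast hn
  have h4n : (4 : ℝ) / n ≤ 1 / 200 := by
    rw [div_le_div_iff₀ (by linarith) (by norm_num)]; linarith
  -- The true weight exceeds `1 / 2` and the estimate is off by at most `3 / n`, so the concentrated
  -- slice passes the test. Hence the loop stops there at the latest.
  have hS₀ : r₀ ≤ n ∧ IsInspected n τ r₀ ∧ 3 / 8 ≤ weightAt f ω D m r₀ (startAt n τ D m r₀) := by
    refine ⟨hr₀, hi₀, ?_⟩
    have h1 := (abs_le.1 (abs_weightAt_sub_le hr₀ (by omega) hD1 (hmin r₀ hr₀ hi₀).1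
      (hgood r₀ hr₀ hi₀).inner)).1
    have h2 : (3 : ℝ) / n ≤ 4 / n := by gcongr; norm_num
    have h3 : ((3 / 8 : ℚ) : ℝ) ≤ (weightAt f ω D m r₀ (startAt n τ D m r₀) : ℝ) := by
      push_cast; linarith
    exact_mod_cast h3
  have hex : ∃ r, r ≤ n ∧ IsInspected n τ r ∧ 3 / 8 ≤ weightAt f ω D m r (startAt n τ D m r) :=
    ⟨r₀, hS₀⟩
  -- The slice on which the algorithm stops may be an earlier one; from here on only its estimated
  -- weight matters.
  obtain ⟨r, ⟨hr, hi, hS⟩, hfirst⟩ : ∃ r, (r ≤ n ∧ IsInspected n τ r ∧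
      3 / 8 ≤ weightAt f ω D m r (startAt n τ D m r)) ∧ ∀ r' < r, ¬ (r' ≤ n ∧ IsInspected n τ r' ∧
      3 / 8 ≤ weightAt f ω D m r' (startAt n τ D m r')) :=
    ⟨Nat.find hex, Nat.find_spec hex, fun r' h => Nat.find_min hex h⟩
  obtain ⟨hDr, hκr⟩ := hmin r hr hi
  have hg := hgood r hr hi
  set s := startAt n τ D m r with hs
  set g := combAt f ω D m r s with hgdef
  set e₀ := s + (topSeqs n (D + 1)).length * m with he₀
  have hdist := sliceInner_sub_combAt_le hr (by omega) hD1 hDr hg.inner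
  have hSr : (3 / 8 : ℝ) ≤ weightAt f ω D m r s := by
    have : ((3 / 8 : ℚ) : ℝ) ≤ (weightAt f ω D m r s : ℝ) := by exact_mod_cast hS
    push_cast at this; exact this
  -- The squared distance is at most `1 - 3 / 8 + 4 / n ≤ 63 / 100`. The good round `l` has estimate
  -- at most `0.431`, and `16 · 0.431² < 3`, so the search stops at `l` or earlier.
  obtain ⟨l, hl, hle⟩ := hg.found (hdist.trans (by linarith))
  have hl3 : 16 * (roundError f ω r g m e₀ 0 l * roundError f ω r g m e₀ 0 l) ≤ 3 := by
    have h1 := abs_le.1 (hg.round l hl)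
    have h0 : 0 ≤ sliceError f r g (roundThreshold ω 0 l) := by
      unfold sliceError condMean
      refine div_nonneg (Finset.sum_nonneg fun x _ => ?_) (by positivity)
      dsimp only
      split_ifs <;> simp
    have h2 : 16 * ((roundError f ω r g m e₀ 0 l : ℝ) * roundError f ω r g m e₀ 0 l) ≤ 3 := by
      nlinarith [h1.1, h1.2]
    exact_mod_cast h2
  have hround : ∃ k, 16 * (roundError f ω r g m e₀ 0 k * roundError f ω r g m e₀ 0 k) ≤ 3 := ⟨l, hl3⟩
  have hkl : Nat.find hround ≤ l := Nat.find_min' hround hl3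
  set k := Nat.find hround with hk
  have hkle := Nat.find_spec hround
  have hklt : ∀ l < k, 3 < 16 * (roundError f ω r g m e₀ 0 l * roundError f ω r g m e₀ 0 l) :=
    fun l h => not_le.1 (Nat.find_min hround h)
  have hkn : k < n := by omega
  have hlt : ∀ r' < r, IsInspected n τ r' → weightAt f ω D m r' (startAt n τ D m r') < 3 / 8 :=
    fun r' h hi' => not_le.1 fun h' => hfirst r' h ⟨by omega, hi', h'⟩
  obtain ⟨e₁, c₁, hrun⟩ := runs_learner hp hm hCD hD1 hτ hr hi hS hlt
    (show k + 2 ≤ M by have := hp.n_le; omega) he₀ hgdef hklt hkle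
  refine ⟨_, e₁, c₁, hrun, ?_⟩
  set μ' := offEst f r (fun i => ω.1 (e₀ + (k + 1) * m + i)) m
  set μ := condMean (fun x => !decide (weight x = r)) (fun x => (f x : ℤ))
  have hoff : |(μ' : ℝ) - μ| ≤ n.choose r / 2 ^ n / 10 := hg.off k hkn
  have hhalf := choose_le_half (n := n) (r := r) (by omega)
  have hN : (0 : ℝ) < 2 ^ n := by positivity
  have hc0 : (0 : ℝ) < n.choose r := by exact_mod_cast Nat.choose_pos hr
  rw [errorProb_eq hr (by split_ifs <;> simp) (by linarith)]
  set w : ℝ := n.choose r / 2 ^ n with hw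
  have hκw : κ ≤ w := by rw [hw, le_div_iff₀ hN]; exact hκr
  have hw0 : 0 < w := by positivity
  have hw1 : w ≤ 1 / 2 := by rw [hw, div_le_iff₀ hN]; linarith
  have herr : sliceError f r g (roundThreshold ω 0 k) ≤ 435 / 1000 := by
    have h1 := (abs_le.1 (hg.round k hkn)).1
    have h2 := cast_le_of_sq_le hkle
    linarith
  -- If the estimate `μ'` has the wrong sign, then `|μ|` is at most its error `w / 10`.
  have hsign : -(w / 10) ≤ ((if 0 ≤ μ' then 1 else -1 : ℚ) : ℝ) * μ := by
    obtain ⟨h1, h2⟩ := abs_le.1 hoff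
    split_ifs with h
    · have : (0 : ℝ) ≤ μ' := by exact_mod_cast h
      push_cast; linarith
    · have : (μ' : ℝ) < 0 := by exact_mod_cast not_le.1 h
      push_cast; linarith
  have h1 : w * sliceError f r g (roundThreshold ω 0 k) ≤ w * (435 / 1000) := by gcongr
  have h2 : (1 - w) * ((1 - ((if 0 ≤ μ' then 1 else -1 : ℚ) : ℝ) * μ) / 2) ≤
      (1 - w) * ((1 + w / 10) / 2) := by
    gcongr
    · linarith
    · linarith
  -- The bound is `0.435 w + (1 - w)(1 + w / 10) / 2 = 1 / 2 - 0.015 w - w² / 20`.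
  nlinarith

end Outcome

end SliceLearner


namespace SliceLearner

open MeasureTheory

/-! ## Slices near the middle are large -/

section Binomial

/-- Below, `q` is at most the ratio `r / (n - r)`, and the quotients `C(n, i) / C(n, i + 1) = (i +
1) / (n - i)` increase with `i`, so each step up from `r` costs at most a factor `1 / q`. -/
theorem pow_mul_choose_le {n r : ℕ} {q : ℝ} (hq : 0 ≤ q) (h : q * (n - r) ≤ r) (j : ℕ) (hj : r + j ≤ n) :
    q ^ j * n.choose (r + j) ≤ n.choose r := by
  induction j with
  | zero => simp
  | succ j ih =>
    refine le_trans ?_ (ih (by omega))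
    rw [pow_succ, mul_assoc]
    refine mul_le_mul_of_nonneg_left ?_ (pow_nonneg hq _)
    have h1 := Nat.choose_succ_right_eq n (r + j)
    have h2 : (n.choose (r + j + 1) : ℝ) * ((r : ℝ) + j + 1) = n.choose (r + j) * ((n : ℝ) - (r + j)) := by
      have h3 : ((n - (r + j) : ℕ) : ℝ) = (n : ℝ) - (r + j) := by
        rw [Nat.cast_sub (by omega)]; push_cast; ring
      rw [← h3]; exact_mod_cast h1
    have hpos : (0 : ℝ) < (r : ℝ) + j + 1 := by positivity
    have hj0 : (0 : ℝ) ≤ j := by positivity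
    rw [← mul_le_mul_iff_left₀ hpos]
    rw [← add_assoc, mul_assoc, h2]
    have h4 : q * ((n : ℝ) - (r + j)) ≤ r + j + 1 := by nlinarith [mul_nonneg hq hj0]
    have h5 : (0 : ℝ) ≤ n.choose (r + j) := by positivity
    nlinarith [mul_le_mul_of_nonneg_left h4 h5]

theorem two_pow_le_mul_choose (n : ℕ) : (2 : ℝ) ^ n ≤ (n + 1) * n.choose (n / 2) := by
  have h : ∑ i ∈ Finset.range (n + 1), n.choose i ≤ (n + 1) * n.choose (n / 2) := by
    refine (Finset.sum_le_card_nsmul _ _ _ fun i _ => Nat.choose_le_middle i n).trans ?_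
    simp
  rw [Nat.sum_range_choose] at h
  exact_mod_cast h

/-- For `x ≤ 1 / 2` one has `1 / (1 - x) ≤ 1 + 2 x ≤ exp (2 x)`. -/
theorem exp_neg_two_mul_le {x : ℝ} (h0 : 0 ≤ x) (h1 : x ≤ 1 / 2) : Real.exp (-(2 * x)) ≤ 1 - x := by
  rw [Real.exp_neg, inv_le_comm₀ (Real.exp_pos _) (by linarith)]
  refine le_trans ?_ (Real.add_one_le_exp _)
  rw [inv_le_iff_one_le_mul₀ (by linarith)]
  nlinarith

/-- The comparison runs from `r` up to the middle coefficient, which is at least `2 ^ n / (n + 1) ≥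
2 ^ n / n²`. The `u ≤ τ / 2` steps cost a factor `(1 - x) ^ u ≥ exp (-2 x u)` with `x u ≤ τ² / n ≤
a² log n`, that is, at least `n ^ (-2 a²)`. -/
theorem le_choose {a : ℝ} {n τ r : ℕ} (hn : 2 ≤ n) (hτ : (τ : ℝ) ^ 2 ≤ a ^ 2 * (n * Real.log n))
    (hτn : 4 * τ ≤ n) (hr : r ≤ n) (hi : IsInspected n τ r) :
    1 / (n : ℝ) ^ (⌈2 * a ^ 2⌉₊ + 2) * 2 ^ n ≤ n.choose r := by
  -- Both the range of inspected weights and the binomial coefficients are symmetric under `r ↦ n -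
  -- r`.
  wlog h : 2 * r ≤ n generalizing r
  · have := this (r := n - r) (by omega) ⟨by have := hi.2; omega, by have := hi.1; omega⟩ (by omega)
    rwa [Nat.choose_symm hr] at this
  have hn0 : (0 : ℝ) < n := by exact_mod_cast (by omega : 0 < n)
  have hn1 : (1 : ℝ) ≤ n := by exact_mod_cast (by omega : 1 ≤ n)
  have h2 : (n : ℝ) ≤ 2 * r + τ := by exact_mod_cast hi.2
  have h3 : 2 * (r : ℝ) ≤ n := by exact_mod_cast h
  have h4 : 4 * (τ : ℝ) ≤ n := by exact_mod_cast hτn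
  -- Since `2 r ≥ n - τ`, the ratio `r / (n - r)` is at least `(n - τ) / (n + τ) ≥ 1 - 2 τ / n`; and
  -- `4 τ ≤ n` gives `x ≤ 1 / 2`.
  set x : ℝ := 2 * τ / n with hx
  have hx0 : 0 ≤ x := by positivity
  have hx1 : x ≤ 1 / 2 := by rw [hx, div_le_iff₀ hn0]; linarith
  have hxn : x * n = 2 * τ := by rw [hx]; field_simp
  obtain ⟨u, hu⟩ : ∃ u, n / 2 = r + u := ⟨n / 2 - r, by omega⟩
  have hu2 : 2 * (u : ℝ) ≤ τ := by
    have : 2 * u ≤ τ := by have := hi.2; omega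
    exact_mod_cast this
  have h5 := pow_mul_choose_le (n := n) (r := r) (q := 1 - x) (by linarith) (by nlinarith) u (by omega)
  rw [← hu] at h5
  have h6 : Real.exp (-(2 * x)) ^ u ≤ (1 - x) ^ u :=
    pow_le_pow_left₀ (Real.exp_pos _).le (exp_neg_two_mul_le hx0 hx1) u
  have hlog : 0 ≤ Real.log n := Real.log_nonneg hn1
  have h7 : 1 / (n : ℝ) ^ ⌈2 * a ^ 2⌉₊ ≤ Real.exp (-(2 * x)) ^ u := by
    rw [← Real.exp_nat_mul, one_div, ← Real.rpow_natCast, ← Real.rpow_neg hn0.le,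
      Real.rpow_def_of_pos hn0]
    refine Real.exp_le_exp.2 ?_
    have h8 : 2 * a ^ 2 ≤ ⌈2 * a ^ 2⌉₊ := Nat.le_ceil _
    have h9 : x * u ≤ a ^ 2 * Real.log n := by
      have : x * u * n ≤ a ^ 2 * Real.log n * n := by nlinarith
      exact le_of_mul_le_mul_right this hn0
    nlinarith [mul_le_mul_of_nonneg_right h8 hlog]
  have h10 := two_pow_le_mul_choose n
  have hpos : (0 : ℝ) ≤ n.choose (n / 2) := by positivity
  have h11 : (n : ℝ) + 1 ≤ (n : ℝ) ^ 2 := by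
    have : (2 : ℝ) ≤ n := by exact_mod_cast hn
    nlinarith
  calc 1 / (n : ℝ) ^ (⌈2 * a ^ 2⌉₊ + 2) * 2 ^ n
      ≤ 1 / (n : ℝ) ^ (⌈2 * a ^ 2⌉₊ + 2) * (n ^ 2 * n.choose (n / 2)) := by
        gcongr
        exact h10.trans (mul_le_mul_of_nonneg_right h11 hpos)
    _ = 1 / (n : ℝ) ^ ⌈2 * a ^ 2⌉₊ * n.choose (n / 2) := by rw [pow_add]; field_simp
    _ ≤ (1 - x) ^ u * n.choose (n / 2) := mul_le_mul_of_nonneg_right (h7.trans h6) hpos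
    _ ≤ _ := h5

end Binomial

/-! ## The bounds for large dimension -/

section Quantitative

/-- The choice is `M = n ^ E` with `E = (3 C + 3) D`: `3 C D` of the exponent covers the `m`
examples, and the remaining `3 D` covers the lists of top sets and all smaller quantities. As `M ≥
1000`, the constants are absorbed and the time is at most `M ^ 18`. -/
theorem exists_bounds {n D C τ : ℕ} (hn : 1000 ≤ n) (hD : 1 ≤ D) (hDn : D ≤ n) (hτ : τ ≤ n) :
    ∃ M L, Bounds n D (n ^ (3 * C * D)) M L ∧ 3 * C * D + 1 ≤ M ∧ τ ≤ M ∧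
      20000 * M ^ 8 * (1 + 4 * L) ^ 2 ≤ n ^ (20 * ((3 * C + 3) * D)) := by
  set E := (3 * C + 3) * D with hE
  have hE3 : E = 3 * C * D + 3 * D := by rw [hE]; ring
  have h1 : 1 ≤ n := by omega
  have h2 : 2 ≤ n := by omega
  have hpow : ∀ i, i + 1 ≤ E → n ^ i + 1 ≤ n ^ E := by
    intro i hi
    have h3 : n ^ (i + 1) ≤ n ^ E := Nat.pow_le_pow_right h1 hi
    have h4 : 1 ≤ n ^ i := Nat.one_le_pow _ _ h1
    have h5 : n ^ i * 2 ≤ n ^ i * n := Nat.mul_le_mul_left _ h2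
    rw [pow_succ] at h3
    omega
  have hnE : n ^ 2 + 1 ≤ n ^ E := hpow 2 (by omega)
  have hn2 : 1000 * n ≤ n ^ 2 := by rw [sq]; exact Nat.mul_le_mul_right _ hn
  refine ⟨n ^ E, 200 * (n ^ E) ^ 3, ⟨h1, by omega, by omega, by omega, hpow D (by omega), ?_,
    hpow _ (by omega), rfl⟩, ?_, by omega, ?_⟩
  · have h3 : D + 1 ≤ n ^ D := Nat.lt_pow_self (by omega)
    have h4 : (D + 1) * n ^ D ≤ n ^ D * n ^ D := Nat.mul_le_mul_right _ h3
    rw [← pow_add] at h4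
    have := hpow (D + D) (by omega)
    omega
  · have h3 : 3 * C * D < n ^ (3 * C * D) := Nat.lt_pow_self (by omega)
    have := hpow (3 * C * D) (by omega)
    omega
  · set M := n ^ E with hM
    have hM0 : 1000 ≤ M := by omega
    have hM3 : 1 ≤ M ^ 3 := Nat.one_le_pow _ _ (by omega)
    rw [mul_comm 20, pow_mul, ← hM]
    calc 20000 * M ^ 8 * (1 + 4 * (200 * M ^ 3)) ^ 2 ≤ 1000 ^ 2 * M ^ 8 * (1000 * M ^ 3) ^ 2 := by
          gcongr
          · norm_num
          · omega
      _ ≤ M ^ 2 * M ^ 8 * (M * M ^ 3) ^ 2 := by gcongr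
      _ = M ^ 18 := by ring
      _ ≤ M ^ 20 := Nat.pow_le_pow_right (by omega) (by norm_num)

/-- Change of base: `n ^ (k D) = exp (k D log n)`, and division by `log 2` passes to base `2`. The
term `t² / n ≥ 0` only enlarges the bound. -/
theorem natPow_le_rpow {n D k : ℕ} {d t : ℝ} (hn : 2 ≤ n) (hD : (D : ℝ) ≤ d) :
    ((n ^ (k * D) : ℕ) : ℝ) ≤ (2 : ℝ) ^ (k / Real.log 2 * (d * Real.log n + t ^ 2 / n)) := by
  have hn0 : (0 : ℝ) < n := by exact_mod_cast (by omega : 0 < n)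
  have hlog2 : 0 < Real.log 2 := Real.log_pos (by norm_num)
  have hlog : 0 ≤ Real.log n := Real.log_nonneg (by exact_mod_cast (by omega : 1 ≤ n))
  push_cast
  rw [← Real.rpow_natCast, Real.rpow_def_of_pos hn0, Real.rpow_def_of_pos (by norm_num : (0 : ℝ) < 2)]
  refine Real.exp_le_exp.2 ?_
  have h1 : Real.log 2 * (k / Real.log 2 * (d * Real.log n + t ^ 2 / n)) =
      k * (d * Real.log n + t ^ 2 / n) := by field_simp
  rw [h1]
  push_cast
  have h2 : (D : ℝ) * Real.log n ≤ d * Real.log n + t ^ 2 / n := by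
    have : 0 ≤ t ^ 2 / n := by positivity
    have := mul_le_mul_of_nonneg_right hD hlog
    linarith
  have hk : (0 : ℝ) ≤ k := by positivity
  nlinarith [mul_le_mul_of_nonneg_left h2 hk]

/-- Since `m κ ≥ n ^ (2 c₀ + 30 D)`, each of the four contributions is at most `n ^ (-4)`, and `4 (n
+ 1) / n ^ 4 ≤ 1 / n`. -/
theorem failure_le {n D C c₀ T : ℕ} (hn : 1000 ≤ n) (hD : 1 ≤ D) (hC : c₀ + 10 ≤ C)
    (hT : T ≤ n ^ (2 * D)) (hq : (n : ℝ) ^ 4 * (47 / 50) ^ n ≤ 1) :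
    ((n : ℝ) + 1) * (T * ((16 * (n : ℝ) ^ (14 * D) + 4) /
        (((n ^ (3 * C * D) : ℕ) : ℝ) * (1 / (n : ℝ) ^ c₀))) + (47 / 50) ^ n +
      n * (16000004 / (((n ^ (3 * C * D) : ℕ) : ℝ) * (1 / (n : ℝ) ^ c₀))) +
      n * ((1600 / (1 / (n : ℝ) ^ c₀) ^ 2 + 4) /
        (((n ^ (3 * C * D) : ℕ) : ℝ) * (1 / (n : ℝ) ^ c₀)))) ≤ 1 / n := by
  have hnR : (1000 : ℝ) ≤ n := by exact_mod_cast hn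
  have hn0 : (0 : ℝ) < n := by linarith
  have hn1 : (1 : ℝ) ≤ n := by linarith
  have hTR : (T : ℝ) ≤ (n : ℝ) ^ (2 * D) := by exact_mod_cast hT
  -- This is where `C ≥ c₀ + 10` and `D ≥ 1` enter: the exponent of `m` exceeds that of `1 / κ` by
  -- at least `2 c₀ + 30 D`.
  obtain ⟨y, hy⟩ : ∃ y, 3 * C * D = 3 * c₀ + 30 * D + y := by
    have h1 : 3 * (c₀ + 10) * D ≤ 3 * C * D := by gcongr
    have h2 : c₀ ≤ c₀ * D := Nat.le_mul_of_pos_right _ hD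
    have h3 : 3 * (c₀ + 10) * D = 3 * (c₀ * D) + 30 * D := by ring
    exact ⟨3 * C * D - (3 * c₀ + 30 * D), by omega⟩
  set Q : ℝ := ((n ^ (3 * C * D) : ℕ) : ℝ) * (1 / (n : ℝ) ^ c₀) with hQ
  have hQge : (n : ℝ) ^ (2 * c₀ + 30 * D) ≤ Q := by
    rw [hQ, hy]
    push_cast
    rw [show 3 * c₀ + 30 * D + y = 2 * c₀ + 30 * D + y + c₀ by ring, pow_add _ _ c₀, mul_one_div,
      mul_div_cancel_right₀ _ (by positivity)]
    exact pow_le_pow_right₀ hn1 (by omega)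
  have hn3 : (1000 : ℝ) ^ 3 ≤ (n : ℝ) ^ 3 := by gcongr
  have key : ∀ (Z : ℝ) (i : ℕ), Z ≤ n ^ i → i + 4 ≤ 2 * c₀ + 30 * D → Z / Q ≤ 1 / (n : ℝ) ^ 4 := by
    intro Z i hZ hi
    have hQ0 : 0 < Q := lt_of_lt_of_le (by positivity) hQge
    rw [div_le_div_iff₀ hQ0 (by positivity), one_mul]
    calc Z * (n : ℝ) ^ 4 ≤ (n : ℝ) ^ i * (n : ℝ) ^ 4 := by gcongr
      _ = (n : ℝ) ^ (i + 4) := by rw [pow_add]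
      _ ≤ (n : ℝ) ^ (2 * c₀ + 30 * D) := pow_le_pow_right₀ hn1 hi
      _ ≤ Q := hQge
  have hp14 : (1 : ℝ) ≤ (n : ℝ) ^ (14 * D) := one_le_pow₀ hn1
  have b1 : T * ((16 * (n : ℝ) ^ (14 * D) + 4) / Q) ≤ 1 / (n : ℝ) ^ 4 := by
    rw [← mul_div_assoc]
    refine key _ (2 * D + 14 * D + 1) ?_ (by omega)
    rw [pow_succ, pow_add, mul_assoc]
    gcongr
    nlinarith
  have b2 : (47 / 50 : ℝ) ^ n ≤ 1 / (n : ℝ) ^ 4 := by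
    rw [le_div_iff₀ (by positivity), mul_comm]; exact hq
  have b3 : n * (16000004 / Q) ≤ 1 / (n : ℝ) ^ 4 := by
    rw [← mul_div_assoc]
    refine key _ (1 + 3) ?_ (by omega)
    rw [pow_add, pow_one]
    gcongr
    linarith
  have b4 : n * ((1600 / (1 / (n : ℝ) ^ c₀) ^ 2 + 4) / Q) ≤ 1 / (n : ℝ) ^ 4 := by
    rw [← mul_div_assoc]
    refine key _ (1 + (2 * c₀ + 3)) ?_ (by omega)
    have h1 : 1600 / (1 / (n : ℝ) ^ c₀) ^ 2 = 1600 * (n : ℝ) ^ (2 * c₀) := by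
      rw [div_pow, one_pow, div_div_eq_mul_div, div_one, ← pow_mul, mul_comm c₀]
    have h2 : (1 : ℝ) ≤ (n : ℝ) ^ (2 * c₀) := one_le_pow₀ hn1
    rw [h1, pow_add, pow_one, pow_add]
    gcongr
    nlinarith
  calc _ ≤ ((n : ℝ) + 1) * (1 / (n : ℝ) ^ 4 + 1 / (n : ℝ) ^ 4 + 1 / (n : ℝ) ^ 4 + 1 / (n : ℝ) ^ 4) := by
        gcongr
    _ = 4 * (n + 1) / (n : ℝ) ^ 4 := by ring
    _ ≤ 1 / n := by
        rw [div_le_div_iff₀ (by positivity) hn0]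
        have : (n : ℝ) ^ 4 = n * n * (n * n) := by ring
        nlinarith [mul_pos hn0 hn0, mul_le_mul hnR hnR (by norm_num) hn0.le]

/-- Success follows from goodness of every inspected slice, so failure lies in a union of at most `n
+ 1` events of small probability; only monotonicity of the measure is applied to the event of
failure itself. -/
theorem tapeMeasure_not_succeeds_le {n C c₀ : ℕ} {t d : ℝ} {f : Cube n → ℤˣ} (hn : 1000 ≤ n)
    (hq : (n : ℝ) ^ 4 * (47 / 50) ^ n ≤ 1) (hd : 1 ≤ d) (hdn : d ≤ n / 4) (htn : t ≤ n / 4)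
    (hc₀ : 1 ≤ c₀) (hC : c₀ + 10 ≤ C)
    (hbin : ∀ r ≤ n, IsInspected n ⌊t⌋₊ r → 1 / (n : ℝ) ^ c₀ * 2 ^ n ≤ n.choose r)
    (hf : IsConcentrated f t d (1 / 2)) :
    tapeMeasure n {ω | ¬ Succeeds C t d f
      ((2 : ℝ) ^ (((20 * (3 * C + 3) : ℕ) : ℝ) / Real.log 2 * (d * Real.log n + t ^ 2 / n)))
      (1 / (n : ℝ) ^ (c₀ + 1)) ω} ≤ ENNReal.ofReal (1 / (n : ℝ)) := by
  classical
  set D := ⌊d⌋₊ with hD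
  set τ := ⌊t⌋₊ with hτ
  have hnR : (1000 : ℝ) ≤ n := by exact_mod_cast hn
  have hn0 : (0 : ℝ) < n := by linarith
  have hD1 : 1 ≤ D := Nat.le_floor (by simpa using hd)
  have hDd : (D : ℝ) ≤ d := Nat.floor_le (by linarith)
  have hD4 : 4 * D ≤ n := by
    have : 4 * (D : ℝ) ≤ n := by linarith
    exact_mod_cast this
  obtain ⟨r₀, hr₀, hlow, hup, htail⟩ := hf
  have ht0 : 0 ≤ t := by linarith
  have hτt : (τ : ℝ) ≤ t := Nat.floor_le ht0
  have hτ4 : 4 * τ ≤ n := by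
    have : 4 * (τ : ℝ) ≤ n := by linarith
    exact_mod_cast this
  -- The difference `|2 r₀ - n|` is an integer at most `t`, hence at most `⌊t⌋`: rounding `t` down
  -- excludes no slice.
  have hi₀ : IsInspected n τ r₀ := by
    constructor
    · rcases le_total (2 * r₀) n with h | h
      · omega
      · have h1 : 2 * r₀ - n ≤ τ := Nat.le_floor (by
          rw [Nat.cast_sub h]; push_cast; linarith)
        omega
    · rcases le_total n (2 * r₀) with h | h
      · omega
      · have h1 : n - 2 * r₀ ≤ τ := Nat.le_floor (by
          rw [Nat.cast_sub h]; push_cast; linarith)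
        omega
  -- The total weight is `1` since `f` takes the values `±1`, and the tail is below `1 / 2`.
  have hw₀ : 1 / 2 < ∑ L ∈ lowLists n D, listWeight r₀ (toReal f) L := by
    have := sum_listWeight_le_of_concentrated hr₀ (by linarith) htail
    rw [sliceInner_toReal_self hr₀] at this
    refine lt_of_le_of_lt ?_ this
    norm_num
  obtain ⟨M, L, hp, hCD, hτM, htime⟩ := exists_bounds (C := C) (τ := τ) hn hD1 (by omega) (by omega)
  set m := n ^ (3 * C * D) with hm
  have hm0 : 0 < m := Nat.pow_pos (by omega)
  set κ : ℝ := 1 / (n : ℝ) ^ c₀ with hκ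
  have hκ0 : 0 < κ := by positivity
  have hκ2 : κ ≤ 1 / 2 := by
    rw [hκ]
    refine one_div_le_one_div_of_le (by norm_num) ?_
    have : (n : ℝ) ≤ (n : ℝ) ^ c₀ := le_self_pow₀ (by linarith) (by omega)
    linarith
  -- Goodness is required of all inspected slices, because the slice on which the learner stops
  -- depends on the examples.
  have hsub : {ω : Tape n | ¬ Succeeds C t d f
      ((2 : ℝ) ^ (((20 * (3 * C + 3) : ℕ) : ℝ) / Real.log 2 * (d * Real.log n + t ^ 2 / n)))
      (1 / (n : ℝ) ^ (c₀ + 1)) ω} ⊆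
      ⋃ r ∈ (Finset.range (n + 1)).filter (IsInspected n τ),
        {ω | ¬ IsGoodOn f ω D m (startAt n τ D m r) r} := by
    intro ω hω
    by_contra hcon
    refine hω ?_
    have hgood : ∀ r ≤ n, IsInspected n τ r → IsGoodOn f ω D m (startAt n τ D m r) r := by
      intro r hr hi
      by_contra h
      refine hcon (Set.mem_iUnion₂.2 ⟨r, ?_, h⟩)
      exact Finset.mem_filter.2 ⟨Finset.mem_range.2 (by omega), hi⟩
    obtain ⟨H, e₁, c₁, hrun, herr⟩ := exists_runs_learner hp hm hCD hD1 hτM (by omega) hr₀ hi₀ hw₀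
      (fun r hr hi => ⟨by have := hi.1; have := hi.2; omega, hbin r hr hi⟩) hgood
    obtain ⟨time, htime', heval⟩ := hrun 0
    refine ⟨H, ⟨e₁, c₁, time⟩, heval, ?_, ?_⟩
    · have h1 : time ≤ n ^ (20 * (3 * C + 3) * D) := by
        rw [mul_assoc]; omega
      have h2 : (time : ℝ) ≤ ((n ^ (20 * (3 * C + 3) * D) : ℕ) : ℝ) := by exact_mod_cast h1
      exact h2.trans (natPow_le_rpow (by omega) hDd)
    · refine herr.trans ?_
      have : 1 / (n : ℝ) ^ (c₀ + 1) ≤ 15 / 1000 * κ := by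
        rw [hκ, pow_succ, ← one_div_mul_one_div, mul_comm]
        refine mul_le_mul_of_nonneg_right ?_ (by positivity)
        rw [div_le_iff₀ hn0]; linarith
      linarith
  have hT : (topSeqs n (D + 1)).length ≤ n ^ (2 * D) := by
    refine (length_topSeqs_le (D := D) (by omega) (D + 1) le_rfl).trans ?_
    have : D + 1 ≤ n ^ D := Nat.lt_pow_self (by omega)
    calc (D + 1) * n ^ D ≤ n ^ D * n ^ D := Nat.mul_le_mul_right _ this
      _ = n ^ (2 * D) := by rw [← pow_add]; congr 1; ring
  refine (measure_mono hsub).trans ((measure_biUnion_finset_le _ _).trans ?_)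
  refine (Finset.sum_le_card_nsmul _ _ (ENNReal.ofReal
    ((topSeqs n (D + 1)).length * ((16 * (n : ℝ) ^ (14 * D) + 4) / (m * κ)) + (47 / 50) ^ n +
      n * (16000004 / (m * κ)) + n * ((1600 / κ ^ 2 + 4) / (m * κ)))) fun r hr => ?_).trans ?_
  · obtain ⟨h1, h2⟩ := Finset.mem_filter.1 hr
    have hrn : r ≤ n := by have := Finset.mem_range.1 h1; omega
    have h3 := choose_le_half (n := n) (r := r) (by omega)
    have h4 : (0 : ℝ) < 2 ^ n := by positivity
    exact tapeMeasure_not_isGoodOn_le hκ0 hrn (hbin r hrn h2) (by nlinarith) hm0 (by omega)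
  · have hcard : ((Finset.range (n + 1)).filter (IsInspected n τ)).card ≤ n + 1 :=
      (Finset.card_filter_le _ _).trans (by simp)
    refine (nsmul_le_nsmul_left zero_le hcard).trans ?_
    rw [nsmul_eq_mul, ← ENNReal.ofReal_natCast, ← ENNReal.ofReal_mul (by positivity)]
    refine ENNReal.ofReal_le_ofReal ?_
    have := failure_le (c₀ := c₀) (C := C) hn hD1 hC hT hq
    push_cast at this ⊢
    rw [hm]
    push_cast
    exact this

end Quantitative

end SliceLearner


/-! ### The asymptotic statement -/

theorem mainTheorem6 (a : ℝ) :
    ∃ c C₀ : ℕ, ∀ C : ℕ, C₀ ≤ C → ∃ K : ℝ, ∀ t d : ℕ → ℝ,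
      Asymptotics.IsBigOWith a Filter.atTop t (fun n => Real.sqrt (n * Real.log n)) →
      Asymptotics.IsLittleO Filter.atTop d (fun n => (n : ℝ) / Real.log n) →
      (∀ᶠ n in Filter.atTop, 1 ≤ d n) →
      ∀ᶠ n : ℕ in Filter.atTop, ∀ f : SliceLearner.Cube n → ℤˣ,
        SliceLearner.IsConcentrated f (t n) (d n) (1 / 2) →
        SliceLearner.tapeMeasure n
          {ω | ¬ SliceLearner.Succeeds C (t n) (d n) f
            ((2 : ℝ) ^ (K * (d n * Real.log n + t n ^ 2 / n))) (1 / (n : ℝ) ^ c) ω}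
          ≤ ENNReal.ofReal (1 / (n : ℝ)) := by
  -- Here `c₀ = ⌈2 a²⌉ + 2` is the exponent of the density of the slices; one more power of `n`
  -- absorbs the constant `15 / 1000`, and `C ≥ c₀ + 10` is the condition of `failure_le`.
  refine ⟨⌈2 * a ^ 2⌉₊ + 2 + 1, ⌈2 * a ^ 2⌉₊ + 2 + 10, fun C hC =>
    ⟨((20 * (3 * C + 3) : ℕ) : ℝ) / Real.log 2, fun t d ht hd hd1 => ?_⟩⟩
  have hlog : Filter.Tendsto (fun n : ℕ => Real.log n) Filter.atTop Filter.atTop :=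
    Real.tendsto_log_atTop.comp tendsto_natCast_atTop_atTop
  have hlogn : Filter.Tendsto (fun n : ℕ => Real.log n / n) Filter.atTop (nhds 0) :=
    (Real.isLittleO_log_id_atTop.tendsto_div_nhds_zero).comp tendsto_natCast_atTop_atTop
  -- The constant makes `a² n log n ≤ (n / 4)²`, hence `t ≤ n / 4`. Together with `d ≤ n / 4` this
  -- ensures that level `⌊d⌋` exists on every inspected slice.
  have hsmall : ∀ᶠ n : ℕ in Filter.atTop, Real.log n / n < 1 / (16 * a ^ 2 + 1) :=
    hlogn.eventually_lt_const (by positivity)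
  have hq := (tendsto_pow_const_mul_const_pow_of_abs_lt_one 4
    (show |(47 / 50 : ℝ)| < 1 by rw [abs_of_pos] <;> norm_num)).eventually_le_const
    (show (0 : ℝ) < 1 by norm_num)
  filter_upwards [Filter.eventually_ge_atTop 1000, hq, ht.bound,
    hd.bound (show (0 : ℝ) < 1 / 4 by norm_num), hd1, hlog.eventually_ge_atTop 1, hsmall]
    with n hn hq ht hd hd1 hlog1 hsmall f hf
  have hnR : (1000 : ℝ) ≤ n := by exact_mod_cast hn
  have hn0 : (0 : ℝ) < n := by linarith
  have hnl : 0 ≤ (n : ℝ) * Real.log n := by positivity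
  rw [Real.norm_eq_abs, Real.norm_eq_abs, abs_of_nonneg (Real.sqrt_nonneg _)] at ht
  have ht2 : t n ^ 2 ≤ a ^ 2 * (n * Real.log n) := by
    rw [← Real.sq_sqrt hnl, ← mul_pow, ← sq_abs]
    exact pow_le_pow_left₀ (abs_nonneg _) ht 2
  have hd4 : d n ≤ n / 4 := by
    rw [Real.norm_eq_abs, Real.norm_eq_abs, abs_of_nonneg (div_nonneg hn0.le (by linarith))] at hd
    have h1 : (n : ℝ) / Real.log n ≤ n := div_le_self hn0.le hlog1
    have := le_abs_self (d n)
    linarith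
  have ht4 : t n ≤ n / 4 := by
    rw [div_lt_div_iff₀ hn0 (by positivity)] at hsmall
    have h1 : t n ^ 2 ≤ ((n : ℝ) / 4) ^ 2 := by
      refine ht2.trans ?_
      nlinarith
    exact le_of_sq_le_sq h1 (by positivity)
  -- Some weight lies between `n / 2 - t / 2` and `n / 2 + t / 2`, which is impossible for negative
  -- `t`.
  have ht0 : 0 ≤ t n := by
    obtain ⟨r, -, h1, h2, -⟩ := hf
    linarith
  have hτt : (⌊t n⌋₊ : ℝ) ≤ t n := Nat.floor_le ht0
  refine SliceLearner.tapeMeasure_not_succeeds_le hn hq hd1 hd4 ht4 (by omega) hC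
    (fun r hr hi => SliceLearner.le_choose (by omega) ?_ ?_ hr hi) hf
  · exact le_trans (pow_le_pow_left₀ (by positivity) hτt 2) ht2
  · have : 4 * (⌊t n⌋₊ : ℝ) ≤ n := by linarith
    exact_mod_cast this
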